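/- Let $m,n,p\ge 2$ and $(k_0,k_1,k_2)=(m,n,p)$, and put $(M,N,P)=(2m+1,2n+1,2p+1)$. Indices $i$ are taken modulo $3$. Setup. Let $X_0$ be a bouquet of three oriented loops $x_0=x,\ x_1=y,\ x_2=z$, and let $A=\pi_1(X_0)=\langle x,y,z\rangle$ be the free group of rank $3$. Let $X_{1/4}$ be the graph with vertices $i_+,i_-$ ($i\in\mathbb Z/3$) and with one edge joining $i_s$ to $(i+1)_t$ for all $i$ and all signs $s,t$. Map $X_{1/4}$ to $X_0$ by collapsing each edge $\{i_+,(i+1)_-\}$ to the vertex, sending the edge from $(i+1)_+$ to $i_-$ to $x_i$, and sending each of the edges from $i_+$ to $(i+1)_+$ and from $i_-$ to $(i+1)_-$ to $x_i^{k_i}$. Fix a base vertex $v$ of $X_{1/4}$, and let $C\le A$ be the image of $\pi_1(X_{1/4},v)$ (this map is injective, and $A$, $C$ are the groups of the splitting $A*_CB$ of the Artin group $\mathrm{Art}_{MNP}$). The deck transformation $i_\pm\mapsto i_\mp$ of $X_{1/4}$, together with a choice of an edge path from $v$ to its translate, induces an automorphism $\beta$ of $C=\pi_1(X_{1/4},v)$.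 Let $\rho:Y\to X_0$ be the combinatorial immersion obtained from $X_{1/4}\to X_0$ by collapsing the edges that are sent to the vertex and subdividing those sent to $x_i^{k_i}$ into paths of length $k_i$. Let $y_0$ be the image of $v$ in $Y$. The oppressive set $\mathcal A_\rho\subseteq A$ consists of the elements represented by $\rho(\mu_1)\cdot\rho(\mu_2)$, where $\mu_1$ is a nontrivial simple non-closed path in $Y$ from $y_0$ to some vertex $y_1$, where $\mu_2$ is either trivial (and $y_2:=y_0$) or a simple non-closed path in $Y$ from some vertex $y_2\neq y_0$ to $y_0$, and where $y_1\ne y_2$. Here a path is an immersed edge path, and a path with successive vertices $v_0,\dots,v_\ell$ is simple if $v_0,\dots,v_{\ell-1}$ are distinct. The von Dyck group $D(M,N,P)$ is the subgroup of index two, consisting of the products of an even number of reflections, in the group generated by the reflections in the sides of a triangle with angles $\pi/M,\pi/N,\pi/P$. Statement. We have $\frac1M+\frac1N+\frac1P<1$, so that the triangle lies in the hyperbolic plane, and there is a surjective homomorphism $\phi:A\to\bar A:=D(M,N,P)$ onto this hyperbolic von Dyck group such that, for every choice of $v$: 1. $\bar C:=\phi(C)$ is a free group of rank $2$ and is malnormal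 in $\bar A$, that is, $g^{-1}\bar Cg\cap\bar C=\{1\}$ for every $g\in\bar A\setminus\bar C$; 2. $\phi$ separates $C$ from $\mathcal A_\rho$, that is, $\phi(g)\notin\phi(C)$ for every $g\in\mathcal A_\rho$; 3. for every choice of the path defining $\beta$, the automorphism $\beta:C\to C$ projects to an automorphism $\bar\beta:\bar C\to\bar C$, that is, $\bar\beta(\phi(h))=\phi(\beta(h))$ for all $h\in C$. -/

import Mathlib

/-! ### Graphs, edge paths, fundamental groups -/

/-- A graph (a one-dimensional CW complex; loops and multiple edges are allowed) with vertex set `V`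
and edge set `E`, each edge being given a reference orientation. -/
structure OGraph (V E : Type*) where
  src : E → V
  tgt : E → V

namespace OGraph

variable {V E S : Type*} (G : OGraph V E)

/-- Initial vertex of an oriented edge: `(e, true)` is `e` with its reference orientation,
`(e, false)` is `e` traversed backwards. -/
def start (a : E × Bool) : V := if a.2 then G.src a.1 else G.tgt a.1

/-- Terminal vertex of an oriented edge. -/
def finish (a : E × Bool) : V := if a.2 then G.tgt a.1 else G.src a.1

/-- `G.IsWalk v w v'`: the list `w` of oriented edges is an edge path from `v` to `v'`. -/
def IsWalk : V → List (E × Bool) → V → Prop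
  | v, [], v' => v = v'
  | v, a :: w, v' => G.start a = v ∧ IsWalk (G.finish a) w v'

/-- A simple path: an immersed (that is, backtrack-free) edge path `v₀, v₁, …, vₙ` whose vertices
`v₀, …, vₙ₋₁` are distinct. -/
def IsSimplePath (v : V) (w : List (E × Bool)) (v' : V) : Prop :=
  G.IsWalk v w v' ∧ FreeGroup.IsReduced w ∧ (w.map G.start).Nodup

variable {G} in
theorem IsWalk.append {v v' v'' : V} {w w' : List (E × Bool)} (h : G.IsWalk v w v')
    (h' : G.IsWalk v' w' v'') : G.IsWalk v (w ++ w') v'' := by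
  induction w generalizing v with
  | nil => cases h; exact h'
  | cons a w ih => exact ⟨h.1, ih h.2⟩

variable {G} in
theorem IsWalk.invRev {v v' : V} {w : List (E × Bool)} (h : G.IsWalk v w v') :
    G.IsWalk v' (FreeGroup.invRev w) v := by
  induction w generalizing v with
  | nil => cases h; exact rfl
  | cons a w ih =>
    rw [FreeGroup.invRev_cons]
    refine (ih h.2).append ?_
    obtain ⟨e, b⟩ := a
    have h1 := h.1
    cases b <;> exact ⟨rfl, h1⟩

/-- The fundamental group of `G` at `v`: closed edge paths at `v` up to insertion and deletion of
backtracks. The homotopy class of a closed edge path at `v` is recorded by its class in the free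
group on the edges. -/
def fundGroup (v : V) : Subgroup (FreeGroup E) where
  carrier := {g | ∃ w, G.IsWalk v w v ∧ FreeGroup.mk w = g}
  one_mem' := ⟨[], rfl, rfl⟩
  mul_mem' := by
    rintro _ _ ⟨w, hw, rfl⟩ ⟨w', hw', rfl⟩
    exact ⟨w ++ w', hw.append hw', FreeGroup.mul_mk.symm⟩
  inv_mem' := by
    rintro _ ⟨w, hw, rfl⟩
    exact ⟨FreeGroup.invRev w, hw.invRev, FreeGroup.inv_mk.symm⟩

/-- The oppressive set of a combinatorial map `ρ` from the based graph `(G, y₀)` to the bouquet of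
loops indexed by `S`, where `ρ` sends the oriented edge `e` to the oriented loop `c e`. The
fundamental group of the bouquet is `FreeGroup S`. The set consists of the classes of
the concatenations `ρ(μ₁) · ρ(μ₂)`, where `μ₁` is a nontrivial non-closed simple path from `y₀` to
some `y₁`, where `μ₂` is either trivial (and then `y₂ = y₀`) or a non-closed simple path from some
`y₂` to `y₀`, and where `y₁ ≠ y₂`. -/
def oppressiveSet (c : E → S) (y₀ : V) : Set (FreeGroup S) :=
  {g | ∃ (μ₁ μ₂ : List (E × Bool)) (y₁ y₂ : V),
    (G.IsSimplePath y₀ μ₁ y₁ ∧ μ₁ ≠ [] ∧ y₁ ≠ y₀) ∧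
    ((μ₂ = [] ∧ y₂ = y₀) ∨ (G.IsSimplePath y₂ μ₂ y₀ ∧ y₂ ≠ y₀)) ∧
    y₁ ≠ y₂ ∧
    g = FreeGroup.map c (FreeGroup.mk μ₁) * FreeGroup.map c (FreeGroup.mk μ₂)}

end OGraph

/-! ### The splitting of the triangle Artin group with odd labels

The vertices of the defining triangle are `0, 1, 2 : Fin 3` (for `a, b, c`); the edge `{i, i+1}`,
oriented from `i` to `i + 1`, has the odd label `2 * k i + 1`. The bouquet `X₀` has one loop for each
edge of the triangle, and `A = π₁(X₀) = FreeGroup (Fin 3)`; its generators `0, 1, 2` are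
`x, y, z`. -/

/-- The vertices `i₊ = (i, true)` and `i₋ = (i, false)` of the horizontal graph at level one
quarter. -/
abbrev QuarterVertex : Type := Fin 3 × Bool

/-- The edges of the horizontal graph at level one quarter: `(i, s, t)` is the edge joining the vertex
of sign `s` over `i` to the vertex of sign `t` over `i + 1`. -/
abbrev QuarterEdge : Type := Fin 3 × Bool × Bool

/-- The horizontal graph `X_{1/4}` at level one quarter, all labels being odd: over each edge
`{i, i+1}` of the triangle it has the edges `{i₊, (i+1)₋}`, `{i₋, (i+1)₊}` and the edges
`{i₊, (i+1)₊}`, `{i₋, (i+1)₋}`. -/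
def quarterGraph : OGraph QuarterVertex QuarterEdge where
  src e := (e.1, e.2.1)
  tgt e := (e.1 + 1, e.2.2)

/-- The map `X_{1/4} → X₀`: the edge `{i₊, (i+1)₋}` is collapsed, the edge `{i₋, (i+1)₊}`, oriented
towards `i₋`, goes once around the `i`-th loop, and each of `{i₊, (i+1)₊}`, `{i₋, (i+1)₋}`, oriented
towards `i + 1`, goes `k i` times around it. -/
def quarterLabel (k : Fin 3 → ℕ) : QuarterEdge → FreeGroup (Fin 3)
  | (_, true, false) => 1
  | (i, false, true) => (FreeGroup.of i)⁻¹
  | (i, true, true) => FreeGroup.of i ^ k i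
  | (i, false, false) => FreeGroup.of i ^ k i

/-- The homomorphism `C = π₁(X_{1/4}, v) → A` induced by `X_{1/4} → X₀`. -/
def edgeGroupHom (k : Fin 3 → ℕ) (v : QuarterVertex) :
    quarterGraph.fundGroup v →* FreeGroup (Fin 3) :=
  (FreeGroup.lift (quarterLabel k)).comp (quarterGraph.fundGroup v).subtype

/-- The subgroup `C` of `A`. -/
def edgeGroup (k : Fin 3 → ℕ) (v : QuarterVertex) : Subgroup (FreeGroup (Fin 3)) :=
  (edgeGroupHom k v).range

/-! The nontrivial deck transformation of the double cover `X_{1/4} → X_{1/2}`, and the induced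
automorphisms of `C`. -/

/-- The deck transformation on vertices: it exchanges `i₊` and `i₋`. -/
def deckVertex (v : QuarterVertex) : QuarterVertex := (v.1, !v.2)

/-- The deck transformation on edges. -/
def deckEdge : QuarterEdge ≃ QuarterEdge where
  toFun e := (e.1, !e.2.1, !e.2.2)
  invFun e := (e.1, !e.2.1, !e.2.2)
  left_inv e := by simp
  right_inv e := by simp

theorem deck_isWalk {v v' : QuarterVertex} {w : List (QuarterEdge × Bool)}
    (h : quarterGraph.IsWalk v w v') :
    quarterGraph.IsWalk (deckVertex v) (w.map fun a => (deckEdge a.1, a.2)) (deckVertex v') := by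
  induction w generalizing v with
  | nil => cases h; exact rfl
  | cons a w ih =>
    obtain ⟨e, b⟩ := a
    obtain ⟨rfl, h2⟩ := h
    have h3 := ih h2
    cases b <;> exact ⟨rfl, h3⟩

/-- Conjugating the deck transformation by the class of a path `w`: `h ↦ [w] · deck(h) · [w]⁻¹`. -/
def deckConj (w : List (QuarterEdge × Bool)) : MulAut (FreeGroup QuarterEdge) :=
  (FreeGroup.freeGroupCongr deckEdge).trans (MulAut.conj (FreeGroup.mk w))

theorem deckConj_apply (w : List (QuarterEdge × Bool)) (h : FreeGroup QuarterEdge) :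
    deckConj w h = FreeGroup.mk w * FreeGroup.map deckEdge h * (FreeGroup.mk w)⁻¹ := rfl

theorem deckConj_mem {v : QuarterVertex} {w : List (QuarterEdge × Bool)}
    (hw : quarterGraph.IsWalk v w (deckVertex v)) {h : FreeGroup QuarterEdge}
    (hh : h ∈ quarterGraph.fundGroup v) : deckConj w h ∈ quarterGraph.fundGroup v := by
  obtain ⟨u, hu, rfl⟩ := hh
  refine ⟨w ++ (u.map fun a => (deckEdge a.1, a.2)) ++ FreeGroup.invRev w,
    (hw.append (deck_isWalk hu)).append hw.invRev, ?_⟩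
  rw [deckConj_apply, FreeGroup.map.mk, FreeGroup.inv_mk, FreeGroup.mul_mk, FreeGroup.mul_mk]

theorem deckConj_symm_mem {v : QuarterVertex} {w : List (QuarterEdge × Bool)}
    (hw : quarterGraph.IsWalk v w (deckVertex v)) {h : FreeGroup QuarterEdge}
    (hh : h ∈ quarterGraph.fundGroup v) : (deckConj w).symm h ∈ quarterGraph.fundGroup v := by
  obtain ⟨u, hu, rfl⟩ := hh
  have h1 := deck_isWalk ((hw.invRev.append hu).append hw)
  have h2 : deckVertex (deckVertex v) = v := by simp [deckVertex]
  rw [h2] at h1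
  refine ⟨_, h1, ?_⟩
  rw [MulEquiv.eq_symm_apply, deckConj_apply, FreeGroup.map.mk, List.map_map]
  have h3 : ((fun a : QuarterEdge × Bool => (deckEdge a.1, a.2)) ∘
      fun a : QuarterEdge × Bool => (deckEdge a.1, a.2)) = id := by
    funext a
    simp [deckEdge]
  rw [h3, List.map_id, ← FreeGroup.mul_mk, ← FreeGroup.mul_mk, ← FreeGroup.inv_mk]
  group

/-- The automorphism `β` of `C = π₁(X_{1/4}, v)` determined by the deck transformation and the choice of
a path `w` from `v` to its translate. If `g` is the element of `B = π₁(X_{1/2})` for which `w` lifts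
`g⁻¹`, this is the conjugation `h ↦ g⁻¹ h g`; the elements `g` obtained in this way
are exactly those of `B` outside `C`. -/
def twist (v : QuarterVertex) (w : List (QuarterEdge × Bool))
    (hw : quarterGraph.IsWalk v w (deckVertex v)) : MulAut (quarterGraph.fundGroup v) where
  toFun h := ⟨deckConj w h, deckConj_mem hw h.2⟩
  invFun h := ⟨(deckConj w).symm h, deckConj_symm_mem hw h.2⟩
  left_inv h := by simp
  right_inv h := by simp
  map_mul' h h' := by simp

/-! ### The graph obtained from `X_{1/4}` by collapsing and subdividing edges

It is the union of three directed cycles, the `i`-th of length `2 * k i + 1` and mapped combinatorially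
to the `i`-th loop of `X₀`, glued along three vertices. -/

/-- Vertices (and edges) of the disjoint union of the three cycles. -/
abbrev CycleVertex (k : Fin 3 → ℕ) : Type := Σ i : Fin 3, ZMod (2 * k i + 1)

/-- The three branching vertices are `p₀ = {0₊, 1₋}`, `p₁ = {1₊, 2₋}` and `p₂ = {2₊, 0₋}`. The `i`-th
cycle passes through `pᵢ` at time `0`, through `pᵢ₊₁` at time `k i` and through `pᵢ₊₂` at time
`k i + 1`. -/
def branchPosition (k : Fin 3 → ℕ) (i v : Fin 3) : ZMod (2 * k i + 1) :=
  if v = i then 0 else if v = i + 1 then (k i : ZMod (2 * k i + 1)) else (k i : ZMod (2 * k i + 1)) + 1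

/-- Vertices of the collapsed and subdivided graph. -/
def BarVertex (k : Fin 3 → ℕ) : Type :=
  Quot fun s t : CycleVertex k =>
    ∃ v : Fin 3, s.2 = branchPosition k s.1 v ∧ t.2 = branchPosition k t.1 v

/-- The collapsed and subdivided graph; the edge `(i, j)` goes from position `j` to position `j + 1` of
the `i`-th cycle, and is mapped to the `i`-th loop of `X₀`. -/
def barGraph (k : Fin 3 → ℕ) : OGraph (BarVertex k) (CycleVertex k) where
  src e := Quot.mk _ e
  tgt e := Quot.mk _ ⟨e.1, e.2 + 1⟩

/-- The image of a vertex of `X_{1/4}`: `i₊` goes to `pᵢ`, and `i₋` goes to `pᵢ₋₁`. -/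
def toBarVertex (k : Fin 3 → ℕ) (v : QuarterVertex) : BarVertex k :=
  if v.2 then Quot.mk _ ⟨v.1, 0⟩ else Quot.mk _ ⟨v.1 - 1, 0⟩

/-- The oppressive set of `C` in `A` with respect to the combinatorial immersion of the collapsed and
subdivided graph to `X₀`, based at the image of `v`. -/
def triangleOppressiveSet (k : Fin 3 → ℕ) (v : QuarterVertex) : Set (FreeGroup (Fin 3)) :=
  (barGraph k).oppressiveSet Sigma.fst (toBarVertex k v)

/-! ### Von Dyck groups -/

/-- Gram matrix of the outward unit normals of the sides `0, 1, 2` of a triangle whose sides `i` and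
`i + 1` form the angle `π / M i`. If the three angles have sum less than `π`, the form has signature
`(2, 1)` and the triangle is a triangle in the hyperboloid model of the hyperbolic plane. -/
noncomputable def triangleGram (M : Fin 3 → ℕ) : Matrix (Fin 3) (Fin 3) ℝ :=
  Matrix.of fun i j =>
    if i = j then 1
    else if j = i + 1 then -Real.cos (Real.pi / M i)
    else -Real.cos (Real.pi / M j)

/-- The reflection `x ↦ x - 2⟨nᵢ, x⟩ nᵢ` in the side `i`, in the basis `n₀, n₁, n₂` of normals. -/
noncomputable def sideReflection (M : Fin 3 → ℕ) (i : Fin 3) :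
    (Fin 3 → ℝ) ≃ₗ[ℝ] (Fin 3 → ℝ) :=
  Module.reflection (x := (Pi.single i 1 : Fin 3 → ℝ))
    (f := (2 : ℝ) • (Matrix.toBilin' (triangleGram M) (Pi.single i 1)))
    (by simp [Matrix.toBilin'_single, triangleGram])

/-- The von Dyck group `D(M 0, M 1, M 2)`: the index two subgroup, formed by the products of an even
number of reflections, of the group generated by the reflections in the sides of a triangle with angles
`π / M 0`, `π / M 1`, `π / M 2`. -/
def vonDyckGroup (M : Fin 3 → ℕ) : Subgroup ((Fin 3 → ℝ) ≃ₗ[ℝ] (Fin 3 → ℝ)) :=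
  Subgroup.closure {g | ∃ i j : Fin 3, g = sideReflection M i * sideReflection M j}

/-! ### Malnormality and separation -/

/-- `H` is malnormal: `g⁻¹ H g ∩ H` is trivial for each `g` outside `H`. -/
def IsMalnormal {G : Type*} [Group G] (H : Subgroup G) : Prop :=
  ∀ g, g ∉ H → ∀ h ∈ H, g⁻¹ * h * g ∈ H → h = 1

/-- The homomorphism `φ` separates the subgroup `H` from the set `T`. -/
def Separates {G Q : Type*} [Group G] [Group Q] (φ : G →* Q) (H : Subgroup G) (T : Set G) : Prop :=
  ∀ g ∈ T, φ g ∉ H.map φ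

/-! The group acts on the tessellation of the hyperbolic plane by chambers, the translates of the
triangle, realised linearly on the space spanned by the normals. Write `rot i` for the rotation by
twice the angle at the vertex of the sides `i` and `i + 1`; it has odd order `2 * k i + 1`. The
homomorphism sends the `i`-th generator of A to `(rot i)⁻¹ ^ 2`. As the order is odd, the `k i`-th
power of this generator goes to `rot i`, which gives surjectivity.

A gauge transformation by reflections at the vertices of the quarter graph (`quotientHom_walk`)
identifies the image of C, up to conjugation by a reflection, with `treeGroup k true`. This group is
generated by the elements `rot i * (rot j)⁻¹` and preserves a treelike union of chambers: from a
chamber of kind `true` one moves by the `rot j`, from a chamber of kind `false` by their inverses.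
Each branch lies in a region bounded by three walls, and `step_mem_cone` shows that a step carries
the region of an admissible next branch into its own region and multiplies the depth behind the
entry side by at least 3/2. The estimates need only angles of at most π/5. Ping-pong then gives
freeness of rank two (`param_injective`).

Malnormality: the square of a nontrivial element of the tree group is hyperbolic, and its axis runs
through chambers of the tree (`exists_isAxis`). If g conjugates one such element to another, it
carries one axis to the other with its direction. Positivity of roots (`word_single_nonneg`) makes
the triangle a fundamental domain, so a generic axis point forces g to carry some chamber of the
tree to a chamber of the tree. Then g preserves the tree, or it exchanges the two kinds of chambers;
in the latter case the groups of the two trees meet trivially (`treeGroup_true_inf_false`).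

Separation: the collapsed and subdivided graph maps to the Schreier graph of cosets of the tree
group by `place`, and this map is injective on vertices (`place_injective`). An element of the
oppressive set whose image lay in that of C would give the same coset to two distinct vertices.

Descent of β: on the free group of rank two that parametrizes the tree group, the deck
transformation acts, up to gauge, by inverting the two free generators (`edgeClass_deck`). -/

namespace TriangleGroup

/-! ### Reflections and pairings with the sides -/

/-- The space spanned by the normals of the sides of the triangle. -/
abbrev Space : Type := Fin 3 → ℝ

/-- Pairing with the normal of the side `i`. -/
noncomputable def wall (k : Fin 3 → ℕ) (i : Fin 3) : Space →ₗ[ℝ] ℝ :=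
  Matrix.toBilin' (triangleGram fun i => 2 * k i + 1) (Pi.single i 1)

/-- The reflection in the side `i`. -/
noncomputable def refl (k : Fin 3 → ℕ) (i : Fin 3) : Space ≃ₗ[ℝ] Space :=
  sideReflection (fun i => 2 * k i + 1) i

/-- The angle between the sides `i` and `i + 1`. -/
noncomputable def angle (k : Fin 3 → ℕ) (i : Fin 3) : ℝ := Real.pi / (2 * k i + 1)

/-- Twice the cosine of the angle between the sides `i` and `i + 1`. -/
noncomputable def cosine (k : Fin 3 → ℕ) (i : Fin 3) : ℝ := 2 * Real.cos (angle k i)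

theorem add_one_two (i : Fin 3) : i + 1 + 2 = i := by fin_cases i <;> rfl
theorem add_two_one (i : Fin 3) : i + 2 + 1 = i := by fin_cases i <;> rfl
theorem add_two_two (i : Fin 3) : i + 2 + 2 = i + 1 := by fin_cases i <;> rfl
theorem add_one_one (i : Fin 3) : i + 1 + 1 = i + 2 := by fin_cases i <;> rfl

theorem eq_or_eq_add (i j : Fin 3) : j = i ∨ j = i + 1 ∨ j = i + 2 := by
  revert i j; decide

theorem eq_add_of_ne {i j : Fin 3} (h : i ≠ j) : j = i + 1 ∨ j = i + 2 := by
  revert i j; decide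

theorem add_one_ne (i : Fin 3) : i + 1 ≠ i := by revert i; decide
theorem add_two_ne (i : Fin 3) : i + 2 ≠ i := by revert i; decide

section Basic

variable (k : Fin 3 → ℕ)

theorem refl_apply (i : Fin 3) (y : Space) :
    refl k i y = y - (2 * wall k i y) • Pi.single i (1 : ℝ) := by
  simp [refl, sideReflection, Module.reflection_apply, wall]

theorem wall_single (i j : Fin 3) :
    wall k i (Pi.single j 1) = triangleGram (fun i => 2 * k i + 1) i j := by
  simp [wall, Matrix.toBilin'_single]

theorem wall_single_self (i : Fin 3) : wall k i (Pi.single i 1) = 1 := by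
  simp [wall_single, triangleGram]

theorem wall_single_add_one (i : Fin 3) :
    wall k i (Pi.single (i + 1) 1) = -(cosine k i / 2) := by
  rw [wall_single]
  simp [triangleGram, cosine, angle, (add_one_ne i).symm]

theorem wall_add_one_single (i : Fin 3) :
    wall k (i + 1) (Pi.single i 1) = -(cosine k i / 2) := by
  rw [wall_single]
  have h : i ≠ i + 1 + 1 := by revert i; decide
  simp [triangleGram, cosine, angle, h]

theorem wall_single_add_two (i : Fin 3) :
    wall k i (Pi.single (i + 2) 1) = -(cosine k (i + 2) / 2) := by
  have := wall_add_one_single k (i + 2)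
  rwa [add_two_one] at this

theorem wall_add_two_single (i : Fin 3) :
    wall k (i + 2) (Pi.single i 1) = -(cosine k (i + 2) / 2) := by
  have := wall_single_add_one k (i + 2)
  rwa [add_two_one] at this

theorem wall_refl_self (i : Fin 3) (y : Space) : wall k i (refl k i y) = -wall k i y := by
  rw [refl_apply, map_sub, map_smul, wall_single_self, smul_eq_mul]; ring

theorem wall_add_one_refl (i : Fin 3) (y : Space) :
    wall k (i + 1) (refl k i y) = wall k (i + 1) y + cosine k i * wall k i y := by
  rw [refl_apply, map_sub, map_smul, wall_add_one_single, smul_eq_mul]; ring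

theorem wall_add_two_refl (i : Fin 3) (y : Space) :
    wall k (i + 2) (refl k i y) = wall k (i + 2) y + cosine k (i + 2) * wall k i y := by
  rw [refl_apply, map_sub, map_smul, wall_add_two_single, smul_eq_mul]; ring

theorem wall_refl_add_one (i : Fin 3) (y : Space) :
    wall k i (refl k (i + 1) y) = wall k i y + cosine k i * wall k (i + 1) y := by
  have := wall_add_two_refl k (i + 1) y
  rwa [add_one_two] at this

theorem wall_add_two_refl_add_one (i : Fin 3) (y : Space) :
    wall k (i + 2) (refl k (i + 1) y) = wall k (i + 2) y + cosine k (i + 1) * wall k (i + 1) y := by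
  have := wall_add_one_refl k (i + 1) y
  rwa [add_one_one] at this

theorem refl_refl (i : Fin 3) (y : Space) : refl k i (refl k i y) = y := by
  rw [refl_apply k i (refl k i y), wall_refl_self, refl_apply]
  ext j; simp

theorem refl_mul_self (i : Fin 3) : refl k i * refl k i = 1 := by
  ext1 y; exact refl_refl k i y

theorem refl_inv (i : Fin 3) : (refl k i)⁻¹ = refl k i :=
  inv_eq_of_mul_eq_one_left (refl_mul_self k i)

theorem wall_apply (i : Fin 3) (y : Space) :
    wall k i y = y i - cosine k i / 2 * y (i + 1) - cosine k (i + 2) / 2 * y (i + 2) := by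
  have h : y = y i • Pi.single i (1 : ℝ) + y (i + 1) • Pi.single (i + 1) (1 : ℝ)
      + y (i + 2) • Pi.single (i + 2) (1 : ℝ) := by
    ext j; fin_cases i <;> fin_cases j <;> simp
  conv_lhs => rw [h]
  simp only [map_add, map_smul, wall_single_self, wall_single_add_one, wall_single_add_two,
    smul_eq_mul]
  ring

end Basic

/-! ### Numerical bounds and nondegeneracy of the form -/

theorem angle_pos (k : Fin 3 → ℕ) (i : Fin 3) : 0 < angle k i := by
  unfold angle; positivity

theorem mul_angle (k : Fin 3 → ℕ) (i : Fin 3) : (2 * k i + 1) * angle k i = Real.pi := by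
  unfold angle; field_simp

theorem five_mul_angle_le {k : Fin 3 → ℕ} (hk : ∀ i, 2 ≤ k i) (i : Fin 3) :
    5 * angle k i ≤ Real.pi := by
  have h := mul_angle k i
  have h2 : (2 : ℝ) ≤ k i := by exact_mod_cast hk i
  nlinarith [angle_pos k i]

theorem sin_angle_pos {k : Fin 3 → ℕ} (hk : ∀ i, 2 ≤ k i) (i : Fin 3) :
    0 < Real.sin (angle k i) := by
  apply Real.sin_pos_of_pos_of_lt_pi (angle_pos k i)
  linarith [five_mul_angle_le hk i, angle_pos k i]

theorem cosine_lt_two {k : Fin 3 → ℕ} (hk : ∀ i, 2 ≤ k i) (i : Fin 3) : cosine k i < 2 := by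
  have h1 := sin_angle_pos hk i
  have h2 := Real.sin_sq_add_cos_sq (angle k i)
  unfold cosine
  nlinarith

theorem cosine_pos {k : Fin 3 → ℕ} (hk : ∀ i, 2 ≤ k i) (i : Fin 3) : 0 < cosine k i := by
  have : 0 < Real.cos (angle k i) := by
    apply Real.cos_pos_of_mem_Ioo
    constructor <;> linarith [five_mul_angle_le hk i, angle_pos k i]
  unfold cosine; linarith

/-- From 5θ ≤ π one gets cos 3θ ≥ cos(π − 2θ). Divided by 1 + cos θ, this says that 2 cos θ is at
least the golden ratio. The later lower bounds on cosines rest on it. -/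
theorem cosine_add_one_le_sq {k : Fin 3 → ℕ} (hk : ∀ i, 2 ≤ k i) (i : Fin 3) :
    cosine k i + 1 ≤ cosine k i ^ 2 := by
  have h0 := cosine_pos hk i
  have h1 := five_mul_angle_le hk i
  have h2 : Real.cos (3 * angle k i) ≥ Real.cos (Real.pi - 2 * angle k i) := by
    apply Real.cos_le_cos_of_nonneg_of_le_pi <;> linarith [angle_pos k i]
  rw [Real.cos_pi_sub, Real.cos_two_mul, Real.cos_three_mul] at h2
  unfold cosine at *
  nlinarith

theorem cosine_gt {k : Fin 3 → ℕ} (hk : ∀ i, 2 ≤ k i) (i : Fin 3) : 8 / 5 < cosine k i := by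
  nlinarith [cosine_add_one_le_sq hk i, cosine_pos hk i]

/-- Four times the Gram determinant is 4 − a² − b² − c² − abc, which is negative because a, b, c
exceed 8/5. The coefficients of the linear combinations come from the adjugate matrix. -/
theorem eq_zero_of_wall {k : Fin 3 → ℕ} (hk : ∀ i, 2 ≤ k i) {y : Space}
    (h : ∀ i, wall k i y = 0) : y = 0 := by
  have h0 := h 0
  have h1 := h 1
  have h2 := h 2
  rw [wall_apply] at h0 h1 h2
  simp only [Fin.isValue, zero_add, show (1 : Fin 3) + 1 = 2 from rfl,
    show (1 : Fin 3) + 2 = 0 from rfl, show (2 : Fin 3) + 1 = 0 from rfl,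
    show (2 : Fin 3) + 2 = 1 from rfl] at h0 h1 h2
  have g0 := cosine_gt hk 0
  have g1 := cosine_gt hk 1
  have g2 := cosine_gt hk 2
  set a := cosine k 0
  set b := cosine k 1
  set c := cosine k 2
  have hd : 4 - a ^ 2 - b ^ 2 - c ^ 2 - a * b * c < 0 := by
    have : 0 < a * b * c := by positivity
    nlinarith
  have e0 : (4 - a ^ 2 - b ^ 2 - c ^ 2 - a * b * c) * y 0 = 0 := by
    linear_combination (4 - b ^ 2) * h0 + (2 * a + b * c) * h1 + (a * b + 2 * c) * h2
  have e1 : (4 - a ^ 2 - b ^ 2 - c ^ 2 - a * b * c) * y 1 = 0 := by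
    linear_combination (2 * a + b * c) * h0 + (4 - c ^ 2) * h1 + (2 * b + a * c) * h2
  have e2 : (4 - a ^ 2 - b ^ 2 - c ^ 2 - a * b * c) * y 2 = 0 := by
    linear_combination (2 * c + a * b) * h0 + (2 * b + a * c) * h1 + (4 - a ^ 2) * h2
  ext j
  fin_cases j
  · exact (mul_eq_zero.mp e0).resolve_left hd.ne
  · exact (mul_eq_zero.mp e1).resolve_left hd.ne
  · exact (mul_eq_zero.mp e2).resolve_left hd.ne

theorem eq_zero_of_wall' {k : Fin 3 → ℕ} (hk : ∀ i, 2 ≤ k i) {y : Space} (i : Fin 3)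
    (h0 : wall k i y = 0) (h1 : wall k (i + 1) y = 0) (h2 : wall k (i + 2) y = 0) : y = 0 := by
  apply eq_zero_of_wall hk
  intro j
  rcases eq_or_eq_add i j with rfl | rfl | rfl <;> assumption

/-! ### Rotations about the vertices -/

/-- The rotation about the common vertex of the sides `i` and `i + 1`. -/
noncomputable def rot (k : Fin 3 → ℕ) (i : Fin 3) : Space ≃ₗ[ℝ] Space :=
  refl k i * refl k (i + 1)

theorem rot_inv (k : Fin 3 → ℕ) (i : Fin 3) : (rot k i)⁻¹ = refl k (i + 1) * refl k i := by
  rw [rot, mul_inv_rev, refl_inv, refl_inv]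

theorem wall_rot (k : Fin 3 → ℕ) (i : Fin 3) (y : Space) :
    wall k i (rot k i y) = -wall k i y - cosine k i * wall k (i + 1) y := by
  change wall k i (refl k i (refl k (i + 1) y)) = _
  rw [wall_refl_self, wall_refl_add_one]; ring

theorem wall_add_one_rot (k : Fin 3 → ℕ) (i : Fin 3) (y : Space) :
    wall k (i + 1) (rot k i y) =
      cosine k i * wall k i y + (cosine k i ^ 2 - 1) * wall k (i + 1) y := by
  change wall k (i + 1) (refl k i (refl k (i + 1) y)) = _
  rw [wall_add_one_refl, wall_refl_add_one, wall_refl_self]; ring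

theorem wall_add_two_rot (k : Fin 3 → ℕ) (i : Fin 3) (y : Space) :
    wall k (i + 2) (rot k i y) = wall k (i + 2) y + cosine k (i + 2) * wall k i y +
      (cosine k (i + 1) + cosine k (i + 2) * cosine k i) * wall k (i + 1) y := by
  change wall k (i + 2) (refl k i (refl k (i + 1) y)) = _
  rw [wall_add_two_refl, wall_add_two_refl_add_one, wall_refl_add_one]; ring

theorem wall_rot_inv (k : Fin 3 → ℕ) (i : Fin 3) (y : Space) :
    wall k i ((rot k i)⁻¹ y) =
      (cosine k i ^ 2 - 1) * wall k i y + cosine k i * wall k (i + 1) y := by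
  rw [rot_inv]
  change wall k i (refl k (i + 1) (refl k i y)) = _
  rw [wall_refl_add_one, wall_add_one_refl, wall_refl_self]; ring

theorem wall_add_one_rot_inv (k : Fin 3 → ℕ) (i : Fin 3) (y : Space) :
    wall k (i + 1) ((rot k i)⁻¹ y) = -cosine k i * wall k i y - wall k (i + 1) y := by
  rw [rot_inv]
  change wall k (i + 1) (refl k (i + 1) (refl k i y)) = _
  rw [wall_refl_self, wall_add_one_refl]; ring

theorem wall_add_two_rot_inv (k : Fin 3 → ℕ) (i : Fin 3) (y : Space) :
    wall k (i + 2) ((rot k i)⁻¹ y) = wall k (i + 2) y + cosine k (i + 1) * wall k (i + 1) y +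
      (cosine k (i + 2) + cosine k (i + 1) * cosine k i) * wall k i y := by
  rw [rot_inv]
  change wall k (i + 2) (refl k (i + 1) (refl k i y)) = _
  rw [wall_add_two_refl_add_one, wall_add_two_refl, wall_add_one_refl]; ring

/-- These are Chebyshev recursions, solved through sin(x + 2t) = 2 cos t sin(x + t) − sin x. The
factor sin θ stays on the left to avoid divisions. -/
theorem wall_rot_pow (k : Fin 3 → ℕ) (i : Fin 3) (m : ℕ) (y : Space) :
    Real.sin (angle k i) * wall k i ((rot k i ^ m) y) =
        -Real.sin ((2 * m - 1) * angle k i) * wall k i y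
          - Real.sin (2 * m * angle k i) * wall k (i + 1) y ∧
    Real.sin (angle k i) * wall k (i + 1) ((rot k i ^ m) y) =
        Real.sin (2 * m * angle k i) * wall k i y
          + Real.sin ((2 * m + 1) * angle k i) * wall k (i + 1) y := by
  have key : ∀ x t : ℝ, Real.sin (x + 2 * t) =
      2 * Real.cos t * Real.sin (x + t) - Real.sin x := by
    intro x t
    have h1 : x + 2 * t = (x + t) + t := by ring
    have h2 : Real.sin x = Real.sin ((x + t) - t) := by ring_nf
    rw [h2, h1, Real.sin_add (x + t) t, Real.sin_sub]; ring
  induction m with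
  | zero => simp
  | succ m ih =>
    obtain ⟨ih1, ih2⟩ := ih
    rw [pow_succ', LinearEquiv.mul_apply, wall_rot, wall_add_one_rot]
    set θ := angle k i
    have e1 := key ((2 * m - 1) * θ) θ
    have e2 := key (2 * m * θ) θ
    have e3 := key ((2 * m + 1) * θ) θ
    have f1 : (2 * m - 1) * θ + θ = 2 * m * θ := by ring
    have f2 : (2 * m - 1) * θ + 2 * θ = (2 * m + 1) * θ := by ring
    have f3 : 2 * m * θ + θ = (2 * m + 1) * θ := by ring
    have f4 : 2 * m * θ + 2 * θ = 2 * (m + 1 : ℕ) * θ := by push_cast; ring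
    have f5 : (2 * m + 1) * θ + θ = 2 * (m + 1 : ℕ) * θ := by push_cast; ring
    have f6 : (2 * m + 1) * θ + 2 * θ = (2 * (m + 1 : ℕ) + 1) * θ := by push_cast; ring
    have f7 : (2 * (m + 1 : ℕ) - 1) * θ = (2 * m + 1) * θ := by push_cast; ring
    rw [f1, f2] at e1
    rw [f3, f4] at e2
    rw [f5, f6] at e3
    rw [f7, e3, e2]
    have hc : cosine k i = 2 * Real.cos θ := rfl
    rw [hc]
    constructor
    · linear_combination (-1) * ih1 - 2 * Real.cos θ * ih2 + wall k i y * e1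
    · linear_combination 2 * Real.cos θ * ih1 + (4 * Real.cos θ ^ 2 - 1) * ih2 +
        (-2) * Real.cos θ * wall k i y * e1

/-- The span of two normals is nondegenerate. -/
theorem sub_rot_pow_mem (k : Fin 3 → ℕ) (i : Fin 3) (m : ℕ) (y : Space) :
    (rot k i ^ m) y (i + 2) = y (i + 2) := by
  induction m with
  | zero => simp
  | succ m ih =>
    rw [pow_succ', LinearEquiv.mul_apply, ← ih]
    generalize (rot k i ^ m) y = z
    change refl k i (refl k (i + 1) z) (i + 2) = _
    rw [refl_apply, refl_apply]
    fin_cases i <;> simp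

/-- After a full turn the pairings with `i` and `i + 1` return, and the coordinate `i + 2` never
changes. The Gram matrix of the two normals has determinant (4 − c²)/4 ≠ 0, so the other two
coordinates return as well. -/
theorem rot_pow_eq_one {k : Fin 3 → ℕ} (hk : ∀ i, 2 ≤ k i) (i : Fin 3) :
    rot k i ^ (2 * k i + 1) = 1 := by
  ext1 y
  obtain ⟨h1, h2⟩ := wall_rot_pow k i (2 * k i + 1) y
  have h3 := sub_rot_pow_mem k i (2 * k i + 1) y
  have hs := sin_angle_pos hk i
  have ha := mul_angle k i
  have e1 : (2 * ((2 * k i + 1 : ℕ) : ℝ) - 1) * angle k i = 2 * Real.pi - angle k i := by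
    push_cast; linear_combination 2 * ha
  have e2 : 2 * ((2 * k i + 1 : ℕ) : ℝ) * angle k i = 2 * Real.pi := by
    push_cast; linear_combination 2 * ha
  have e3 : (2 * ((2 * k i + 1 : ℕ) : ℝ) + 1) * angle k i = angle k i + 2 * Real.pi := by
    push_cast; linear_combination 2 * ha
  rw [e1, e2, Real.sin_two_pi_sub, Real.sin_two_pi] at h1
  rw [e2, e3, Real.sin_two_pi, Real.sin_add_two_pi] at h2
  set z := (rot k i ^ (2 * k i + 1)) y
  have g1 : wall k i z = wall k i y := mul_left_cancel₀ hs.ne' (by linarith)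
  have g2 : wall k (i + 1) z = wall k (i + 1) y := mul_left_cancel₀ hs.ne' (by linarith)
  rw [wall_apply, wall_apply] at g1
  rw [wall_apply, wall_apply, add_one_one, add_one_two] at g2
  rw [h3] at g1 g2
  have hc : 0 < 4 - cosine k i ^ 2 := by nlinarith [cosine_lt_two hk i, cosine_pos hk i]
  have k1 : z i = y i := by
    have : (4 - cosine k i ^ 2) * (z i - y i) = 0 := by
      linear_combination 4 * g1 + 2 * cosine k i * g2
    linarith [(mul_eq_zero.mp this).resolve_left hc.ne']
  have k2 : z (i + 1) = y (i + 1) := by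
    have : (4 - cosine k i ^ 2) * (z (i + 1) - y (i + 1)) = 0 := by
      linear_combination 4 * g2 + 2 * cosine k i * g1
    linarith [(mul_eq_zero.mp this).resolve_left hc.ne']
  ext j
  rcases eq_or_eq_add i j with rfl | rfl | rfl
  · exact k1
  · exact k2
  · exact h3

/-! ### Branches of the tree of chambers and their regions -/

/-- The rotations by which the chambers of the tree of chambers are reached. -/
noncomputable def step (k : Fin 3 → ℕ) : Bool → Fin 3 → (Space ≃ₗ[ℝ] Space)
  | true, j => rot k j
  | false, j => (rot k j)⁻¹

/-- The index of the side through which the branch `j` of the tree of chambers is entered. -/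
def entry : Bool → Fin 3 → Fin 3
  | true, j => j
  | false, j => j + 1

/-- A side bounding the branch `j`. -/
noncomputable def sideA (k : Fin 3 → ℕ) : Bool → Fin 3 → Space → ℝ
  | true, j, y => wall k (j + 2) y + cosine k (j + 2) * wall k j y
  | false, j, y => wall k (j + 2) y + cosine k (j + 1) * wall k (j + 1) y

/-- The other side bounding the branch `j`. -/
noncomputable def sideB (k : Fin 3 → ℕ) : Bool → Fin 3 → Space → ℝ
  | true, j, y => (cosine k j ^ 3 - 2 * cosine k j) * wall k j y +
      (cosine k j ^ 2 - 1) * wall k (j + 1) y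
  | false, j, y => (cosine k j ^ 3 - 2 * cosine k j) * wall k (j + 1) y +
      (cosine k j ^ 2 - 1) * wall k j y

/-- The region of the branch `j` of the tree of chambers. -/
def Cone (k : Fin 3 → ℕ) (b : Bool) (j : Fin 3) : Set Space :=
  {y | wall k (entry b j) y ≤ 0 ∧ 0 ≤ sideA k b j y ∧ 0 ≤ sideB k b j y}

/-- The interior of the region of the branch `j`. -/
def OpenCone (k : Fin 3 → ℕ) (b : Bool) (j : Fin 3) : Set Space :=
  {y | wall k (entry b j) y < 0 ∧ 0 < sideA k b j y ∧ 0 < sideB k b j y}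

/-- The fundamental chamber. -/
def Chamber (k : Fin 3 → ℕ) : Set Space := {y | ∀ i, 0 ≤ wall k i y}

/-- The interior of the fundamental chamber. -/
def OpenChamber (k : Fin 3 → ℕ) : Set Space := {y | ∀ i, 0 < wall k i y}

theorem entry_ne {b : Bool} {i j : Fin 3} (h : i ≠ j) : entry b i ≠ entry b j := by
  cases b <;> simpa [entry] using h

/-- Pulled back by the step, the three functions bounding a branch become, up to sign, nonnegative
combinations of the chamber's own sides. Geometrically, `sideA` is the third side of the chamber
crossed halfway, and `sideB` is the third wall met after the entry side when turning about the
vertex. -/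
theorem wall_entry_step_true (k : Fin 3 → ℕ) (j : Fin 3) (q : Space) :
    wall k (entry true j) (step k true j q) = -(wall k j q + cosine k j * wall k (j + 1) q) := by
  simp only [entry, step, wall_rot]; ring

theorem wall_entry_step_false (k : Fin 3 → ℕ) (j : Fin 3) (q : Space) :
    wall k (entry false j) (step k false j q) =
      -(wall k (j + 1) q + cosine k j * wall k j q) := by
  simp only [entry, step, wall_add_one_rot_inv]; ring

theorem sideA_step_true (k : Fin 3 → ℕ) (j : Fin 3) (q : Space) :
    sideA k true j (step k true j q) = wall k (j + 2) q + cosine k (j + 1) * wall k (j + 1) q := by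
  simp only [sideA, step, wall_rot, wall_add_two_rot]; ring

theorem sideA_step_false (k : Fin 3 → ℕ) (j : Fin 3) (q : Space) :
    sideA k false j (step k false j q) = wall k (j + 2) q + cosine k (j + 2) * wall k j q := by
  simp only [sideA, step, wall_add_one_rot_inv, wall_add_two_rot_inv]; ring

theorem sideB_step_true (k : Fin 3 → ℕ) (j : Fin 3) (q : Space) :
    sideB k true j (step k true j q) = cosine k j * wall k j q + wall k (j + 1) q := by
  simp only [sideB, step, wall_rot, wall_add_one_rot]; ring

theorem sideB_step_false (k : Fin 3 → ℕ) (j : Fin 3) (q : Space) :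
    sideB k false j (step k false j q) = cosine k j * wall k (j + 1) q + wall k j q := by
  simp only [sideB, step, wall_rot_inv, wall_add_one_rot_inv]; ring

theorem openCone_subset (k : Fin 3 → ℕ) (b : Bool) (j : Fin 3) : OpenCone k b j ⊆ Cone k b j :=
  fun _ hy => ⟨hy.1.le, hy.2.1.le, hy.2.2.le⟩

theorem wall_add_two_step (k : Fin 3 → ℕ) (b : Bool) (i : Fin 3) (y : Space) :
    wall k (i + 2) (step k b i y) = wall k (i + 2) y +
      (if b then cosine k (i + 2) else cosine k (i + 2) + cosine k (i + 1) * cosine k i) *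
        wall k i y +
      (if b then cosine k (i + 1) + cosine k (i + 2) * cosine k i else cosine k (i + 1)) *
        wall k (i + 1) y := by
  cases b
  · simp only [step, wall_add_two_rot_inv]; simp; ring
  · simp only [step, wall_add_two_rot]; simp

section Large

variable {k : Fin 3 → ℕ} (hk : ∀ i, 2 ≤ k i)
include hk

/-- Bounds for the coefficients that occur. -/
theorem cosine_bounds (i : Fin 3) :
    3 / 2 < cosine k i ∧ 3 / 2 < cosine k i ^ 2 - 1 ∧ 0 < cosine k i ^ 3 - 2 * cosine k i ∧
      cosine k i ^ 2 - 1 ≤ cosine k i * (cosine k i ^ 3 - 2 * cosine k i) ∧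
      cosine k i ^ 3 - 2 * cosine k i ≤ cosine k i * (cosine k i ^ 2 - 1) := by
  have h1 := cosine_gt hk i
  have h2 := cosine_add_one_le_sq hk i
  refine ⟨by linarith, by nlinarith, by nlinarith, ?_, by nlinarith⟩
  nlinarith [mul_nonneg (sub_nonneg.mpr h2)
    (by nlinarith : 0 ≤ cosine k i ^ 2 + cosine k i - 1)]

theorem step_mem_cone_of_chamber (b : Bool) (j : Fin 3) {y : Space} (hy : y ∈ Chamber k) :
    step k b j y ∈ Cone k b j := by
  have h0 := hy j
  have h1 := hy (j + 1)
  have h2 := hy (j + 2)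
  have c0 := cosine_pos hk j
  have c1 := cosine_pos hk (j + 1)
  have c2 := cosine_pos hk (j + 2)
  cases b
  · refine ⟨?_, ?_, ?_⟩
    · rw [wall_entry_step_false]; nlinarith
    · rw [sideA_step_false]; positivity
    · rw [sideB_step_false]; positivity
  · refine ⟨?_, ?_, ?_⟩
    · rw [wall_entry_step_true]; nlinarith
    · rw [sideA_step_true]; positivity
    · rw [sideB_step_true]; positivity

theorem step_mem_openCone_of_chamber (b : Bool) (j : Fin 3) {y : Space} (hy : y ∈ OpenChamber k) :
    step k b j y ∈ OpenCone k b j := by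
  have h0 := hy j
  have h1 := hy (j + 1)
  have h2 := hy (j + 2)
  have c0 := cosine_pos hk j
  have c1 := cosine_pos hk (j + 1)
  have c2 := cosine_pos hk (j + 2)
  cases b
  · refine ⟨?_, ?_, ?_⟩
    · rw [wall_entry_step_false]; nlinarith
    · rw [sideA_step_false]; positivity
    · rw [sideB_step_false]; positivity
  · refine ⟨?_, ?_, ?_⟩
    · rw [wall_entry_step_true]; nlinarith
    · rw [sideA_step_true]; positivity
    · rw [sideB_step_true]; positivity

/-- The other sides of the fundamental chamber do not separate it from the region of a branch. -/
theorem wall_nonneg_of_cone {b : Bool} {j i : Fin 3} (hi : i ≠ entry b j) {y : Space}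
    (hy : y ∈ Cone k b j) : 0 ≤ wall k i y := by
  obtain ⟨h0, h1, h2⟩ := hy
  obtain ⟨a1, a2, a3, -, -⟩ := cosine_bounds hk j
  obtain ⟨b1, -⟩ := cosine_bounds hk (j + 1)
  obtain ⟨c1, -⟩ := cosine_bounds hk (j + 2)
  cases b
  · simp only [entry, sideA, sideB] at *
    rcases eq_or_eq_add j i with rfl | rfl | rfl
    · by_contra h; push Not at h; nlinarith
    · exact absurd rfl hi
    · nlinarith
  · simp only [entry, sideA, sideB] at *
    rcases eq_or_eq_add j i with rfl | rfl | rfl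
    · exact absurd rfl hi
    · by_contra h; push Not at h; nlinarith
    · nlinarith

theorem wall_pos_of_openCone {b : Bool} {j i : Fin 3} (hi : i ≠ entry b j) {y : Space}
    (hy : y ∈ Cone k b j) (hy' : wall k (entry b j) y < 0) : 0 < wall k i y := by
  obtain ⟨h0, h1, h2⟩ := hy
  obtain ⟨a1, a2, a3, -, -⟩ := cosine_bounds hk j
  obtain ⟨b1, -⟩ := cosine_bounds hk (j + 1)
  obtain ⟨c1, -⟩ := cosine_bounds hk (j + 2)
  cases b
  · simp only [entry, sideA, sideB] at *
    rcases eq_or_eq_add j i with rfl | rfl | rfl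
    · by_contra h; push Not at h; nlinarith
    · exact absurd rfl hi
    · nlinarith
  · simp only [entry, sideA, sideB] at *
    rcases eq_or_eq_add j i with rfl | rfl | rfl
    · exact absurd rfl hi
    · by_contra h; push Not at h; nlinarith
    · nlinarith

end Large

/-- The inequalities behind the passage to a branch that does not turn around the same vertex. -/
theorem turn_ineq {q a b u v w D E : ℝ} (hu : 3 / 2 < u) (hv : 3 / 2 < v) (hw : 3 / 2 < w)
    (hD : 0 < D) (hE : 3 / 2 < E) (hDE : E ≤ v * D) (h0 : q ≤ 0) (h1 : 0 ≤ a + w * q)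
    (h2 : 0 ≤ D * q + E * b) :
    0 ≤ a ∧ 0 ≤ b ∧ 3 / 2 * q ≥ -(a + u * b) ∧ 0 ≤ q + v * b := by
  have ha : 0 ≤ a := by nlinarith
  have hb : 0 ≤ b := by
    by_contra h; push Not at h; nlinarith
  refine ⟨ha, hb, by nlinarith, ?_⟩
  have : 0 ≤ E * (q + v * b) := by nlinarith
  exact nonneg_of_mul_nonneg_right this (by linarith)

theorem turn_ineq_strict {q a b u v w D E : ℝ} (hu : 3 / 2 < u) (hv : 3 / 2 < v) (hw : 3 / 2 < w)
    (hD : 0 < D) (hE : 3 / 2 < E) (hDE : E ≤ v * D) (h0 : q < 0) (h1 : 0 < a + w * q)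
    (h2 : 0 < D * q + E * b) :
    0 < a ∧ 0 < b ∧ -(a + u * b) < 0 ∧ 0 < q + v * b := by
  have ha : 0 < a := by nlinarith
  have hb : 0 < b := by
    by_contra h; push Not at h; nlinarith
  refine ⟨ha, hb, by nlinarith, ?_⟩
  have : 0 < E * (q + v * b) := by nlinarith
  exact pos_of_mul_pos_right this (by linarith)

/-- The inequalities behind the passage to a branch that turns around the same vertex. -/
theorem pivot_ineq {q a b u D E : ℝ} (hu : 3 / 2 < u)
    (hu2 : 3 / 2 < u ^ 2 - 1) (hD : 0 < D) (hE : 3 / 2 < E) (h0 : q ≤ 0) (h1 : 0 ≤ a + u * q)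
    (h2 : 0 ≤ D * q + E * b) :
    0 ≤ a ∧ 0 ≤ b ∧ 3 / 2 * q ≥ -(q + u * a) := by
  have ha : 0 ≤ a := by nlinarith
  have hb : 0 ≤ b := by
    by_contra h; push Not at h; nlinarith
  refine ⟨ha, hb, ?_⟩
  nlinarith

theorem pivot_ineq_strict {q a b u D E : ℝ} (hu : 3 / 2 < u)
    (hD : 0 < D) (hE : 3 / 2 < E) (h0 : q < 0) (h1 : 0 < a + u * q)
    (h2 : 0 < D * q + E * b) :
    0 < a ∧ 0 < b ∧ -(q + u * a) < 0 := by
  have ha : 0 < a := by nlinarith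
  have hb : 0 < b := by
    by_contra h; push Not at h; nlinarith
  refine ⟨ha, hb, ?_⟩
  nlinarith

section Large

variable {k : Fin 3 → ℕ} (hk : ∀ i, 2 ≤ k i)
include hk

/-- The nesting behind every ping-pong argument below. The next branch either continues about the
same vertex (`pivot_ineq`) or turns away from it (`turn_ineq`); in both cases the depth behind the
entry side grows by a factor of at least 3/2. -/
theorem step_mem_cone (b : Bool) {i j : Fin 3} (hij : j ≠ i) {y : Space}
    (hy : y ∈ Cone k (!b) i) :
    step k b j y ∈ Cone k b j ∧
      wall k (entry b j) (step k b j y) ≤ 3 / 2 * wall k (entry (!b) i) y := by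
  obtain ⟨h0, h1, h2⟩ := hy
  obtain ⟨a1, a2, a3, a4, -⟩ := cosine_bounds hk j
  obtain ⟨b1, b2, b3, b4, -⟩ := cosine_bounds hk (j + 1)
  obtain ⟨c1, c2, c3, c4, -⟩ := cosine_bounds hk (j + 2)
  cases b <;> rcases eq_add_of_ne hij with rfl | rfl <;>
    simp only [entry, sideA, sideB, Bool.not_true, Bool.not_false, add_one_two, add_two_one,
      add_two_two, add_one_one] at h0 h1 h2
  · obtain ⟨ha, hb, h⟩ := pivot_ineq a1 a2 b3 b2 h0 h1 h2
    refine ⟨⟨?_, ?_, ?_⟩, ?_⟩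
    · rw [wall_entry_step_false]; linarith
    · rw [sideA_step_false]; positivity
    · rw [sideB_step_false]; linarith
    · rw [wall_entry_step_false]; exact h
  · obtain ⟨ha, hb, h, h'⟩ := turn_ineq a1 c1 b1 c3 c2 c4 h0 h1 h2
    refine ⟨⟨?_, ?_, ?_⟩, ?_⟩
    · rw [wall_entry_step_false]; linarith
    · rw [sideA_step_false]; exact h'
    · rw [sideB_step_false]; positivity
    · rw [wall_entry_step_false]; simp only [entry, Bool.not_false]; exact h
  · obtain ⟨ha, hb, h, h'⟩ := turn_ineq a1 b1 c1 b3 b2 b4 h0 h1 h2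
    refine ⟨⟨?_, ?_, ?_⟩, ?_⟩
    · rw [wall_entry_step_true]; linarith
    · rw [sideA_step_true]; exact h'
    · rw [sideB_step_true]; positivity
    · rw [wall_entry_step_true]; simp only [entry, Bool.not_true, add_one_one]; exact h
  · obtain ⟨ha, hb, h⟩ := pivot_ineq a1 a2 c3 c2 h0 h1 h2
    refine ⟨⟨?_, ?_, ?_⟩, ?_⟩
    · rw [wall_entry_step_true]; linarith
    · rw [sideA_step_true]; positivity
    · rw [sideB_step_true]; linarith
    · rw [wall_entry_step_true]; simp only [entry, Bool.not_true, add_two_one]; exact h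

theorem step_mem_openCone (b : Bool) {i j : Fin 3} (hij : j ≠ i) {y : Space}
    (hy : y ∈ OpenCone k (!b) i) : step k b j y ∈ OpenCone k b j := by
  obtain ⟨h0, h1, h2⟩ := hy
  obtain ⟨a1, a2, a3, a4, -⟩ := cosine_bounds hk j
  obtain ⟨b1, b2, b3, b4, -⟩ := cosine_bounds hk (j + 1)
  obtain ⟨c1, c2, c3, c4, -⟩ := cosine_bounds hk (j + 2)
  cases b <;> rcases eq_add_of_ne hij with rfl | rfl <;>
    simp only [entry, sideA, sideB, Bool.not_true, Bool.not_false, add_one_two, add_two_one,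
      add_two_two, add_one_one] at h0 h1 h2
  · obtain ⟨ha, hb, h⟩ := pivot_ineq_strict a1 b3 b2 h0 h1 h2
    refine ⟨?_, ?_, ?_⟩
    · rw [wall_entry_step_false]; linarith
    · rw [sideA_step_false]; positivity
    · rw [sideB_step_false]; linarith
  · obtain ⟨ha, hb, h, h'⟩ := turn_ineq_strict a1 c1 b1 c3 c2 c4 h0 h1 h2
    refine ⟨?_, ?_, ?_⟩
    · rw [wall_entry_step_false]; linarith
    · rw [sideA_step_false]; exact h'
    · rw [sideB_step_false]; positivity
  · obtain ⟨ha, hb, h, h'⟩ := turn_ineq_strict a1 b1 c1 b3 b2 b4 h0 h1 h2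
    refine ⟨?_, ?_, ?_⟩
    · rw [wall_entry_step_true]; linarith
    · rw [sideA_step_true]; exact h'
    · rw [sideB_step_true]; positivity
  · obtain ⟨ha, hb, h⟩ := pivot_ineq_strict a1 c3 c2 h0 h1 h2
    refine ⟨?_, ?_, ?_⟩
    · rw [wall_entry_step_true]; linarith
    · rw [sideA_step_true]; positivity
    · rw [sideB_step_true]; linarith

/-- The depth of the image is a combination, with positive coefficients, of two nonnegative
pairings, so it vanishes only where both do: at the vertex about which the step turns. -/
theorem vertex_of_wall_step (b : Bool) (j : Fin 3) {y : Space} (hy : y ∈ Chamber k)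
    (h : wall k (entry b j) (step k b j y) = 0) : wall k j y = 0 ∧ wall k (j + 1) y = 0 := by
  have h0 := hy j
  have h1 := hy (j + 1)
  have c := cosine_gt hk j
  cases b
  · rw [wall_entry_step_false] at h
    constructor <;> nlinarith
  · rw [wall_entry_step_true] at h
    constructor <;> nlinarith

/-- Two steps into the tree of chambers move the region of a branch off the walls. -/
theorem wall_step_step_neg (b : Bool) {i j l : Fin 3} (hij : j ≠ i) (hil : i ≠ l) {y : Space}
    (hy : y ∈ Cone k b l) (h0 : y ≠ 0) :
    wall k (entry b j) (step k b j (step k (!b) i y)) < 0 := by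
  have hy' : y ∈ Cone k (!(!b)) l := by rwa [Bool.not_not]
  have h1 := step_mem_cone hk (!b) hil hy'
  have h2 := (step_mem_cone hk b hij h1.1).1.1
  -- If the final depth is zero, the growth factor makes the two earlier depths zero too. Then `y`
  -- and its first image are chamber points at vertices. The first step preserves the pairing of `y`
  -- with the third side `i + 2`, and since `j ≠ i` this side passes through the second vertex, so
  -- all pairings of `y` vanish.
  refine lt_of_le_of_ne h2 fun h3 => h0 ?_
  have g1 : wall k (entry (!b) i) (step k (!b) i y) = 0 :=
    le_antisymm h1.1.1 (by linarith [(step_mem_cone hk b hij h1.1).2])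
  have g2 : wall k (entry b l) y = 0 := by
    have := h1.2
    rw [Bool.not_not] at this
    exact le_antisymm hy.1 (by linarith)
  have ny : ∀ m, 0 ≤ wall k m y := fun m => by
    by_cases hm : m = entry b l
    · rw [hm, g2]
    · exact wall_nonneg_of_cone hk hm hy
  have nq : ∀ m, 0 ≤ wall k m (step k (!b) i y) := fun m => by
    by_cases hm : m = entry (!b) i
    · rw [hm, g1]
    · exact wall_nonneg_of_cone hk hm h1.1
  have zy := vertex_of_wall_step hk (!b) i ny g1
  have zq := vertex_of_wall_step hk b j nq h3
  have e := wall_add_two_step k (!b) i y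
  rw [zy.1, zy.2, mul_zero, mul_zero, add_zero, add_zero] at e
  refine eq_zero_of_wall' hk i zy.1 zy.2 ?_
  rw [← e]
  rcases eq_add_of_ne hij with rfl | rfl
  · rw [add_one_two]; exact zq.1
  · rw [add_two_two]; exact zq.2
end Large

/-! ### Words in the tree and the group that preserves it -/

/-- The element of the tree of chambers reached by a word, starting at a chamber of the kind `b`. -/
noncomputable def ev (k : Fin 3 → ℕ) : Bool → List (Fin 3) → (Space ≃ₗ[ℝ] Space)
  | _, [] => 1
  | b, j :: l => step k b j * ev k (!b) l

/-- The kind of the chamber reached by a word. -/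
def flag : Bool → List (Fin 3) → Bool
  | b, [] => b
  | b, _ :: l => flag (!b) l

theorem flag_append (b : Bool) (l m : List (Fin 3)) : flag b (l ++ m) = flag (flag b l) m := by
  induction l generalizing b with
  | nil => rfl
  | cons j l ih => exact ih _

theorem flag_not (b : Bool) (l : List (Fin 3)) : flag (!b) l = !flag b l := by
  induction l generalizing b with
  | nil => rfl
  | cons j l ih => exact ih _

theorem flag_eq_iff (b : Bool) (l : List (Fin 3)) : flag b l = b ↔ Even l.length := by
  induction l generalizing b with
  | nil => simp [flag]
  | cons j l ih =>
    rw [List.length_cons, Nat.even_add_one, ← ih b, flag, flag_not]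
    cases b <;> cases flag _ l <;> simp

theorem ev_append (k : Fin 3 → ℕ) (b : Bool) (l m : List (Fin 3)) :
    ev k b (l ++ m) = ev k b l * ev k (flag b l) m := by
  induction l generalizing b with
  | nil => simp [ev, flag]
  | cons j l ih => rw [List.cons_append, ev, ih, ev, mul_assoc, flag]

theorem step_mul_step_not (k : Fin 3 → ℕ) (b : Bool) (j : Fin 3) :
    step k b j * step k (!b) j = 1 := by
  cases b <;> simp [step]

theorem step_inv (k : Fin 3 → ℕ) (b : Bool) (j : Fin 3) : (step k b j)⁻¹ = step k (!b) j :=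
  inv_eq_of_mul_eq_one_right (step_mul_step_not k b j)

theorem ev_inv (k : Fin 3 → ℕ) (b : Bool) (l : List (Fin 3)) :
    (ev k b l)⁻¹ = ev k (flag b l) l.reverse := by
  induction l generalizing b with
  | nil => simp [ev]
  | cons j l ih =>
    rw [ev, mul_inv_rev, ih, List.reverse_cons, ev_append, step_inv, flag]
    congr 1
    have h : flag (flag (!b) l) l.reverse = !b := by
      rw [← flag_append, flag_eq_iff]; simp
    rw [h]; simp [ev]

/-- Words can be reduced. -/
theorem exists_chain_ev (k : Fin 3 → ℕ) (b : Bool) (l : List (Fin 3)) :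
    ∃ m : List (Fin 3), m.IsChain (· ≠ ·) ∧ ev k b m = ev k b l ∧ flag b m = flag b l := by
  induction l generalizing b with
  | nil => exact ⟨[], by simp, rfl, rfl⟩
  | cons j l ih =>
    obtain ⟨m, h1, h2, h3⟩ := ih (!b)
    rcases m with _ | ⟨i, m⟩
    · exact ⟨[j], by simp, congrArg (step k b j * ·) h2, h3⟩
    · by_cases h : j = i
      · subst h
        refine ⟨m, h1.tail, ?_, ?_⟩
        · rw [ev, ← h2, ev, ← mul_assoc, step_mul_step_not, one_mul, Bool.not_not]
        · rw [flag, ← h3, flag, Bool.not_not]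
      · exact ⟨j :: i :: m, by simpa [h] using h1, by rw [ev, h2, ev], by rw [flag, h3, flag]⟩

/-- The elements that preserve the tree of chambers, written from a chamber of the kind `b`. -/
def treeGroup (k : Fin 3 → ℕ) (b : Bool) : Subgroup (Space ≃ₗ[ℝ] Space) where
  carrier := {g | ∃ l, flag b l = b ∧ ev k b l = g}
  one_mem' := ⟨[], rfl, rfl⟩
  mul_mem' := by
    rintro _ _ ⟨l, hl, rfl⟩ ⟨m, hm, rfl⟩
    exact ⟨l ++ m, by rw [flag_append, hl, hm], by rw [ev_append, hl]⟩
  inv_mem' := by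
    rintro _ ⟨l, hl, rfl⟩
    refine ⟨l.reverse, ?_, by rw [ev_inv, hl]⟩
    rw [flag_eq_iff] at *
    simpa using hl

theorem mem_treeGroup_iff {k : Fin 3 → ℕ} {b : Bool} {g : Space ≃ₗ[ℝ] Space} :
    g ∈ treeGroup k b ↔ ∃ l : List (Fin 3), l.IsChain (· ≠ ·) ∧ flag b l = b ∧ ev k b l = g := by
  constructor
  · rintro ⟨l, h1, h2⟩
    obtain ⟨m, hm, hm', hm''⟩ := exists_chain_ev k b l
    exact ⟨m, hm, hm''.trans h1, hm'.trans h2⟩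
  · rintro ⟨l, -, h⟩
    exact ⟨l, h⟩

/-- A point in the interior of the fundamental chamber. -/
def basePoint : Space := fun _ => -1

section Large

variable {k : Fin 3 → ℕ} (hk : ∀ i, 2 ≤ k i)
include hk

theorem basePoint_mem : basePoint ∈ OpenChamber k := by
  intro i
  rw [wall_apply]
  have h1 := cosine_gt hk i
  have h2 := cosine_gt hk (i + 2)
  simp only [basePoint]
  linarith

theorem ev_mem_cone (l : List (Fin 3)) (b : Bool) {j i : Fin 3}
    (hl : (j :: l ++ [i]).IsChain (· ≠ ·)) {y : Space} (hy : y ∈ Cone k (flag b (j :: l)) i) :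
    ev k b (j :: l) y ∈ Cone k b j ∧ wall k (entry b j) (ev k b (j :: l) y) ≤
      (3 / 2) ^ (l.length + 1) * wall k (entry (flag b (j :: l)) i) y := by
  induction l generalizing b j with
  | nil =>
    have h : j ≠ i := by simpa using hl
    simpa [ev, flag] using step_mem_cone hk b h hy
  | cons m l ih =>
    simp only [List.cons_append, List.isChain_cons_cons] at hl
    obtain ⟨h1, h2⟩ := ih (!b) hl.2 hy
    obtain ⟨h3, h4⟩ := step_mem_cone hk b hl.1 h1
    refine ⟨h3, h4.trans ?_⟩
    rw [List.length_cons, pow_succ' _ (l.length + 1), mul_assoc]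
    exact mul_le_mul_of_nonneg_left h2 (by norm_num)

theorem ev_mem_cone_of_chamber (l : List (Fin 3)) (b : Bool) {j : Fin 3}
    (hl : (j :: l).IsChain (· ≠ ·)) {y : Space} (hy : y ∈ Chamber k) :
    ev k b (j :: l) y ∈ Cone k b j := by
  induction l generalizing b j with
  | nil => simpa [ev] using step_mem_cone_of_chamber hk b j hy
  | cons m l ih =>
    simp only [List.isChain_cons_cons] at hl
    exact (step_mem_cone hk b hl.1 (ih (!b) hl.2)).1

theorem ev_mem_openCone (l : List (Fin 3)) (b : Bool) {j : Fin 3}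
    (hl : (j :: l).IsChain (· ≠ ·)) {y : Space} (hy : y ∈ OpenChamber k) :
    ev k b (j :: l) y ∈ OpenCone k b j := by
  induction l generalizing b j with
  | nil => simpa [ev] using step_mem_openCone_of_chamber hk b j hy
  | cons m l ih =>
    simp only [List.isChain_cons_cons] at hl
    exact step_mem_openCone hk b hl.1 (ih (!b) hl.2)

theorem wall_ev_neg (l : List (Fin 3)) (b : Bool) {j i q : Fin 3}
    (hl : (j :: i :: l ++ [q]).IsChain (· ≠ ·)) {y : Space}
    (hy : y ∈ Cone k (flag b (j :: i :: l)) q) (h0 : y ≠ 0) :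
    wall k (entry b j) (ev k b (j :: i :: l) y) < 0 := by
  rcases l with _ | ⟨m, l⟩
  · simp only [List.cons_append, List.nil_append, List.isChain_cons_cons] at hl
    simp only [flag, Bool.not_not] at hy
    simpa [ev] using wall_step_step_neg hk b hl.1 hl.2.1 hy h0
  · simp only [List.cons_append, List.isChain_cons_cons] at hl
    have h1 : ev k b (m :: l) y ∈ Cone k b m := by
      refine (ev_mem_cone hk l b (j := m) (by simpa using hl.2.2) ?_).1
      simpa [flag] using hy
    have h2 : ev k b (m :: l) y ≠ 0 := by simpa using h0
    have := wall_step_step_neg hk b hl.1 hl.2.1 h1 h2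
    simpa [ev] using this

/-- A branch is separated from the fundamental chamber by its entry side alone, so a point in its
interior remembers the first side crossed. -/
theorem wall_neg_of_openCone {b : Bool} {i j : Fin 3} {y : Space} (hy : y ∈ OpenCone k b j) :
    wall k i y < 0 ↔ i = entry b j := by
  constructor
  · intro h
    by_contra hi
    exact absurd h (wall_nonneg_of_cone hk hi (openCone_subset k b j hy)).not_gt
  · rintro rfl; exact hy.1

theorem ev_ne_one (b : Bool) {l : List (Fin 3)} (hl : l.IsChain (· ≠ ·)) (h0 : l ≠ []) :
    ev k b l ≠ 1 := by
  rcases l with _ | ⟨j, l⟩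
  · exact absurd rfl h0
  · intro h
    have h1 := ev_mem_openCone hk l b hl (basePoint_mem hk)
    rw [h] at h1
    exact absurd h1.1 (basePoint_mem hk _).not_gt

/-- The two kinds of chambers of the tree are not related by an element that preserves it. -/
theorem treeGroup_true_inf_false {g : Space ≃ₗ[ℝ] Space} (h1 : g ∈ treeGroup k true)
    (h2 : g ∈ treeGroup k false) : g = 1 := by
  obtain ⟨l, hl, hf, rfl⟩ := mem_treeGroup_iff.mp h1
  obtain ⟨m, hm, hf', he⟩ := mem_treeGroup_iff.mp h2
  rcases l with _ | ⟨j, l⟩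
  · rfl
  exfalso
  rcases m with _ | ⟨i, _ | ⟨i', m⟩⟩
  · exact ev_ne_one hk true hl (by simp) he.symm
  · simp [flag] at hf'
  simp only [List.isChain_cons_cons] at hm
  have g1 := ev_mem_openCone hk l true hl (basePoint_mem hk)
  have g2 := ev_mem_openCone hk m true hm.2 (basePoint_mem hk)
  rw [← he] at g1
  set y := ev k true (i' :: m) basePoint
  change step k false i y ∈ _ at g1
  have g3 := step_mem_openCone hk false hm.1 g2
  -- Both descriptions of the element must cross the same first side.
  have hj : j = i + 1 := by
    have := (wall_neg_of_openCone hk g1).mpr rfl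
    exact (wall_neg_of_openCone hk g3).mp this
  subst hj
  -- After side `i + 1` the tree of kind `true` never crosses side `i` of the adjacent chamber,
  -- whereas the tree of kind `false` does so at once. At this point `sideA` equals `-wall k i y`.
  have h := g1.2.1
  have hp : 0 < wall k i y := wall_pos_of_openCone hk (by simpa [entry] using hm.1)
    (openCone_subset k _ _ g2) g2.1
  simp only [sideA, add_one_two, step, wall_rot_inv, wall_add_one_rot_inv] at h
  nlinarith

end Large

/-! ### Freeness of the tree group -/

/-- The images of the elements of a free basis. -/
noncomputable def letter (i : Fin 3) : FreeGroup (Fin 2) :=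
  Fin.cases 1 FreeGroup.of i

/-- The parametrization of the group that preserves the tree by a free group. -/
noncomputable def param (k : Fin 3 → ℕ) : FreeGroup (Fin 2) →* (Space ≃ₗ[ℝ] Space) :=
  FreeGroup.lift fun i => rot k 0 * (rot k i.succ)⁻¹

theorem param_letter (k : Fin 3 → ℕ) (i : Fin 3) :
    param k (letter i) = rot k 0 * (rot k i)⁻¹ := by
  refine Fin.cases ?_ (fun i => ?_) i
  · simp [letter]
  · simp [letter, param]

theorem param_letter_inv_mul (k : Fin 3 → ℕ) (i j : Fin 3) :
    param k ((letter i)⁻¹ * letter j) = rot k i * (rot k j)⁻¹ := by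
  rw [map_mul, map_inv, param_letter, param_letter]; group

theorem param_range (k : Fin 3 → ℕ) : (param k).range = treeGroup k true := by
  apply le_antisymm
  · rintro _ ⟨f, rfl⟩
    induction f using FreeGroup.induction_on with
    | C1 => rw [map_one]; exact one_mem _
    | of i =>
      refine ⟨[0, i.succ], rfl, ?_⟩
      simp [ev, step, param]
    | inv_of i ih => rw [map_inv]; exact inv_mem ih
    | mul f g hf hg => rw [map_mul]; exact mul_mem hf hg
  · rintro _ ⟨l, hl, rfl⟩
    induction l using List.twoStepInduction with
    | nil => exact one_mem _
    | singleton j => simp [flag] at hl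
    | cons_cons i j l ih _ =>
      have : ev k true (i :: j :: l) = rot k i * (rot k j)⁻¹ * ev k true l := by
        simp [ev, step, mul_assoc]
      rw [this, ← param_letter_inv_mul]
      exact mul_mem ⟨_, rfl⟩ (ih (by simpa [flag] using hl))

/-- Ping-pong with four regions. An inverse generator ends with `rot i.succ` and leads into the
branch `i.succ` of kind `true`; a generator leads into the `rot 0`-translate of the branch `i.succ`
of kind `false`, which lies inside the branch `0`. The base point is in none of them. -/
theorem param_injective {k : Fin 3 → ℕ} (hk : ∀ i, 2 ≤ k i) : Function.Injective (param k) := by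
  let Reg : Fin 2 × Bool → Set Space := fun a =>
    if a.2 then {y | step k false 0 y ∈ OpenCone k false a.1.succ} else OpenCone k true a.1.succ
  have hzero : ∀ i : Fin 2, (0 : Fin 3) ≠ i.succ := fun i => (Fin.succ_ne_zero i).symm
  have hback : ∀ y, step k true 0 (step k false 0 y) = y := fun y =>
    LinearEquiv.congr_fun (step_mul_step_not k true 0) y
  have hforth : ∀ y, step k false 0 (step k true 0 y) = y := fun y =>
    LinearEquiv.congr_fun (step_mul_step_not k false 0) y
  have hReg : ∀ i y, y ∈ Reg (i, true) → y ∈ OpenCone k true 0 := fun i y hy => by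
    have : step k false 0 y ∈ OpenCone k false i.succ := hy
    rw [← hback y]
    exact step_mem_openCone hk true (hzero i) this
  have key : ∀ (L : List (Fin 2 × Bool)) (a : Fin 2 × Bool), FreeGroup.IsReduced (a :: L) →
      param k (FreeGroup.mk (a :: L)) basePoint ∈ Reg a := by
    intro L
    induction L with
    | nil =>
      rintro ⟨i, b⟩ -
      cases b
      · have h1 := step_mem_openCone_of_chamber hk false 0 (basePoint_mem hk)
        have h2 := step_mem_openCone hk true (hzero i).symm h1
        simpa [Reg, param, FreeGroup.lift_mk, step] using h2
      · have h1 := step_mem_openCone_of_chamber hk false i.succ (basePoint_mem hk)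
        change step k false 0 _ ∈ OpenCone k false i.succ
        simpa [Reg, param, FreeGroup.lift_mk, step] using h1
    | cons c L ih =>
      rintro ⟨i, b⟩ h
      obtain ⟨j, d⟩ := c
      rw [FreeGroup.isReduced_cons_cons] at h
      have h1 := ih (j, d) h.2
      rw [show FreeGroup.mk ((i, b) :: (j, d) :: L) =
        FreeGroup.mk [(i, b)] * FreeGroup.mk ((j, d) :: L) by rw [FreeGroup.mul_mk]; rfl, map_mul,
        LinearEquiv.mul_apply]
      set y := param k (FreeGroup.mk ((j, d) :: L)) basePoint
      cases b
      · have e : param k (FreeGroup.mk [(i, false)]) = step k true i.succ * step k false 0 := by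
          simp [param, FreeGroup.lift_mk, step]
        rw [e]
        change step k true i.succ (step k false 0 y) ∈ OpenCone k true i.succ
        cases d
        · refine step_mem_openCone hk true (i := 0) (hzero i).symm ?_
          exact step_mem_openCone hk false (hzero j) h1
        · refine step_mem_openCone hk true (i := j.succ) ?_ h1
          intro h'
          have := h.1 (Fin.succ_injective _ h')
          simp at this
      · have e : param k (FreeGroup.mk [(i, true)]) = step k true 0 * step k false i.succ := by
          simp [param, FreeGroup.lift_mk, step]
        rw [e]
        change step k false 0 (step k true 0 (step k false i.succ y)) ∈ OpenCone k false i.succ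
        rw [hforth]
        cases d
        · refine step_mem_openCone hk false (i := j.succ) ?_ h1
          intro h'
          have := h.1 (Fin.succ_injective _ h')
          simp at this
        · exact step_mem_openCone hk false (hzero i).symm (hReg j y h1)
  rw [injective_iff_map_eq_one]
  intro f hf
  rw [← FreeGroup.mk_toWord (x := f)] at hf ⊢
  have hr := FreeGroup.isReduced_toWord (x := f)
  rcases hL : f.toWord with _ | ⟨⟨i, b⟩, L⟩
  · rfl
  · rw [hL] at hf hr
    have h1 := key L (i, b) hr
    rw [hf] at h1
    exfalso
    cases b
    · exact absurd (show basePoint ∈ OpenCone k true _ from h1).1 (basePoint_mem hk _).not_gt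
    · exact absurd (hReg i _ h1).1 (basePoint_mem hk _).not_gt

/-- An element of finite order that preserves the tree is trivial. -/
theorem treeGroup_torsionFree {k : Fin 3 → ℕ} (hk : ∀ i, 2 ≤ k i) {g : Space ≃ₗ[ℝ] Space}
    (hg : g ∈ treeGroup k true) {n : ℕ} (hn : n ≠ 0) (h : g ^ n = 1) : g = 1 := by
  rw [← param_range] at hg
  obtain ⟨f, rfl⟩ := hg
  rw [← map_pow] at h
  have h1 : f ^ n = 1 := param_injective hk (h.trans (map_one _).symm)
  have h2 : f = 1 := by
    have := pow_left_injective hn (a₁ := f) (a₂ := 1)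
    exact this (by simpa using h1)
  rw [h2, map_one]

/-! ### Words in the reflections and positivity of roots -/

/-- The product of the reflections in the sides listed. -/
noncomputable def word (k : Fin 3 → ℕ) (l : List (Fin 3)) : Space ≃ₗ[ℝ] Space :=
  (l.map (refl k)).prod

theorem word_cons (k : Fin 3 → ℕ) (i : Fin 3) (l : List (Fin 3)) :
    word k (i :: l) = refl k i * word k l := by simp [word]

theorem word_append (k : Fin 3 → ℕ) (l m : List (Fin 3)) :
    word k (l ++ m) = word k l * word k m := by simp [word]

theorem word_singleton (k : Fin 3 → ℕ) (i : Fin 3) : word k [i] = refl k i := by simp [word]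

theorem word_reverse (k : Fin 3 → ℕ) (l : List (Fin 3)) : word k l.reverse = (word k l)⁻¹ := by
  induction l with
  | nil => simp [word]
  | cons i l ih =>
    rw [List.reverse_cons, word_append, ih, word_singleton, word_cons, mul_inv_rev, refl_inv]

theorem det_refl (k : Fin 3 → ℕ) (i : Fin 3) : LinearEquiv.det (refl k i) = -1 := by
  rw [Units.ext_iff, LinearEquiv.coe_det, ← LinearMap.det_toMatrix', Matrix.det_fin_three]
  simp only [LinearMap.toMatrix'_apply, LinearEquiv.coe_coe, refl_apply, wall_apply]
  fin_cases i <;> simp <;> ring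

theorem det_word (k : Fin 3 → ℕ) (l : List (Fin 3)) :
    LinearEquiv.det (word k l) = (-1) ^ l.length := by
  induction l with
  | nil => simp [word]
  | cons i l ih => rw [word_cons, map_mul, ih, det_refl, List.length_cons, pow_succ']

theorem length_parity {k : Fin 3 → ℕ} {l m : List (Fin 3)} (h : word k l = word k m) :
    Even l.length ↔ Even m.length := by
  have h1 := det_word k l
  rw [h, det_word] at h1
  have hne : (-1 : ℝˣ) ≠ 1 := by
    intro h; have := congrArg Units.val h; norm_num at this
  rcases Nat.even_or_odd l.length with h2 | h2 <;> rcases Nat.even_or_odd m.length with h3 | h3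
  · simp [h2, h3]
  · rw [h2.neg_one_pow, h3.neg_one_pow] at h1; exact absurd h1 hne
  · rw [h2.neg_one_pow, h3.neg_one_pow] at h1; exact absurd h1.symm hne
  · simp [Nat.not_even_iff_odd.mpr h2, Nat.not_even_iff_odd.mpr h3]

/-- A word is reduced if no shorter word has the same value. -/
def IsRed (k : Fin 3 → ℕ) (l : List (Fin 3)) : Prop :=
  ∀ m, word k m = word k l → l.length ≤ m.length

theorem exists_isRed (k : Fin 3 → ℕ) (l : List (Fin 3)) :
    ∃ m, IsRed k m ∧ word k m = word k l := by
  have hex : ∃ n, ∃ m, word k m = word k l ∧ m.length = n := ⟨_, l, rfl, rfl⟩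
  classical
  obtain ⟨m, h1, h2⟩ := Nat.find_spec hex
  refine ⟨m, fun m' h => ?_, h1⟩
  rw [h2]
  exact Nat.find_min' hex ⟨m', h.trans h1, rfl⟩

theorem IsRed.of_append {k : Fin 3 → ℕ} {a b c : List (Fin 3)} (h : IsRed k (a ++ b ++ c)) :
    IsRed k b := by
  intro m hm
  have := h (a ++ m ++ c) (by simp only [word_append, hm])
  simp only [List.length_append] at this
  omega

theorem IsRed.left {k : Fin 3 → ℕ} {a b : List (Fin 3)} (h : IsRed k (a ++ b)) : IsRed k a :=
  IsRed.of_append (a := []) (c := b) (by simpa using h)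

theorem IsRed.right {k : Fin 3 → ℕ} {a b : List (Fin 3)} (h : IsRed k (a ++ b)) : IsRed k b :=
  IsRed.of_append (a := a) (c := []) (by simpa using h)

theorem IsRed.congr {k : Fin 3 → ℕ} {a b : List (Fin 3)} (h : IsRed k a)
    (hw : word k b = word k a) (hl : b.length ≤ a.length) : IsRed k b :=
  fun m hm => hl.trans (h m (hm.trans hw))

theorem IsRed.reverse {k : Fin 3 → ℕ} {a : List (Fin 3)} (h : IsRed k a) : IsRed k a.reverse := by
  intro m hm
  have := h m.reverse (by rw [word_reverse, hm, word_reverse, inv_inv])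
  simpa using this

theorem IsRed.isChain {k : Fin 3 → ℕ} {l : List (Fin 3)} (h : IsRed k l) :
    l.IsChain (· ≠ ·) := by
  induction l with
  | nil => simp
  | cons a l ih =>
    have h1 := ih (IsRed.right (a := [a]) h)
    rcases l with _ | ⟨b, l⟩
    · simp
    · refine List.isChain_cons_cons.mpr ⟨?_, h1⟩
      rintro rfl
      have := h l (by rw [word_cons, word_cons, ← mul_assoc, refl_mul_self, one_mul])
      simp only [List.length_cons] at this
      omega

/-- The index of the angle between two sides. -/
def pairIndex (i m : Fin 3) : Fin 3 := if m = i + 1 then i else m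

theorem pairIndex_comm {i m : Fin 3} (h : i ≠ m) : pairIndex i m = pairIndex m i := by
  revert i m; decide

theorem wall_pair (k : Fin 3 → ℕ) {i m : Fin 3} (h : i ≠ m) :
    wall k i (Pi.single m 1) = -(cosine k (pairIndex i m) / 2) := by
  rcases eq_add_of_ne h with rfl | rfl
  · rw [wall_single_add_one]; simp [pairIndex]
  · rw [wall_single_add_two]
    have : i + 2 ≠ i + 1 := by revert i; decide
    simp [pairIndex, this]

theorem refl_mul_refl_pow {k : Fin 3 → ℕ} (hk : ∀ i, 2 ≤ k i) {i m : Fin 3} (h : i ≠ m) :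
    (refl k i * refl k m) ^ (2 * k (pairIndex i m) + 1) = 1 := by
  rcases eq_add_of_ne h with rfl | rfl
  · have : pairIndex i (i + 1) = i := by simp [pairIndex]
    rw [this]; exact rot_pow_eq_one hk i
  · have h2 : i + 2 ≠ i + 1 := by revert i; decide
    have : pairIndex i (i + 2) = i + 2 := by simp [pairIndex, h2]
    have h3 := rot_inv k (i + 2)
    rw [add_two_one] at h3
    rw [this, ← h3, inv_pow, rot_pow_eq_one hk, inv_one]

theorem refl_mul_refl_pow_succ {k : Fin 3 → ℕ} (hk : ∀ i, 2 ≤ k i) {i m : Fin 3} (h : i ≠ m) :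
    (refl k i * refl k m) ^ (k (pairIndex i m) + 1) =
      (refl k m * refl k i) ^ k (pairIndex i m) := by
  have h1 := refl_mul_refl_pow hk h
  have h2 : refl k m * refl k i = (refl k i * refl k m)⁻¹ := by
    rw [mul_inv_rev, refl_inv, refl_inv]
  rw [h2, inv_pow, eq_inv_iff_mul_eq_one, ← pow_add, ← h1]
  congr 1; ring

theorem word_replicate (k : Fin 3 → ℕ) (i m : Fin 3) (n : ℕ) :
    word k (List.replicate n [i, m]).flatten = (refl k i * refl k m) ^ n := by
  induction n with
  | zero => simp [word]
  | succ n ih =>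
    rw [List.replicate_succ, List.flatten_cons, word_append, ih, pow_succ']
    simp [word]

theorem word_alternating (k : Fin 3 → ℕ) {i m : Fin 3} (n : ℕ) (d : List (Fin 3))
    (hd : d.length = 2 * n) (hc : (i :: d).IsChain (· ≠ ·)) (hm : ∀ x ∈ d, x = i ∨ x = m) :
    word k d = (refl k m * refl k i) ^ n := by
  induction n generalizing d with
  | zero =>
    have : d = [] := List.eq_nil_of_length_eq_zero (by simpa using hd)
    rw [this]; rfl
  | succ n ih =>
    rcases d with _ | ⟨x, _ | ⟨y, d⟩⟩
    · simp at hd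
    · simp at hd; omega
    · simp only [List.isChain_cons_cons] at hc
      have hx : x = m := (hm x (by simp)).resolve_left (Ne.symm hc.1)
      have hy : y = i := (hm y (by simp)).resolve_right (by rw [← hx]; exact Ne.symm hc.2.1)
      subst hx hy
      rw [word_cons, word_cons, ih d (by simpa using (by simp at hd; omega)) hc.2.2
        (fun z hz => hm z (by simp [hz])), pow_succ', mul_assoc]

/-- With M = 2n + 1, an alternating word of length M + 1 in two reflections equals the opposite
alternating word of length M − 1, so no reduced word contains it. -/
theorem length_le_of_isRed {k : Fin 3 → ℕ} (hk : ∀ i, 2 ≤ k i) {i m : Fin 3} (him : i ≠ m)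
    {d : List (Fin 3)} (hd : IsRed k d) (hm : ∀ x ∈ d, x = i ∨ x = m) :
    d.length ≤ 2 * k (pairIndex i m) + 1 := by
  by_contra hlt
  push Not at hlt
  set n := k (pairIndex i m) with hn
  have h1 : IsRed k (d.take (2 * (n + 1))) := by
    have : IsRed k (d.take (2 * (n + 1)) ++ d.drop (2 * (n + 1))) := by
      rwa [List.take_append_drop]
    exact this.left
  have h2 : (d.take (2 * (n + 1))).length = 2 * (n + 1) := by
    rw [List.length_take]; omega
  have h3 : ∀ x ∈ d.take (2 * (n + 1)), x = i ∨ x = m := fun x hx => hm x (List.mem_of_mem_take hx)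
  generalize d.take (2 * (n + 1)) = e at h1 h2 h3
  have key : ∀ a b : Fin 3, a ≠ b → pairIndex b a = pairIndex i m → (∀ x ∈ e, x = a ∨ x = b) →
      (a :: e).IsChain (· ≠ ·) → False := by
    intro a b hab hp he hc
    have h4 := word_alternating k (n + 1) e h2 hc he
    have h5 := refl_mul_refl_pow_succ hk hab.symm
    rw [hp, ← hn] at h5
    have := h1 (List.replicate n [a, b]).flatten (by rw [word_replicate, h4, h5])
    rw [h2] at this
    simp at this
    omega
  rcases e with _ | ⟨x, e⟩
  · simp at h2
  · have hc := h1.isChain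
    rcases h3 x (by simp) with rfl | rfl
    · exact key m x him.symm rfl (fun y hy => (h3 y hy).symm)
        (List.isChain_cons_cons.mpr ⟨him.symm, hc⟩)
    · exact key i x him (pairIndex_comm him.symm) h3 (List.isChain_cons_cons.mpr ⟨him, hc⟩)

/-- Within the plane of two normals each further letter turns the root by one more angle θ. The
coefficients stay nonnegative as long as the word with its last letter has length at most M. -/
theorem sin_smul_word_single {k : Fin 3 → ℕ} {i m : Fin 3} (him : i ≠ m)
    (d : List (Fin 3)) (hm : ∀ x ∈ d, x = i ∨ x = m) (hc : (d ++ [i]).IsChain (· ≠ ·)) :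
    ∃ h o : Fin 3, ((h = i ∧ o = m) ∨ (h = m ∧ o = i)) ∧ (d ++ [i]).head? = some h ∧
      Real.sin (angle k (pairIndex i m)) • word k d (Pi.single i (1 : ℝ)) =
        Real.sin ((d.length + 1) * angle k (pairIndex i m)) • Pi.single h (1 : ℝ) +
          Real.sin (d.length * angle k (pairIndex i m)) • Pi.single o (1 : ℝ) := by
  induction d with
  | nil => exact ⟨i, m, Or.inl ⟨rfl, rfl⟩, rfl, by simp [word]⟩
  | cons x d ih =>
    obtain ⟨h, o, h1, h2, h3⟩ := ih (fun y hy => hm y (by simp [hy])) hc.tail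
    have hx : x = o := by
      have h4 : x ≠ h := by
        rcases hd : d ++ [i] with _ | ⟨y, e⟩
        · simp at hd
        · rw [hd] at h2
          rw [List.cons_append, hd, List.isChain_cons_cons] at hc
          simp at h2
          rw [← h2]; exact hc.1
      rcases h1 with ⟨rfl, rfl⟩ | ⟨rfl, rfl⟩
      · exact (hm x (by simp)).resolve_left h4
      · exact (hm x (by simp)).resolve_right h4
    subst hx
    have hne : x ≠ h := by
      rcases h1 with ⟨rfl, rfl⟩ | ⟨rfl, rfl⟩
      · exact him.symm
      · exact him
    have hp : pairIndex x h = pairIndex i m := by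
      rcases h1 with ⟨rfl, rfl⟩ | ⟨rfl, rfl⟩
      · exact pairIndex_comm him.symm
      · rfl
    refine ⟨x, h, h1.symm.imp And.symm And.symm, by simp, ?_⟩
    rw [word_cons, LinearEquiv.mul_apply, ← map_smul, h3, map_add, map_smul, map_smul,
      refl_apply, refl_apply, wall_single_self, wall_pair k hne, hp]
    set θ := angle k (pairIndex i m)
    have e : Real.sin ((((x :: d).length : ℕ) + 1 : ℝ) * θ) =
        cosine k (pairIndex i m) * Real.sin ((d.length + 1) * θ) - Real.sin (d.length * θ) := by
      have h1 : (((x :: d).length : ℕ) + 1 : ℝ) * θ = (d.length + 1) * θ + θ := by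
        simp; ring
      have h2 : (d.length : ℝ) * θ = (d.length + 1) * θ - θ := by ring
      rw [h1, h2, Real.sin_add, Real.sin_sub]
      change _ = 2 * Real.cos θ * _ - _
      ring
    rw [e]
    have e2 : (((x :: d).length : ℕ) : ℝ) = d.length + 1 := by simp
    rw [e2]
    ext j
    simp only [Pi.add_apply, Pi.smul_apply, Pi.sub_apply, smul_eq_mul]
    ring

/-- The coordinates of a root are all nonnegative or all nonpositive: the decisive case. -/
theorem word_single_nonneg {k : Fin 3 → ℕ} (hk : ∀ i, 2 ≤ k i) (l : List (Fin 3)) (i : Fin 3)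
    (hl : IsRed k (l ++ [i])) : 0 ≤ word k l (Pi.single i (1 : ℝ)) := by
  induction hlen : l.length using Nat.strong_induction_on generalizing l i with
  | _ n ih =>
  subst hlen
  rcases List.eq_nil_or_concat l with rfl | ⟨l0, m, rfl⟩
  · simp [word]
  rw [List.concat_eq_append] at *
  have him : i ≠ m := by
    rintro rfl
    have := hl.isChain
    rw [List.append_assoc] at this
    have h2 := this.right_of_append
    simp at h2
  set l := l0 ++ [m] with hldef
  have hlr : IsRed k l := hl.left
  classical
  -- Split the element as v·d with d a word in the last two letters, lengths adding, and v as short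
  -- as possible. Then v is a minimal coset representative for the dihedral group, and induction
  -- applies to both of its roots.
  have hex : ∃ n, ∃ v d : List (Fin 3), v.length = n ∧ word k (v ++ d) = word k l ∧
      v.length + d.length = l.length ∧ (∀ x ∈ d, x = i ∨ x = m) :=
    ⟨_, l0, [m], rfl, rfl, by simp [hldef], by simp⟩
  obtain ⟨v, d, hv, hw, hlen, hd⟩ := Nat.find_spec hex
  have hmin : ∀ v' d' : List (Fin 3), word k (v' ++ d') = word k l →
      v'.length + d'.length = l.length → (∀ x ∈ d', x = i ∨ x = m) → v.length ≤ v'.length := by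
    intro v' d' h1 h2 h3
    rw [hv]
    exact Nat.find_min' hex ⟨v', d', rfl, h1, h2, h3⟩
  have hvlt : v.length < l.length := by
    have := hmin l0 [m] rfl (by simp [hldef]) (by simp)
    simp [hldef]; omega
  -- A shorter word v' for v·x is, by parity, shorter than v itself. Replacing v·d by v'·(x·d) then
  -- contradicts the minimality of v.
  have hred : ∀ x, x = i ∨ x = m → IsRed k (v ++ [x]) := by
    intro x hx v' hv'
    by_contra hlt
    push Not at hlt
    simp only [List.length_append, List.length_singleton] at hlt
    have hpar := length_parity hv'
    simp only [List.length_append, List.length_singleton, Nat.even_add_one] at hpar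
    have hne : v'.length ≠ v.length := by
      intro h; rw [h] at hpar; exact iff_not_self hpar
    have h1 : word k (v' ++ (x :: d)) = word k l := by
      rw [word_append, hv', word_append, word_singleton, word_cons, mul_assoc,
        ← mul_assoc (refl k x), refl_mul_self, one_mul, ← word_append, hw]
    have h2 := hlr _ h1
    simp only [List.length_append, List.length_cons] at h2
    have := hmin v' (x :: d) h1 (by simp only [List.length_cons]; omega)
      (by intro y hy; rcases List.mem_cons.mp hy with rfl | hy
          · exact hx
          · exact hd y hy)
    omega
  have hi := ih v.length hvlt v i (hred i (Or.inl rfl)) rfl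
  have hm := ih v.length hvlt v m (hred m (Or.inr rfl)) rfl
  have hdi : IsRed k (d ++ [i]) := by
    have : IsRed k (v ++ (d ++ [i])) := by
      refine hl.congr ?_ ?_
      · rw [← List.append_assoc, word_append, hw, ← word_append]
      · simp only [List.length_append] at *; omega
    exact this.right
  have hdl := length_le_of_isRed hk him hdi (by
    intro x hx
    rcases List.mem_append.mp hx with hx | hx
    · exact hd x hx
    · left; simpa using hx)
  obtain ⟨h, o, h1, -, h3⟩ := sin_smul_word_single (k := k) him d hd hdi.isChain
  have hh : 0 ≤ word k v (Pi.single h (1 : ℝ)) := by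
    rcases h1 with ⟨rfl, rfl⟩ | ⟨rfl, rfl⟩ <;> assumption
  have ho : 0 ≤ word k v (Pi.single o (1 : ℝ)) := by
    rcases h1 with ⟨rfl, rfl⟩ | ⟨rfl, rfl⟩ <;> assumption
  set p := pairIndex i m
  have hs := sin_angle_pos hk p
  have hpi := mul_angle k p
  have hθ := angle_pos k p
  rw [List.length_append, List.length_singleton] at hdl
  have hdl' : (d.length : ℝ) + 1 ≤ 2 * k p + 1 := by exact_mod_cast hdl
  have s1 : 0 ≤ Real.sin ((d.length + 1) * angle k p) :=
    Real.sin_nonneg_of_nonneg_of_le_pi (by positivity) (by rw [← hpi]; gcongr)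
  have s2 : 0 ≤ Real.sin (d.length * angle k p) :=
    Real.sin_nonneg_of_nonneg_of_le_pi (by positivity) (by rw [← hpi]; gcongr; linarith)
  have h4 : Real.sin (angle k p) • word k l (Pi.single i (1 : ℝ)) =
      Real.sin ((d.length + 1) * angle k p) • word k v (Pi.single h (1 : ℝ)) +
        Real.sin (d.length * angle k p) • word k v (Pi.single o (1 : ℝ)) := by
    rw [← hw, word_append, LinearEquiv.mul_apply, ← map_smul, h3, map_add, map_smul, map_smul]
  have h5 : 0 ≤ Real.sin (angle k p) • word k l (Pi.single i (1 : ℝ)) := by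
    rw [h4]; exact add_nonneg (smul_nonneg s1 hh) (smul_nonneg s2 ho)
  intro j
  have := h5 j
  exact nonneg_of_mul_nonneg_right this hs

/-! ### The invariant form and the fundamental domain -/

/-- The invariant symmetric bilinear form. -/
noncomputable def form (k : Fin 3 → ℕ) (y z : Space) : ℝ := ∑ i, y i * wall k i z

theorem form_comm (k : Fin 3 → ℕ) (y z : Space) : form k y z = form k z y := by
  simp only [form, Fin.sum_univ_three, wall_apply]
  simp
  ring

theorem form_single (k : Fin 3 → ℕ) (i : Fin 3) (z : Space) :
    form k (Pi.single i 1) z = wall k i z := by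
  simp [form, Pi.single_apply]

theorem form_add_left (k : Fin 3 → ℕ) (y y' z : Space) :
    form k (y + y') z = form k y z + form k y' z := by
  simp [form, add_mul, Finset.sum_add_distrib]

theorem form_smul_left (k : Fin 3 → ℕ) (c : ℝ) (y z : Space) :
    form k (c • y) z = c * form k y z := by
  simp [form, Finset.mul_sum, mul_assoc]

theorem form_refl (k : Fin 3 → ℕ) (i : Fin 3) (y z : Space) :
    form k (refl k i y) z = form k y (refl k i z) := by
  have h : ∀ y z, form k (refl k i y) z = form k y z - 2 * wall k i y * wall k i z := by
    intro y z
    have : refl k i y = y + (-(2 * wall k i y)) • Pi.single i (1 : ℝ) := by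
      rw [refl_apply, neg_smul, sub_eq_add_neg]
    rw [this, form_add_left, form_smul_left, form_single]; ring
  rw [h, form_comm k y (refl k i z), h, form_comm k z y]; ring

theorem form_word (k : Fin 3 → ℕ) (l : List (Fin 3)) (y z : Space) :
    form k (word k l y) z = form k y (word k l.reverse z) := by
  induction l generalizing z with
  | nil => rfl
  | cons i l ih =>
    rw [word_cons, LinearEquiv.mul_apply, form_refl, ih, List.reverse_cons, word_append,
      word_singleton, LinearEquiv.mul_apply]

theorem form_word_word (k : Fin 3 → ℕ) (l : List (Fin 3)) (y z : Space) :
    form k (word k l y) (word k l z) = form k y z := by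
  rw [form_word, word_reverse, ← LinearEquiv.mul_apply, inv_mul_cancel]; rfl

theorem wall_word (k : Fin 3 → ℕ) (l : List (Fin 3)) (i : Fin 3) (y : Space) :
    wall k i (word k l y) = ∑ j, word k l.reverse (Pi.single i (1 : ℝ)) j * wall k j y := by
  rw [← form_single, form_comm, form_word, form_comm]; rfl

theorem word_conj_refl (k : Fin 3 → ℕ) (l : List (Fin 3)) (i j : Fin 3)
    (h : word k l (Pi.single i (1 : ℝ)) = Pi.single j 1) :
    word k l * refl k i = refl k j * word k l := by
  ext1 y
  rw [LinearEquiv.mul_apply, LinearEquiv.mul_apply, refl_apply, refl_apply, map_sub, map_smul, h,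
    ← form_single k j, ← h, form_word_word, form_single]

section Large

variable {k : Fin 3 → ℕ} (hk : ∀ i, 2 ≤ k i)
include hk

/-- The fundamental chamber meets none of its other translates, except along the sides. -/
theorem word_eq_one_or_refl (l : List (Fin 3)) {x : Space} (hx : x ∈ Chamber k)
    (hx' : ∀ i j, wall k i x = 0 → wall k j x = 0 → i = j) (hw : (word k l)⁻¹ x ∈ Chamber k) :
    word k l = 1 ∨ ∃ i, wall k i x = 0 ∧ word k l = refl k i := by
  induction hn : l.length using Nat.strong_induction_on generalizing l with
  | _ n ih =>
  subst hn
  obtain ⟨m, hm, he⟩ := exists_isRed k l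
  rcases List.eq_nil_or_concat m with rfl | ⟨m, i, rfl⟩
  · left; rw [← he]; rfl
  rw [List.concat_eq_append] at *
  have hlen : m.length < l.length := by
    have := hm l he.symm
    simp at this; omega
  have hpos := word_single_nonneg hk m i hm
  have hroot : word k (m ++ [i]) (Pi.single i (1 : ℝ)) = -word k m (Pi.single i 1) := by
    rw [word_append, word_singleton, LinearEquiv.mul_apply, ← map_neg]
    congr 1
    rw [refl_apply, wall_single_self]
    ext j; simp; ring
  have hwall : wall k i ((word k l)⁻¹ x) = -∑ j, word k m (Pi.single i (1 : ℝ)) j * wall k j x := by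
    rw [← word_reverse, wall_word, List.reverse_reverse, ← he, hroot, ← Finset.sum_neg_distrib]
    simp
  have hterm : ∀ j, 0 ≤ word k m (Pi.single i (1 : ℝ)) j * wall k j x :=
    fun j => mul_nonneg (hpos j) (hx j)
  -- The root is nonnegative and `x` is in the chamber, so every term is nonnegative; the translate
  -- being in the chamber bounds the sum above by zero. Hence only the coordinate of the one wall
  -- through `x` survives.
  have hsum : ∑ j, word k m (Pi.single i (1 : ℝ)) j * wall k j x = 0 := by
    apply le_antisymm
    · have := hw i
      rw [hwall] at this
      linarith
    · exact Finset.sum_nonneg fun j _ => hterm j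
  have hz := (Finset.sum_eq_zero_iff_of_nonneg fun j _ => hterm j).mp hsum
  have hne : word k m (Pi.single i (1 : ℝ)) ≠ 0 := by
    rw [Ne, LinearEquiv.map_eq_zero_iff]
    simp
  obtain ⟨j, hj⟩ := Function.ne_iff.mp hne
  have hj0 : wall k j x = 0 := (mul_eq_zero.mp (hz j (Finset.mem_univ j))).resolve_left hj
  obtain ⟨c, hc⟩ : ∃ c : ℝ, word k m (Pi.single i (1 : ℝ)) = c • Pi.single j 1 := by
    refine ⟨word k m (Pi.single i (1 : ℝ)) j, ?_⟩
    ext j'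
    by_cases h : j' = j
    · subst h; simp
    · have : wall k j' x ≠ 0 := fun h' => h (hx' _ _ h' hj0)
      simp [h, (mul_eq_zero.mp (hz j' (Finset.mem_univ j'))).resolve_right this]
  -- The image root has norm one and is a nonnegative multiple of a simple root.
  have hc1 : c = 1 := by
    have h1 : form k (word k m (Pi.single i 1)) (word k m (Pi.single i (1 : ℝ))) = 1 := by
      rw [form_word_word, form_single, wall_single_self]
    rw [hc, form_smul_left, form_comm, form_smul_left, form_single, wall_single_self] at h1
    have h2 : 0 ≤ c := by
      have := hpos j
      rw [hc] at this
      simpa using this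
    nlinarith
  rw [hc1, one_smul] at hc
  have hconj := word_conj_refl k m i j hc
  have hword : word k l = refl k j * word k m := by
    rw [← he, word_append, word_singleton, hconj]
  have hxj : refl k j x = x := by rw [refl_apply, hj0]; simp
  have hw' : (word k m)⁻¹ x ∈ Chamber k := by
    rw [hword, mul_inv_rev, refl_inv, LinearEquiv.mul_apply, hxj] at hw
    exact hw
  rcases ih m.length hlen m hw' rfl with h | ⟨j', h1, h2⟩
  · right; exact ⟨j, hj0, by rw [hword, h, mul_one]⟩
  · left
    rw [hword, h2, hx' _ _ h1 hj0, refl_mul_self]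

/-- The sum of the pairings with the sides does not decrease from the fundamental chamber to its
translates. -/
theorem sum_wall_word_ge (l : List (Fin 3)) {x : Space} (hx : x ∈ Chamber k) :
    ∑ i, wall k i x ≤ ∑ i, wall k i (word k l x) := by
  obtain ⟨m, hm, he⟩ := exists_isRed k l
  rw [← he]
  clear he
  induction m with
  | nil => exact le_rfl
  | cons i m ih =>
    have h1 := ih (IsRed.right (a := [i]) hm)
    refine h1.trans ?_
    have h2 : 0 ≤ wall k i (word k m x) := by
      rw [wall_word]
      refine Finset.sum_nonneg fun j _ => mul_nonneg ?_ (hx j)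
      have h3 := hm.reverse
      rw [List.reverse_cons] at h3
      exact word_single_nonneg hk _ i h3 j
    rw [word_cons, LinearEquiv.mul_apply]
    generalize word k m x = z at h2
    have h4 : ∀ f : Fin 3 → ℝ, ∑ j, f j = f i + f (i + 1) + f (i + 2) := by
      intro f; fin_cases i <;> simp [Fin.sum_univ_three] <;> ring
    rw [h4, h4, wall_refl_self, wall_add_one_refl, wall_add_two_refl]
    -- The reflection changes the sum by (c_i + c_{i+2} − 2) times the nonnegative pairing, and both
    -- cosines exceed 1.
    have h5 := cosine_gt hk i
    have h6 := cosine_gt hk (i + 2)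
    nlinarith

end Large

/-! ### Traces, eigenvalues and hyperbolicity -/

/-- The Cayley–Hamilton theorem for `3 × 3` matrices. -/
theorem cayleyHamilton_fin_three (A : Matrix (Fin 3) (Fin 3) ℝ) :
    A ^ 3 - A.trace • A ^ 2 + A.adjugate.trace • A - A.det • (1 : Matrix (Fin 3) (Fin 3) ℝ) = 0 := by
  ext i j
  simp only [Matrix.det_fin_three, Matrix.trace_fin_three, Matrix.adjugate_fin_three, pow_succ,
    pow_zero, one_mul, Matrix.sub_apply, Matrix.add_apply, Matrix.smul_apply, Matrix.mul_apply,
    Fin.sum_univ_three, smul_eq_mul, Matrix.zero_apply]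
  fin_cases i <;> fin_cases j <;> simp <;> ring

/-- The trace of an automorphism of the space. -/
noncomputable def tr (g : Space ≃ₗ[ℝ] Space) : ℝ :=
  (LinearMap.toMatrix' (g : Space →ₗ[ℝ] Space)).trace

theorem tr_conj (g h : Space ≃ₗ[ℝ] Space) : tr (g * h * g⁻¹) = tr h := by
  have e : ∀ a b : Space ≃ₗ[ℝ] Space, LinearMap.toMatrix' ((a * b : Space ≃ₗ[ℝ] Space) :
      Space →ₗ[ℝ] Space) = LinearMap.toMatrix' (a : Space →ₗ[ℝ] Space) *
        LinearMap.toMatrix' (b : Space →ₗ[ℝ] Space) := fun a b =>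
    LinearMap.toMatrix'_comp _ _
  rw [tr, e, Matrix.trace_mul_comm, ← e, ← mul_assoc, inv_mul_cancel, one_mul, tr]

theorem wall_eq_sum (k : Fin 3 → ℕ) (i : Fin 3) (y : Space) :
    wall k i y = ∑ j, wall k i (Pi.single j 1) * y j := by
  conv_lhs => rw [pi_eq_sum_univ' y, map_sum]
  refine Finset.sum_congr rfl fun j _ => ?_
  rw [map_smul, smul_eq_mul, mul_comm]

theorem toMatrix_word_transpose (k : Fin 3 → ℕ) (l : List (Fin 3)) :
    (LinearMap.toMatrix' (word k l : Space →ₗ[ℝ] Space)).transpose *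
      (Matrix.of fun i j => wall k i (Pi.single j 1)) =
    (Matrix.of fun i j => wall k i (Pi.single j 1)) *
      LinearMap.toMatrix' (word k l.reverse : Space →ₗ[ℝ] Space) := by
  ext i j
  have h := form_word k l (Pi.single i 1) (Pi.single j 1)
  rw [form_single, wall_eq_sum] at h
  rw [Matrix.mul_apply, Matrix.mul_apply]
  simpa [form, LinearMap.toMatrix'_apply] using h

section Large

variable {k : Fin 3 → ℕ} (hk : ∀ i, 2 ≤ k i)
include hk

/-- By invariance of the nondegenerate form, the inverse is conjugate through the Gram matrix to the
transpose. -/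
theorem tr_word_inv (l : List (Fin 3)) : tr (word k l)⁻¹ = tr (word k l) := by
  have h := toMatrix_word_transpose k l
  set G : Matrix (Fin 3) (Fin 3) ℝ := Matrix.of fun i j => wall k i (Pi.single j 1) with hG
  have hlin : ∀ (y : Space), G.mulVec y = fun i => wall k i y := by
    intro y
    ext i
    exact (wall_eq_sum k i y).symm
  have hdet : G.det ≠ 0 := by
    intro h0
    obtain ⟨v, hv, hv'⟩ := Matrix.exists_mulVec_eq_zero_iff.mpr h0
    refine hv (eq_zero_of_wall hk fun i => ?_)
    rw [hlin] at hv'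
    exact congrFun hv' i
  rw [← word_reverse, tr, tr]
  have hu : IsUnit G.det := isUnit_iff_ne_zero.mpr hdet
  have h2 : LinearMap.toMatrix' (word k l.reverse : Space →ₗ[ℝ] Space) =
      G⁻¹ * ((LinearMap.toMatrix' (word k l : Space →ₗ[ℝ] Space)).transpose * G) := by
    rw [h, ← mul_assoc, Matrix.nonsing_inv_mul _ hu, one_mul]
  rw [h2, Matrix.trace_mul_comm, mul_assoc, Matrix.mul_nonsing_inv _ hu, mul_one,
    Matrix.trace_transpose]

/-- The characteristic equation of an orientation preserving isometry. -/
theorem charpoly_word (l : List (Fin 3)) (hl : Even l.length) (y : Space) :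
    word k l (word k l (word k l y)) - tr (word k l) • word k l (word k l y) +
      tr (word k l) • word k l y - y = 0 := by
  set g := word k l with hg
  set A := LinearMap.toMatrix' (g : Space →ₗ[ℝ] Space) with hA
  have hAy : ∀ y, A.mulVec y = g y := fun y => by
    rw [hA, LinearMap.toMatrix'_mulVec]; rfl
  have hdet : A.det = 1 := by
    rw [hA, LinearMap.det_toMatrix', ← LinearEquiv.coe_det, hg, det_word, hl.neg_one_pow]; rfl
  have hinv : A.adjugate = LinearMap.toMatrix' ((g⁻¹ : Space ≃ₗ[ℝ] Space) : Space →ₗ[ℝ] Space) := by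
    have h1 : A * LinearMap.toMatrix' ((g⁻¹ : Space ≃ₗ[ℝ] Space) : Space →ₗ[ℝ] Space) = 1 := by
      rw [hA, ← LinearMap.toMatrix'_comp, ← LinearMap.toMatrix'_id]
      congr 1
      ext1 x
      exact LinearMap.ext fun z => LinearEquiv.congr_fun (mul_inv_cancel g) _
    calc A.adjugate = A.adjugate * (A * LinearMap.toMatrix' ((g⁻¹ : Space ≃ₗ[ℝ] Space) :
        Space →ₗ[ℝ] Space)) := by rw [h1, mul_one]
      _ = _ := by rw [← mul_assoc, Matrix.adjugate_mul, hdet, one_smul, one_mul]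
  have h := cayleyHamilton_fin_three A
  have htr : A.adjugate.trace = tr g := by rw [hinv]; exact tr_word_inv hk l
  rw [htr, hdet, show A.trace = tr g from rfl] at h
  have h2 := congrArg (fun B : Matrix (Fin 3) (Fin 3) ℝ => B.mulVec y) h
  simp only [Matrix.sub_mulVec, Matrix.add_mulVec, Matrix.smul_mulVec, Matrix.one_mulVec, pow_succ,
    pow_zero, one_mul, ← Matrix.mulVec_mulVec, hAy, one_smul, Matrix.zero_mulVec] at h2
  exact h2

/-- The coordinates given by the sides of the region of a branch. -/
theorem exists_coneEquiv (b : Bool) (j : Fin 3) : ∃ Φ : Space ≃ₗ[ℝ] Space, ∀ y,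
    Φ y 0 = -wall k (entry b j) y ∧ Φ y 1 = sideA k b j y ∧ Φ y 2 = sideB k b j y := by
  let Φ : Space →ₗ[ℝ] Space :=
    { toFun := fun y => ![-wall k (entry b j) y, sideA k b j y, sideB k b j y]
      map_add' := by
        intro y z
        cases b <;> ext i <;> fin_cases i <;> simp [sideA, sideB] <;> ring
      map_smul' := by
        intro c y
        cases b <;> ext i <;> fin_cases i <;> simp [sideA, sideB] <;> ring }
  have hinj : Function.Injective Φ := by
    rw [← LinearMap.ker_eq_bot, LinearMap.ker_eq_bot']
    intro y hy
    have h0 : wall k (entry b j) y = 0 := by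
      have := congrFun hy 0
      simpa [Φ] using this
    have h1 : sideA k b j y = 0 := congrFun hy 1
    have h2 : sideB k b j y = 0 := congrFun hy 2
    obtain ⟨-, c2, -⟩ := cosine_bounds hk j
    have c3 : cosine k j ^ 2 - 1 ≠ 0 := by linarith
    cases b
    · simp only [entry] at h0
      simp only [sideA, sideB, h0, mul_zero, add_zero, zero_add] at h1 h2
      exact eq_zero_of_wall' hk j ((mul_eq_zero.mp h2).resolve_left c3) h0 h1
    · simp only [entry] at h0
      simp only [sideA, sideB, h0, mul_zero, add_zero, zero_add] at h1 h2
      exact eq_zero_of_wall' hk j h0 ((mul_eq_zero.mp h2).resolve_left c3) h1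
  exact ⟨LinearEquiv.ofInjectiveEndo Φ hinj, fun y => ⟨rfl, rfl, rfl⟩⟩

/-- A cyclically reduced closed path of length at least four is a hyperbolic element. -/
theorem three_lt_tr (b : Bool) (j : Fin 3) (l : List (Fin 3))
    (hl : (j :: l ++ [j]).IsChain (· ≠ ·)) (hf : flag b (j :: l) = b) (hlen : 3 ≤ l.length) :
    3 < tr (ev k b (j :: l)) := by
  obtain ⟨Φ, hΦ⟩ := exists_coneEquiv hk b j
  set g := ev k b (j :: l) with hg
  rw [← tr_conj Φ, tr, Matrix.trace_fin_three]
  simp only [LinearMap.toMatrix'_apply]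
  -- In coordinates adapted to the region the basis vectors are its extreme rays. The element maps
  -- the region into itself, so its diagonal entries are nonnegative, and the entry for the depth is
  -- at least (3/2)⁴ > 3.
  have hmem : ∀ i, Φ⁻¹ (Pi.single i (1 : ℝ)) ∈ Cone k b j := by
    intro i
    obtain ⟨h0, h1, h2⟩ := hΦ (Φ⁻¹ (Pi.single i (1 : ℝ)))
    have e : Φ (Φ⁻¹ (Pi.single i (1 : ℝ))) = Pi.single i 1 :=
      LinearEquiv.congr_fun (mul_inv_cancel Φ) _
    rw [e] at h0 h1 h2
    have hs : ∀ a : Fin 3, 0 ≤ (Pi.single i (1 : ℝ) : Space) a := fun a => by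
      by_cases h : a = i
      · subst h; simp
      · simp [h]
    refine ⟨?_, ?_, ?_⟩
    · linarith [hs 0]
    · rw [← h1]; exact hs 1
    · rw [← h2]; exact hs 2
  have hstep : ∀ i, g (Φ⁻¹ (Pi.single i (1 : ℝ))) ∈ Cone k b j ∧
      wall k (entry b j) (g (Φ⁻¹ (Pi.single i (1 : ℝ)))) ≤
        (3 / 2) ^ (l.length + 1) * wall k (entry b j) (Φ⁻¹ (Pi.single i (1 : ℝ))) := by
    intro i
    have := ev_mem_cone hk l b (j := j) (i := j) hl (y := Φ⁻¹ (Pi.single i (1 : ℝ)))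
      (by rw [hf]; exact hmem i)
    rwa [hf] at this
  have e : ∀ i a, (Φ * g * Φ⁻¹ : Space ≃ₗ[ℝ] Space) (Pi.single i (1 : ℝ)) a =
      Φ (g (Φ⁻¹ (Pi.single i (1 : ℝ)))) a := fun i a => rfl
  have f0 : (3 / 2 : ℝ) ^ (l.length + 1) ≤
      (Φ * g * Φ⁻¹ : Space ≃ₗ[ℝ] Space) (Pi.single 0 (1 : ℝ)) 0 := by
    rw [e, (hΦ _).1]
    have h1 := (hstep 0).2
    have h2 := (hΦ (Φ⁻¹ (Pi.single 0 (1 : ℝ)))).1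
    have e : Φ (Φ⁻¹ (Pi.single 0 (1 : ℝ))) = Pi.single 0 1 :=
      LinearEquiv.congr_fun (mul_inv_cancel Φ) _
    rw [e, Pi.single_eq_same] at h2
    have h3 : wall k (entry b j) (Φ⁻¹ (Pi.single 0 (1 : ℝ))) = -1 := by linarith
    rw [h3] at h1
    linarith
  have f1 : 0 ≤ (Φ * g * Φ⁻¹ : Space ≃ₗ[ℝ] Space) (Pi.single 1 (1 : ℝ)) 1 := by
    rw [e, (hΦ _).2.1]; exact (hstep 1).1.2.1
  have f2 : 0 ≤ (Φ * g * Φ⁻¹ : Space ≃ₗ[ℝ] Space) (Pi.single 2 (1 : ℝ)) 2 := by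
    rw [e, (hΦ _).2.2]; exact (hstep 2).1.2.2
  have h4 : (3 / 2 : ℝ) ^ 4 ≤ (3 / 2) ^ (l.length + 1) :=
    pow_le_pow_right₀ (by norm_num) (by omega)
  have : (3 : ℝ) < (3 / 2) ^ 4 := by norm_num
  have f0' := f0
  change _ ≤ ((Φ * g * Φ⁻¹ : Space ≃ₗ[ℝ] Space) : Space →ₗ[ℝ] Space) _ _ at f0'
  change 0 ≤ ((Φ * g * Φ⁻¹ : Space ≃ₗ[ℝ] Space) : Space →ₗ[ℝ] Space) _ _ at f1 f2
  linarith

end Large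

/-- The larger root of μ² − (t − 1)μ + 1. By `charpoly_word` the eigenvalues of an element of trace
t are then μ, 1 and μ⁻¹. -/
theorem exists_multiplier {t : ℝ} (ht : 3 < t) : ∃ μ : ℝ, 1 < μ ∧ t = μ + μ⁻¹ + 1 := by
  have h1 : 0 ≤ (t - 1) ^ 2 - 4 := by nlinarith
  have h2 := Real.sq_sqrt h1
  have h3 := Real.sqrt_nonneg ((t - 1) ^ 2 - 4)
  set s := Real.sqrt ((t - 1) ^ 2 - 4)
  have h4 : 0 < (t - 1 + s) / 2 := by linarith
  refine ⟨(t - 1 + s) / 2, by linarith, ?_⟩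
  have h5 : ((t - 1 + s) / 2)⁻¹ = (t - 1 - s) / 2 := inv_eq_of_mul_eq_one_right (by nlinarith)
  rw [h5]; ring

theorem multiplier_unique {μ ν : ℝ} (hμ : 1 < μ) (hν : 1 < ν) (h : μ + μ⁻¹ + 1 = ν + ν⁻¹ + 1) :
    μ = ν := by
  have h1 : μ ≠ 0 := by linarith
  have h2 : ν ≠ 0 := by linarith
  field_simp at h
  have : (μ - ν) * (μ * ν - 1) = 0 := by nlinarith
  rcases mul_eq_zero.mp this with h | h
  · linarith
  · nlinarith

/-- A sequence that dominates a geometric progression of ratio greater than one. -/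
theorem nonneg_of_geometric {μ a c d : ℝ} (hμ : 1 < μ)
    (h : ∀ m : ℕ, 0 ≤ μ ^ m * a + c + μ⁻¹ ^ m * d) : 0 ≤ a := by
  by_contra ha
  push Not at ha
  obtain ⟨m, hm⟩ := pow_unbounded_of_one_lt ((|c| + |d| + 1) / (-a)) hμ
  rw [div_lt_iff₀ (by linarith)] at hm
  have h1 : μ⁻¹ ^ m ≤ 1 := pow_le_one₀ (by positivity) (inv_le_one_of_one_le₀ hμ.le)
  have h2 : 0 ≤ μ⁻¹ ^ m := by positivity
  have h3 : μ⁻¹ ^ m * d ≤ |d| := by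
    calc μ⁻¹ ^ m * d ≤ μ⁻¹ ^ m * |d| := mul_le_mul_of_nonneg_left (le_abs_self d) h2
      _ ≤ 1 * |d| := mul_le_mul_of_nonneg_right h1 (abs_nonneg d)
      _ = |d| := one_mul _
  have := h m
  linarith [le_abs_self c]

theorem add_two_ne_add_one (i : Fin 3) : i + 2 ≠ i + 1 := by revert i; decide

theorem exists_word_ev (k : Fin 3 → ℕ) (b : Bool) (l : List (Fin 3)) :
    ∃ m : List (Fin 3), Even m.length ∧ word k m = ev k b l := by
  induction l generalizing b with
  | nil => exact ⟨[], by simp, rfl⟩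
  | cons j l ih =>
    obtain ⟨m, h1, h2⟩ := ih (!b)
    cases b
    · refine ⟨(j + 1) :: j :: m, by simpa [Nat.even_add_one] using h1, ?_⟩
      rw [word_cons, word_cons, h2, ev, step, rot_inv, mul_assoc]
    · refine ⟨j :: (j + 1) :: m, by simpa [Nat.even_add_one] using h1, ?_⟩
      rw [word_cons, word_cons, h2, ev, step, rot, mul_assoc]

/-! ### Axes inside the tree of chambers -/

/-- The chambers of the tree of chambers that contains the fundamental chamber, this having the
kind `b`. -/
def TreeChamber (k : Fin 3 → ℕ) (b : Bool) : Set (Space ≃ₗ[ℝ] Space) :=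
  {κ | ∃ l, κ = ev k b l ∨ ∃ s, κ = ev k b l * refl k s}

theorem step_mul_mem_treeChamber {k : Fin 3 → ℕ} {b : Bool} {j : Fin 3} {κ : Space ≃ₗ[ℝ] Space}
    (h : κ ∈ TreeChamber k (!b)) : step k b j * κ ∈ TreeChamber k b := by
  obtain ⟨l, rfl | ⟨s, rfl⟩⟩ := h
  · exact ⟨j :: l, Or.inl rfl⟩
  · exact ⟨j :: l, Or.inr ⟨s, by rw [ev, mul_assoc]⟩⟩

theorem ev_mul_mem_treeChamber {k : Fin 3 → ℕ} {b : Bool} (m : List (Fin 3))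
    {κ : Space ≃ₗ[ℝ] Space} (h : κ ∈ TreeChamber k (flag b m)) :
    ev k b m * κ ∈ TreeChamber k b := by
  obtain ⟨l, rfl | ⟨s, rfl⟩⟩ := h
  · exact ⟨m ++ l, Or.inl (ev_append k b m l).symm⟩
  · exact ⟨m ++ l, Or.inr ⟨s, by rw [ev_append, mul_assoc]⟩⟩

theorem smul_mem_cone {k : Fin 3 → ℕ} {b : Bool} {j : Fin 3} {y : Space} (hy : y ∈ Cone k b j)
    {c : ℝ} (hc : 0 ≤ c) : c • y ∈ Cone k b j := by
  obtain ⟨h0, h1, h2⟩ := hy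
  have e1 : sideA k b j (c • y) = c * sideA k b j y := by
    cases b <;> simp only [sideA, map_smul, smul_eq_mul] <;> ring
  have e2 : sideB k b j (c • y) = c * sideB k b j y := by
    cases b <;> simp only [sideB, map_smul, smul_eq_mul] <;> ring
  refine ⟨?_, ?_, ?_⟩
  · rw [map_smul, smul_eq_mul]; exact mul_nonpos_of_nonneg_of_nonpos hc h0
  · rw [e1]; positivity
  · rw [e2]; positivity

theorem pow_smul_of_eigen {g : Space ≃ₗ[ℝ] Space} {v : Space} {c : ℝ} (h : g v = c • v) (m : ℕ) :
    (g ^ m) v = c ^ m • v := by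
  induction m with
  | zero => simp
  | succ m ih =>
    rw [pow_succ', LinearEquiv.mul_apply, ih, map_smul, h, smul_smul, pow_succ]

section Large

variable {k : Fin 3 → ℕ} (hk : ∀ i, 2 ≤ k i)
include hk

/-- The region of a branch is on one side of the walls that bound the other branches. -/
theorem side_nonneg_of_cone (b : Bool) (i j : Fin 3) {y : Space} (hy : y ∈ Cone k b i) :
    0 ≤ sideA k b j y ∧ 0 ≤ sideB k b j y := by
  have hw : ∀ l, l ≠ entry b i → 0 ≤ wall k l y := fun l hl => wall_nonneg_of_cone hk hl hy
  obtain ⟨h0, h1, h2⟩ := hy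
  obtain ⟨a1, a2, a3, a4, a5⟩ := cosine_bounds hk i
  obtain ⟨b1, b2, b3, b4, b5⟩ := cosine_bounds hk (i + 1)
  obtain ⟨c1, c2, c3, c4, c5⟩ := cosine_bounds hk (i + 2)
  have hb := add_two_ne_add_one i
  cases b <;> rcases eq_or_eq_add i j with rfl | rfl | rfl <;>
    simp only [entry, sideA, sideB, add_one_two, add_two_one, add_two_two, add_one_one]
      at h0 h1 h2 hw ⊢
  · exact ⟨h1, h2⟩
  · have w0 := hw i (add_one_ne i).symm
    have w2 := hw (i + 2) hb
    exact ⟨by nlinarith, by nlinarith⟩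
  · have w0 := hw i (add_one_ne i).symm
    have w2 := hw (i + 2) hb
    exact ⟨by by_contra h; push Not at h; nlinarith, by nlinarith⟩
  · exact ⟨h1, h2⟩
  · have w1 := hw (i + 1) (add_one_ne i)
    have w2 := hw (i + 2) (add_two_ne i)
    exact ⟨by by_contra h; push Not at h; nlinarith, by nlinarith⟩
  · have w1 := hw (i + 1) (add_one_ne i)
    have w2 := hw (i + 2) (add_two_ne i)
    exact ⟨by nlinarith, by nlinarith⟩

theorem ev_pow_mem_cone (b : Bool) (j : Fin 3) (l : List (Fin 3))
    (hl : (j :: l ++ [j]).IsChain (· ≠ ·)) (hf : flag b (j :: l) = b) {y : Space}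
    (hy : y ∈ Cone k b j) (n : ℕ) : (ev k b (j :: l) ^ n) y ∈ Cone k b j ∧
      wall k (entry b j) ((ev k b (j :: l) ^ n) y) ≤ (3 / 2) ^ n * wall k (entry b j) y := by
  induction n with
  | zero => simpa using hy
  | succ n ih =>
    obtain ⟨h1, h2⟩ := ih
    rw [pow_succ', LinearEquiv.mul_apply]
    have h3 := ev_mem_cone hk l b (j := j) (i := j) hl
      (y := (ev k b (j :: l) ^ n) y) (by rw [hf]; exact h1)
    rw [hf] at h3
    refine ⟨h3.1, h3.2.trans ?_⟩
    have h4 : (3 / 2 : ℝ) ≤ (3 / 2) ^ (l.length + 1) := le_self_pow₀ (by norm_num) (by omega)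
    have h5 := h1.1
    calc _ ≤ (3 / 2 : ℝ) * wall k (entry b j) ((ev k b (j :: l) ^ n) y) :=
          mul_le_mul_of_nonpos_right h4 h5
      _ ≤ 3 / 2 * ((3 / 2) ^ n * wall k (entry b j) y) := by gcongr
      _ = _ := by rw [pow_succ]; ring

/-- The attracting direction of a hyperbolic element lies in the region of its first branch. -/
theorem exists_eigen (b : Bool) (j : Fin 3) (l : List (Fin 3))
    (hl : (j :: l ++ [j]).IsChain (· ≠ ·)) (hf : flag b (j :: l) = b) {μ : ℝ} (hμ : 1 < μ)
    (ht : tr (ev k b (j :: l)) = μ + μ⁻¹ + 1) :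
    ∃ ξ ∈ Cone k b j, ξ ≠ 0 ∧ ev k b (j :: l) ξ = μ • ξ := by
  obtain ⟨Φ, hΦ⟩ := exists_coneEquiv hk b j
  set x := ev k b (j :: l) basePoint with hx
  have hx1 : x ∈ OpenCone k b j :=
    ev_mem_openCone hk l b (List.IsChain.left_of_append hl) (basePoint_mem hk)
  have hpow := ev_pow_mem_cone hk b j l hl hf (openCone_subset k b j hx1)
  obtain ⟨m, hm, hg⟩ := exists_word_ev k b (j :: l)
  have hch := charpoly_word hk m hm
  rw [hg] at hch
  set g := ev k b (j :: l)
  obtain ⟨a, ha⟩ : ∃ a, a = μ⁻¹ := ⟨_, rfl⟩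
  have haμ : a * μ = 1 := by rw [ha]; exact inv_mul_cancel₀ (by linarith)
  have ha1 : a < 1 := by rw [ha]; exact inv_lt_one_of_one_lt₀ hμ
  have ha0 : 0 < a := by rw [ha]; positivity
  rw [ht, ← ha] at hch
  have h3 : g (g (g x)) = (μ + a + 1) • g (g x) - (μ + a + 1) • g x + x := by
    rw [← sub_eq_zero, ← hch x]; abel
  -- Apply to `x` the products of two of the factors g − μ, g − 1, g − μ⁻¹. The characteristic
  -- equation makes the results satisfy the eigenvector equations for μ, 1 and μ⁻¹; Lagrange
  -- interpolation recovers the orbit of `x` from them.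
  set v1 := g (g x) - (1 + a) • g x + a • x with hv1
  set v2 := g (g x) - (μ + a) • g x + x with hv2
  set v3 := g (g x) - (1 + μ) • g x + μ • x with hv3
  have e1 : g v1 = μ • v1 := by
    rw [hv1, map_add, map_sub, map_smul, map_smul, h3]
    linear_combination (norm := module) haμ • (g x - x)
  have e2 : g v2 = (1 : ℝ) • v2 := by
    rw [hv2, map_add, map_sub, map_smul, h3]
    module
  have e3 : g v3 = a • v3 := by
    rw [hv3, map_add, map_sub, map_smul, map_smul, h3]
    linear_combination (norm := module) haμ • (g x - x)
  have hdec : ∀ n : ℕ, ((μ - 1) * (μ - a) * (1 - a)) • (g ^ n) x =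
      ((1 - a) * μ ^ n) • v1 - (μ - a) • v2 + ((μ - 1) * a ^ n) • v3 := by
    intro n
    have : ((μ - 1) * (μ - a) * (1 - a)) • x = (1 - a) • v1 - (μ - a) • v2 + (μ - 1) • v3 := by
      rw [hv1, hv2, hv3]
      linear_combination (norm := module) -(haμ • ((μ - a) • x))
    rw [← map_smul, this, map_add, map_sub, map_smul, map_smul, map_smul, pow_smul_of_eigen e1,
      pow_smul_of_eigen e2, pow_smul_of_eigen e3]
    simp only [smul_smul, one_pow, mul_one]
  set D := (μ - 1) * (μ - a) * (1 - a) with hD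
  have hDpos : 0 < D := by
    have h1 : 0 < μ - 1 := by linarith
    have h2 : 0 < μ - a := by linarith
    have h3 : 0 < 1 - a := by linarith
    positivity
  have hval : ∀ (f : Space →ₗ[ℝ] ℝ) (n : ℕ), D * f ((g ^ n) x) =
      μ ^ n * ((1 - a) * f v1) + (-(μ - a) * f v2) + μ⁻¹ ^ n * ((μ - 1) * f v3) := by
    intro f n
    rw [← smul_eq_mul, ← map_smul, hdec]
    simp only [map_add, map_sub, map_smul, smul_eq_mul, ← ha]
    ring
  -- The term in μⁿ dominates, so a functional that is nonnegative along the orbit is nonnegative on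
  -- `v1`; applied to the three functions bounding the region, this puts `v1` in it.
  have hpos : ∀ f : Space →ₗ[ℝ] ℝ, (∀ n, 0 ≤ f ((g ^ n) x)) → 0 ≤ f v1 := by
    intro f hf
    have := nonneg_of_geometric hμ (a := (1 - a) * f v1) (c := -(μ - a) * f v2)
      (d := (μ - 1) * f v3) fun n => by rw [← hval]; exact mul_nonneg hDpos.le (hf n)
    exact nonneg_of_mul_nonneg_right this (by linarith)
  have hcoord : ∀ i, 0 ≤ Φ v1 i := by
    intro i
    refine hpos ((LinearMap.proj i).comp (Φ : Space →ₗ[ℝ] Space)) fun n => ?_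
    obtain ⟨h0, h1, h2⟩ := hΦ ((g ^ n) x)
    obtain ⟨⟨c0, c1, c2⟩, -⟩ := hpow n
    change 0 ≤ Φ ((g ^ n) x) i
    fin_cases i
    · change 0 ≤ Φ ((g ^ n) x) 0; rw [h0]; linarith
    · change 0 ≤ Φ ((g ^ n) x) 1; rw [h1]; exact c1
    · change 0 ≤ Φ ((g ^ n) x) 2; rw [h2]; exact c2
  obtain ⟨h0, h1, h2⟩ := hΦ v1
  refine ⟨v1, ⟨?_, ?_, ?_⟩, ?_, e1⟩
  · linarith [hcoord 0]
  · rw [← h1]; exact hcoord 1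
  · rw [← h2]; exact hcoord 2
  -- Without the term in μⁿ the depth along the orbit would be bounded, against its growth by 3/2 at
  -- each power.
  · intro hzero
    have h4 := nonneg_of_geometric (μ := 3 / 2) (a := D * wall k (entry b j) x)
      (c := |(μ - a) * wall k (entry b j) v2| + |(μ - 1) * wall k (entry b j) v3|) (d := 0)
      (by norm_num) fun n => by
        have h5 := hval (wall k (entry b j)) n
        rw [hzero, map_zero, mul_zero, mul_zero, zero_add] at h5
        have h6 := mul_le_mul_of_nonneg_left (hpow n).2 hDpos.le
        have h7 : μ⁻¹ ^ n ≤ 1 := pow_le_one₀ (by positivity) (inv_le_one_of_one_le₀ hμ.le)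
        have h8 : |μ⁻¹ ^ n * ((μ - 1) * wall k (entry b j) v3)| ≤
            |(μ - 1) * wall k (entry b j) v3| := by
          rw [abs_mul, abs_of_nonneg (by positivity : 0 ≤ μ⁻¹ ^ n)]
          exact mul_le_of_le_one_left (abs_nonneg _) h7
        have h9 := neg_abs_le (μ⁻¹ ^ n * ((μ - 1) * wall k (entry b j) v3))
        have h10 := le_abs_self ((μ - a) * wall k (entry b j) v2)
        have h11 := abs_le.mp h8
        rw [mul_zero, add_zero]
        linarith [h11.1, h11.2]
    have := hx1.1
    nlinarith

end Large

theorem refl_mem_treeChamber (k : Fin 3 → ℕ) (b : Bool) (s : Fin 3) : refl k s ∈ TreeChamber k b :=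
  ⟨[], Or.inr ⟨s, by simp [ev]⟩⟩

theorem ev_replicate (k : Fin 3 → ℕ) {b : Bool} {c : List (Fin 3)} (hc : flag b c = b) (n : ℕ) :
    flag b (List.replicate n c).flatten = b ∧
      ev k b (List.replicate n c).flatten = ev k b c ^ n := by
  induction n with
  | zero => exact ⟨rfl, rfl⟩
  | succ n ih =>
    rw [List.replicate_succ, List.flatten_cons, flag_append, ev_append, hc, ih.2, pow_succ']
    exact ⟨ih.1, rfl⟩

theorem isChain_replicate {j : Fin 3} {l : List (Fin 3)} (hl : (j :: l ++ [j]).IsChain (· ≠ ·))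
    (n : ℕ) : ((List.replicate n (j :: l)).flatten ++ [j]).IsChain (· ≠ ·) ∧
      ((List.replicate n (j :: l)).flatten ++ [j]).head? = some j := by
  induction n with
  | zero => simp
  | succ n ih =>
    refine ⟨?_, by simp [List.replicate_succ]⟩
    rw [List.replicate_succ, List.flatten_cons, List.append_assoc, List.isChain_append]
    rw [List.isChain_append] at hl
    exact ⟨hl.1, ih.1, fun x hx y hy => hl.2.2 x hx y (by rw [ih.2] at hy; simpa using hy)⟩

theorem exists_replicate_eq (c : List (Fin 3)) (q : Fin 3) (n : ℕ) :
    ∃ s, q :: (List.replicate n (c ++ [q])).flatten = s ++ [q] := by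
  induction n with
  | zero => exact ⟨[], rfl⟩
  | succ n ih =>
    refine ⟨q :: (List.replicate n (c ++ [q])).flatten ++ c, ?_⟩
    rw [List.replicate_succ']
    simp

/-- Every closed path is conjugate to a cyclically reduced one. -/
theorem exists_conj_closed (k : Fin 3 → ℕ) (b : Bool) (l : List (Fin 3))
    (hl : l.IsChain (· ≠ ·)) (hf : flag b l = b) (h0 : l ≠ []) :
    ∃ (p : List (Fin 3)) (j : Fin 3) (m : List (Fin 3)), (j :: m ++ [j]).IsChain (· ≠ ·) ∧
      flag (flag b p) (j :: m) = flag b p ∧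
      ev k b l = ev k b p * ev k (flag b p) (j :: m) * (ev k b p)⁻¹ := by
  induction hn : l.length using Nat.strong_induction_on generalizing l b with
  | _ n ih =>
  subst hn
  obtain ⟨j, l, rfl⟩ := List.exists_cons_of_ne_nil h0
  rcases List.eq_nil_or_concat l with rfl | ⟨m, q, rfl⟩
  · cases b <;> simp [flag] at hf
  rw [List.concat_eq_append] at *
  -- Equal first and last letters cancel after conjugation by the first step, at the cost of
  -- changing the kind of the base chamber.
  by_cases hq : q = j
  · subst hq
    have hm0 : m ≠ [] := by
      rintro rfl; simp at hl
    have hfm : flag (!b) m = !b := by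
      rw [flag, flag_append, flag, flag] at hf
      generalize flag (!b) m = f at hf
      cases f <;> cases b <;> simp_all
    have hm : m.IsChain (· ≠ ·) :=
      List.IsChain.left_of_append (l₂ := [q]) hl.tail
    obtain ⟨p, i, c, h1, h2, h3⟩ := ih m.length (by simp) (!b) m hm hfm hm0 rfl
    refine ⟨q :: p, i, c, h1, h2, ?_⟩
    have e : ∀ c, ev k b (q :: c) = step k b q * ev k (!b) c := fun _ => rfl
    have e' : ev k (!b) [q] = step k (!b) q := by simp [ev]
    rw [e, e, ev_append, h3, hfm, e', flag, mul_inv_rev, step_inv]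
    simp only [mul_assoc]
  · refine ⟨[], j, m ++ [q], ?_, hf, by simp [ev, flag]⟩
    rw [List.isChain_append]
    refine ⟨hl, by simp, fun x hx y hy => ?_⟩
    have hx' : (j :: (m ++ [q])).getLast? = some q := by
      rw [← List.cons_append, List.getLast?_append]; rfl
    rw [hx'] at hx
    simp at hx hy
    rw [← hx, ← hy]; exact hq

section Large

variable {k : Fin 3 → ℕ} (hk : ∀ i, 2 ≤ k i)
include hk

/-- A segment between two branches that leaves the tree of chambers nowhere in between meets
a chamber of the tree. -/
theorem exists_treeChamber (l : List (Fin 3)) (b : Bool) {i q : Fin 3} {y η : Space}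
    (hl : (i :: l ++ [q]).IsChain (· ≠ ·)) (hy : y ∈ Cone k b i) (hη : η ∈ Cone k (flag b l) q)
    (h1 : 0 ≤ wall k (entry b i) (y + ev k b l η))
    (h2 : wall k (entry (flag b l) ((i :: l).getLast (List.cons_ne_nil i l)))
      ((ev k b l)⁻¹ (y + ev k b l η)) < 0) :
    ∃ κ ∈ TreeChamber k b, κ⁻¹ (y + ev k b l η) ∈ Chamber k := by
  induction l generalizing b i y with
  | nil =>
    simp only [ev, flag, List.getLast_singleton, inv_one] at h1 h2
    exact absurd h2 h1.not_gt
  | cons j l ih =>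
    have hij : i ≠ j := by
      simp only [List.cons_append, List.isChain_cons_cons] at hl; exact hl.1
    have hl' : (j :: l ++ [q]).IsChain (· ≠ ·) := by
      simp only [List.cons_append, List.isChain_cons_cons] at hl ⊢; exact hl.2
    have hx := (ev_mem_cone hk l b hl' hη).1
    set z := y + ev k b (j :: l) η with hz
    have hA : 0 ≤ sideA k b j z := by
      have e : sideA k b j z = sideA k b j y + sideA k b j (ev k b (j :: l) η) := by
        rw [hz]; cases b <;> simp only [sideA, map_add] <;> ring
      rw [e]
      exact add_nonneg (side_nonneg_of_cone hk b i j hy).1 hx.2.1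
    have hw : ∀ m, m ≠ entry b j → 0 ≤ wall k m z := by
      intro m hm
      by_cases hm' : m = entry b i
      · rw [hm']; exact h1
      · rw [hz, map_add]
        exact add_nonneg (wall_nonneg_of_cone hk hm' hy) (wall_nonneg_of_cone hk hm hx)
    -- Three possibilities: the point has not left the fundamental chamber, it is in the adjacent
    -- chamber across the entry side, or it has passed into the branch `j` and the induction
    -- hypothesis applies after stepping back.
    by_cases h3 : 0 ≤ wall k (entry b j) z
    · refine ⟨1, ⟨[], Or.inl rfl⟩, fun m => ?_⟩
      by_cases hm : m = entry b j
      · rw [hm]; exact h3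
      · exact hw m hm
    push Not at h3
    by_cases h4 : wall k (entry (!b) j) (step k (!b) j z) ≤ 0
    · refine ⟨refl k (entry b j), refl_mem_treeChamber k b _, fun m => ?_⟩
      rw [refl_inv]
      cases b
      · rw [Bool.not_false, wall_entry_step_true] at h4
        simp only [entry, sideA] at h3 hA ⊢
        rcases eq_or_eq_add j m with rfl | rfl | rfl
        · rw [wall_refl_add_one]; linarith
        · rw [wall_refl_self]; linarith
        · rw [wall_add_two_refl_add_one]; linarith
      · rw [Bool.not_true, wall_entry_step_false] at h4
        simp only [entry, sideA] at h3 hA ⊢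
        rcases eq_or_eq_add j m with rfl | rfl | rfl
        · rw [wall_refl_self]; linarith
        · rw [wall_add_one_refl]; linarith
        · rw [wall_add_two_refl]; linarith
    · push Not at h4
      have hback : ∀ x, step k (!b) j (step k b j x) = x := fun x => by
        have := step_mul_step_not k (!b) j
        rw [Bool.not_not] at this
        exact LinearEquiv.congr_fun this x
      have hforth : ∀ x, step k b j (step k (!b) j x) = x := fun x =>
        LinearEquiv.congr_fun (step_mul_step_not k b j) x
      have hz' : step k (!b) j z = step k (!b) j y + ev k (!b) l η := by
        rw [hz, map_add, ev, LinearEquiv.mul_apply, hback]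
      have hy' := (step_mem_cone hk (!b) hij.symm (y := y) (by rwa [Bool.not_not])).1
      rw [hz'] at h4
      obtain ⟨κ, hκ, hκ'⟩ := ih (!b) hl' hy' hη h4.le (by
        rw [← hz']
        rw [List.getLast_cons (List.cons_ne_nil j l)] at h2
        rwa [ev, mul_inv_rev, LinearEquiv.mul_apply, step_inv] at h2)
      refine ⟨step k b j * κ, step_mul_mem_treeChamber hκ, ?_⟩
      rw [mul_inv_rev, step_inv, LinearEquiv.mul_apply, hz']
      exact hκ'

/-- The negative entry pairing is outweighed by another one because of `sideA`. The positive sum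
fixes the sign of the ends of an axis and later distinguishes an end from its negative. -/
theorem sum_wall_pos_of_cone {b : Bool} {j : Fin 3} {y : Space} (hy : y ∈ Cone k b j)
    (h : wall k (entry b j) y < 0) : 0 < ∑ i, wall k i y := by
  have e : ∑ i, wall k i y = wall k j y + wall k (j + 1) y + wall k (j + 2) y := by
    rw [Fin.sum_univ_three]
    fin_cases j
    · rfl
    · change _ = wall k 1 y + wall k 2 y + wall k 0 y; ring
    · change _ = wall k 2 y + wall k 0 y + wall k 1 y; ring
  have h4 : ∀ i, i ≠ entry b j → 0 < wall k i y := fun i hi => wall_pos_of_openCone hk hi hy h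
  obtain ⟨h0, h1, -⟩ := hy
  obtain ⟨b1, -⟩ := cosine_bounds hk (j + 1)
  obtain ⟨c1, -⟩ := cosine_bounds hk (j + 2)
  rw [e]
  cases b
  · have := h4 j (add_one_ne j).symm
    simp only [entry, sideA] at *
    nlinarith
  · have := h4 (j + 1) (add_one_ne j)
    simp only [entry, sideA] at *
    nlinarith

/-- The axis of a cyclically reduced element runs inside the tree of chambers. -/
theorem exists_axis_of_closed (b : Bool) (j : Fin 3) (l : List (Fin 3))
    (hl : (j :: l ++ [j]).IsChain (· ≠ ·)) (hf : flag b (j :: l) = b) (hlen : 3 ≤ l.length) :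
    ∃ (μ : ℝ) (ξ ξ' : Space), 1 < μ ∧ tr (ev k b (j :: l)) = μ + μ⁻¹ + 1 ∧
      0 < ∑ i, wall k i ξ ∧ 0 < ∑ i, wall k i ξ' ∧ ev k b (j :: l) ξ = μ • ξ ∧
      ev k b (j :: l) ξ' = μ⁻¹ • ξ' ∧
      ∀ t : ℝ, 0 < t → ∃ κ ∈ TreeChamber k b, κ⁻¹ (ξ' + t • ξ) ∈ Chamber k := by
  obtain ⟨μ, hμ, ht⟩ := exists_multiplier (three_lt_tr hk b j l hl hf hlen)
  have hμ0 : μ ≠ 0 := by linarith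
  have hneg : ∀ (j : Fin 3) (l : List (Fin 3)), (j :: l ++ [j]).IsChain (· ≠ ·) →
      flag b (j :: l) = b → 3 ≤ l.length → ∀ ξ ∈ Cone k b j, ξ ≠ 0 → ev k b (j :: l) ξ = μ • ξ →
      wall k (entry b j) ξ < 0 := by
    intro j l hl hf hlen ξ h1 h2 h3
    rcases l with _ | ⟨i, l⟩
    · simp at hlen
    have := wall_ev_neg hk l b hl (y := ξ) (by rw [hf]; exact h1) h2
    rw [h3, map_smul, smul_eq_mul] at this
    exact (pos_iff_neg_of_mul_neg this).mp (by linarith)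
  obtain ⟨ξ, hξ, hξ0, hξe⟩ := exists_eigen hk b j l hl hf hμ ht
  have hξn := hneg j l hl hf hlen ξ hξ hξ0 hξe
  obtain ⟨c, q, hc⟩ : ∃ c q, j :: l = c ++ [q] := by
    rcases List.eq_nil_or_concat (j :: l) with h | ⟨c, q, h⟩
    · simp at h
    · exact ⟨c, q, by simpa using h⟩
  have hqj : q ≠ j := by
    rw [hc, List.append_assoc] at hl
    have := List.IsChain.right_of_append hl
    simpa using this
  have hrev : (j :: l).reverse = q :: c.reverse := by rw [hc]; simp
  have hinv : (ev k b (j :: l))⁻¹ = ev k b (q :: c.reverse) := by rw [ev_inv, hf, hrev]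
  have hcl : c.length = l.length := by
    have := congrArg List.length hc
    simpa using this.symm
  have hl' : (q :: c.reverse ++ [q]).IsChain (· ≠ ·) := by
    rw [← hrev, ← List.reverse_cons, List.isChain_reverse]
    refine List.IsChain.cons_cons ?_ ?_
    · exact hqj.symm
    · exact (List.IsChain.left_of_append hl).imp fun a b h => h.symm
  have hf' : flag b (q :: c.reverse) = b := by
    rw [flag_eq_iff] at hf ⊢
    simpa [hcl] using hf
  have ht' : tr (ev k b (q :: c.reverse)) = μ + μ⁻¹ + 1 := by
    obtain ⟨m, -, hm⟩ := exists_word_ev k b (j :: l)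
    rw [← hinv, ← hm, tr_word_inv hk, hm, ht]
  have hlen' : 3 ≤ c.reverse.length := by simpa [hcl] using hlen
  obtain ⟨ξ', hξ', hξ0', hξe'⟩ := exists_eigen hk b q c.reverse hl' hf' hμ ht'
  have hξn' := hneg q c.reverse hl' hf' hlen' ξ' hξ' hξ0' hξe'
  rw [← hinv] at hξe'
  set H := ev k b (j :: l) with hH
  have hξe2 : H ξ' = μ⁻¹ • ξ' := by
    have : H (H⁻¹ ξ') = ξ' := LinearEquiv.congr_fun (mul_inv_cancel H) ξ'
    rw [hξe', map_smul] at this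
    calc H ξ' = (μ⁻¹ * μ) • H ξ' := by rw [inv_mul_cancel₀ hμ0, one_smul]
      _ = μ⁻¹ • ξ' := by rw [mul_smul, this]
  have hqe : entry b q ≠ entry b j := entry_ne hqj
  have hpos := wall_pos_of_openCone hk hqe hξ hξn
  refine ⟨μ, ξ, ξ', hμ, ht, sum_wall_pos_of_cone hk hξ hξn, sum_wall_pos_of_cone hk hξ' hξn', hξe,
    hξe2, fun t htpos => ?_⟩
  set A := wall k (entry b q) ξ
  set B := wall k (entry b q) ξ'
  -- With this n the axis point moved forward by the n-th power is on the inner side of the entry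
  -- wall of `ξ'`, and moved back by the n-th power it is beyond that wall.
  obtain ⟨n, hn⟩ := pow_unbounded_of_one_lt (max (-B / (t * A)) (t * A / -B)) hμ
  have hμn : 1 ≤ μ ^ n := one_le_pow₀ hμ.le
  have hn1 : -B < μ ^ n * (t * A) := by
    have := (le_max_left _ _).trans_lt hn
    rwa [div_lt_iff₀ (by positivity)] at this
  have hn2 : t * A < μ ^ n * -B := by
    have := (le_max_right _ _).trans_lt hn
    rwa [div_lt_iff₀ (by linarith)] at this
  obtain ⟨r1, r2⟩ := ev_replicate k hf (2 * n)
  obtain ⟨c1, c2⟩ := isChain_replicate hl (2 * n)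
  set w := (List.replicate (2 * n) (j :: l)).flatten with hw
  have hpow : ∀ m, (H ^ m) ξ = μ ^ m • ξ := pow_smul_of_eigen hξe
  have hpow' : ∀ m, (H ^ m) ξ' = μ⁻¹ ^ m • ξ' := pow_smul_of_eigen hξe2
  have hμi : μ⁻¹ ^ n * μ ^ n = 1 := by rw [← mul_pow, inv_mul_cancel₀ hμ0, one_pow]
  -- Rewritten this way, the point lies between the branch of `ξ'` and a direction at the far end of
  -- 2n periods of the word.
  have hz : (H ^ n) (ξ' + t • ξ) = μ⁻¹ ^ n • ξ' + ev k b w ((t * μ⁻¹ ^ n) • ξ) := by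
    rw [r2, map_smul, hpow, map_add, map_smul, hpow, hpow', smul_smul, smul_smul, two_mul, pow_add]
    congr 2
    linear_combination (-(t * μ ^ n)) * hμi
  have hback : (ev k b w)⁻¹ (μ⁻¹ ^ n • ξ' + ev k b w ((t * μ⁻¹ ^ n) • ξ)) =
      μ ^ n • ξ' + (t * μ⁻¹ ^ n) • ξ := by
    apply (ev k b w).injective
    rw [← LinearEquiv.mul_apply, mul_inv_cancel, LinearEquiv.coe_one, id_eq, map_add]
    congr 1
    rw [map_smul, r2, hpow', smul_smul, two_mul, pow_add]
    congr 1
    linear_combination (-(μ⁻¹ ^ n)) * hμi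
  obtain ⟨s, hs⟩ := exists_replicate_eq c q (2 * n)
  rw [← hc] at hs
  obtain ⟨κ, hκ, hκ'⟩ := exists_treeChamber hk w b (i := q) (q := j) (y := μ⁻¹ ^ n • ξ')
    (η := (t * μ⁻¹ ^ n) • ξ)
    (by
      rw [List.cons_append, List.isChain_cons]
      exact ⟨fun y hy => by rw [c2] at hy; simp at hy; rw [← hy]; exact hqj, c1⟩)
    (smul_mem_cone hξ' (by positivity)) (by rw [r1]; exact smul_mem_cone hξ (by positivity))
    (by
      rw [← hz, map_add, map_smul, hpow, hpow', map_add, map_smul, map_smul, map_smul]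
      simp only [smul_eq_mul]
      have h1 : μ⁻¹ ^ n ≤ 1 := pow_le_one₀ (by positivity) (inv_le_one_of_one_le₀ hμ.le)
      have h2 : μ⁻¹ ^ n * -B ≤ 1 * -B := mul_le_mul_of_nonneg_right h1 (by linarith)
      change 0 ≤ μ⁻¹ ^ n * B + t * (μ ^ n * A)
      nlinarith)
    (by
      have e : ∀ (L : List (Fin 3)) (h : L ≠ []), L = s ++ [q] → L.getLast h = q := by
        rintro _ _ rfl; simp
      rw [e _ _ hs, r1, hback, map_add, map_smul, map_smul]
      simp only [smul_eq_mul]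
      have h1 : μ⁻¹ ^ n ≤ 1 := pow_le_one₀ (by positivity) (inv_le_one_of_one_le₀ hμ.le)
      have h2 : μ⁻¹ ^ n * (t * A) ≤ 1 * (t * A) := mul_le_mul_of_nonneg_right h1 (by positivity)
      change μ ^ n * B + t * μ⁻¹ ^ n * A < 0
      nlinarith)
  obtain ⟨s1, s2⟩ := ev_replicate k hf' n
  refine ⟨ev k b (List.replicate n (q :: c.reverse)).flatten * κ,
    ev_mul_mem_treeChamber _ (by rw [s1]; exact hκ), ?_⟩
  rw [mul_inv_rev, s2, ← hinv, inv_pow, inv_inv, LinearEquiv.mul_apply, hz]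
  exact hκ'

end Large

/-- The element `h` is a translation along an axis with ends `ξ'` and `ξ`, and the axis runs inside
the tree of chambers. -/
structure IsAxis (k : Fin 3 → ℕ) (h : Space ≃ₗ[ℝ] Space) (μ : ℝ) (ξ ξ' : Space) : Prop where
  one_lt : 1 < μ
  tr_eq : tr h = μ + μ⁻¹ + 1
  eigen : h ξ = μ • ξ
  eigen' : h ξ' = μ⁻¹ • ξ'
  pos : ∃ m, 0 < ∑ i, wall k i (word k m ξ) ∧ 0 < ∑ i, wall k i (word k m ξ')
  cover : ∀ t : ℝ, 0 < t → ∃ κ ∈ TreeChamber k true, κ⁻¹ (ξ' + t • ξ) ∈ Chamber k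

namespace IsAxis

variable {k : Fin 3 → ℕ} {h : Space ≃ₗ[ℝ] Space} {μ : ℝ} {ξ ξ' : Space}

theorem ne_zero (H : IsAxis k h μ ξ ξ') : ξ ≠ 0 := by
  rintro rfl
  obtain ⟨m, h1, -⟩ := H.pos
  simp at h1

theorem ne_zero' (H : IsAxis k h μ ξ ξ') : ξ' ≠ 0 := by
  rintro rfl
  obtain ⟨m, -, h1⟩ := H.pos
  simp at h1

end IsAxis

/-- A second independent eigenvector for μ would give determinant μ·μ·μ⁻¹ = μ ≠ 1. The form of the
hypotheses allows μ⁻¹ in place of μ. -/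
theorem exists_smul_of_eigen {g : Space ≃ₗ[ℝ] Space} (hg : LinearEquiv.det g = 1) {μ : ℝ}
    (h0 : μ ≠ 0) (h1 : μ ≠ 1) (h2 : μ ≠ μ⁻¹) {ξ ξ' v : Space} (hξ : ξ ≠ 0) (hξ' : ξ' ≠ 0)
    (e : g ξ = μ • ξ) (e' : g ξ' = μ⁻¹ • ξ') (ev : g v = μ • v) : ∃ c : ℝ, v = c • ξ := by
  let S : Matrix (Fin 3) (Fin 3) ℝ := Matrix.of fun i j => ![ξ, v, ξ'] j i
  have hS : ∀ u : Space, S.mulVec u = u 0 • ξ + u 1 • v + u 2 • ξ' := by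
    intro u
    ext i
    simp [S, Matrix.mulVec, dotProduct, Fin.sum_univ_three]
    ring
  have hA : (LinearMap.toMatrix' (g : Space →ₗ[ℝ] Space)).det = 1 := by
    rw [LinearMap.det_toMatrix', ← LinearEquiv.coe_det, hg]; rfl
  have hAS : LinearMap.toMatrix' (g : Space →ₗ[ℝ] Space) * S =
      S * Matrix.diagonal ![μ, μ, μ⁻¹] := by
    apply Matrix.toLin'.injective
    refine LinearMap.ext fun u => ?_
    have e1 : ∀ y, (LinearMap.toMatrix' (g : Space →ₗ[ℝ] Space)).mulVec y = g y := fun y => by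
      rw [LinearMap.toMatrix'_mulVec]; rfl
    rw [Matrix.toLin'_apply, Matrix.toLin'_apply, ← Matrix.mulVec_mulVec, ← Matrix.mulVec_mulVec,
      hS, hS, e1, map_add, map_add, map_smul, map_smul, map_smul, e, e', ev]
    simp only [Matrix.mulVec_diagonal]
    simp only [Matrix.cons_val_zero, Matrix.cons_val_one, Matrix.cons_val]
    module
  have hdet : S.det = 0 := by
    have h3 := congrArg Matrix.det hAS
    rw [Matrix.det_mul, Matrix.det_mul, hA, Matrix.det_diagonal, Fin.prod_univ_three] at h3
    simp only [Matrix.cons_val_zero, Matrix.cons_val_one, Matrix.cons_val] at h3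
    rw [mul_assoc, mul_inv_cancel₀ h0, mul_one, one_mul] at h3
    have : S.det * (μ - 1) = 0 := by linarith
    exact (mul_eq_zero.mp this).resolve_right (sub_ne_zero.mpr h1)
  obtain ⟨u, hu, hu'⟩ := Matrix.exists_mulVec_eq_zero_iff.mpr hdet
  rw [hS] at hu'
  have h3 : g (u 0 • ξ + u 1 • v + u 2 • ξ') = 0 := by rw [hu', map_zero]
  simp only [map_add, map_smul, e, e', ev] at h3
  have h4 : (μ⁻¹ - μ) • (u 2 • ξ') = 0 := by
    linear_combination (norm := module) h3 - μ • hu'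
  have h5 : u 2 = 0 := by
    rcases smul_eq_zero.mp h4 with h | h
    · exact absurd (sub_eq_zero.mp h).symm h2
    · exact (smul_eq_zero.mp h).resolve_right hξ'
  rw [h5, zero_smul, add_zero] at hu'
  have h6 : u 1 ≠ 0 := by
    intro h6
    rw [h6, zero_smul, add_zero] at hu'
    have h7 := (smul_eq_zero.mp hu').resolve_right hξ
    apply hu
    ext i
    fin_cases i
    · exact h7
    · exact h6
    · exact h5
  refine ⟨-(u 1)⁻¹ * u 0, ?_⟩
  calc v = (u 1)⁻¹ • (u 1 • v) := by rw [smul_smul, inv_mul_cancel₀ h6, one_smul]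
    _ = (u 1)⁻¹ • (-(u 0 • ξ)) := by rw [eq_neg_of_add_eq_zero_right hu']
    _ = _ := by module

theorem exists_word_treeChamber {k : Fin 3 → ℕ} {b : Bool} {κ : Space ≃ₗ[ℝ] Space}
    (h : κ ∈ TreeChamber k b) : ∃ m, word k m = κ := by
  obtain ⟨l, rfl | ⟨s, rfl⟩⟩ := h
  · obtain ⟨m, -, h⟩ := exists_word_ev k b l
    exact ⟨m, h⟩
  · obtain ⟨m, -, h⟩ := exists_word_ev k b l
    exact ⟨m ++ [s], by rw [word_append, h, word_singleton]⟩

theorem det_ev (k : Fin 3 → ℕ) (b : Bool) (l : List (Fin 3)) : LinearEquiv.det (ev k b l) = 1 := by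
  obtain ⟨m, h1, h2⟩ := exists_word_ev k b l
  rw [← h2, det_word, h1.neg_one_pow]

theorem conj_mem_treeGroup {k : Fin 3 → ℕ} {b : Bool} {h : Space ≃ₗ[ℝ] Space}
    (hh : h ∈ treeGroup k b) (l : List (Fin 3)) :
    (ev k b l)⁻¹ * h * ev k b l ∈ treeGroup k (flag b l) := by
  obtain ⟨m, hm, rfl⟩ := hh
  have h1 : flag (flag b l) l.reverse = b := by
    rw [← flag_append, flag_eq_iff]; simp
  refine ⟨l.reverse ++ m ++ l, ?_, ?_⟩
  · rw [flag_append, flag_append, h1, hm]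
  · rw [ev_append, ev_append, flag_append, h1, hm, ev_inv]

/-- Each odd chamber of the tree lies between a chamber of kind `true` and one of kind `false`, so
it can always be named from the former. -/
theorem exists_flag_true (l : List (Fin 3)) (s : Fin 3) :
    ∃ m j, flag true m = true ∧ ev k true l * refl k s = ev k true m * refl k j := by
  cases hf : flag true l
  · refine ⟨l ++ [s + 2], s + 2, by rw [flag_append, hf]; rfl, ?_⟩
    have e : ev k false [s + 2] = (rot k (s + 2))⁻¹ := by simp [ev, step]
    rw [ev_append, hf, e, rot_inv, add_two_one, mul_assoc, mul_assoc, refl_mul_self, mul_one]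
  · exact ⟨l, s, hf, rfl⟩

/-! ### Malnormality of the tree group -/

section Large

variable {k : Fin 3 → ℕ} (hk : ∀ i, 2 ≤ k i)
include hk

/-- A cyclically reduced closed path may have only two letters; squaring guarantees the four needed
for the trace estimate. The axis is then transported back by the conjugating path. -/
theorem exists_isAxis {h : Space ≃ₗ[ℝ] Space} (hh : h ∈ treeGroup k true) (h1 : h ≠ 1) :
    ∃ μ ξ ξ', IsAxis k (h ^ 2) μ ξ ξ' := by
  obtain ⟨l, hl, hf, rfl⟩ := mem_treeGroup_iff.mp hh
  have hl0 : l ≠ [] := by rintro rfl; exact h1 rfl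
  obtain ⟨p, j, m, h2, h3, h4⟩ := exists_conj_closed k true l hl hf hl0
  set b := flag true p with hb
  have hm : 1 ≤ m.length := by
    rcases m with _ | ⟨i, m⟩
    · simp at h2
    · simp
  have hch : (j :: (m ++ j :: m) ++ [j]).IsChain (· ≠ ·) := by
    have e : j :: (m ++ j :: m) ++ [j] = (j :: m) ++ ((j :: m) ++ [j]) := by simp
    rw [e, List.isChain_append]
    rw [List.isChain_append] at h2
    refine ⟨h2.1, List.isChain_append.mpr h2, fun x hx y hy => ?_⟩
    exact h2.2.2 x hx y (by simpa using hy)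
  have hsq : ev k b (j :: (m ++ j :: m)) = ev k b (j :: m) ^ 2 := by
    rw [← List.cons_append, ev_append, h3, pow_two]
  have hfl : flag b (j :: (m ++ j :: m)) = b := by
    rw [← List.cons_append, flag_append, h3, h3]
  obtain ⟨μ, ξ, ξ', a1, a2, a3, a4, a5, a6, a7⟩ := exists_axis_of_closed hk b j (m ++ j :: m) hch
    hfl (by simp; omega)
  rw [hsq] at a2 a5 a6
  set H := ev k b (j :: m)
  set P := ev k true p with hP
  have hconj : ev k true l ^ 2 = P * H ^ 2 * P⁻¹ := by rw [h4, conj_pow]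
  have hPi : ∀ y, P⁻¹ (P y) = y := fun y => LinearEquiv.congr_fun (inv_mul_cancel P) y
  refine ⟨μ, P ξ, P ξ', a1, by rw [hconj, tr_conj, a2], ?_, ?_, ?_, ?_⟩
  · rw [hconj, LinearEquiv.mul_apply, LinearEquiv.mul_apply, hPi, a5, map_smul]
  · rw [hconj, LinearEquiv.mul_apply, LinearEquiv.mul_apply, hPi, a6, map_smul]
  · obtain ⟨w, -, hw⟩ := exists_word_ev k true p
    refine ⟨w.reverse, ?_⟩
    rw [word_reverse, hw, ← hP, hPi, hPi]
    exact ⟨a3, a4⟩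
  · intro t ht
    obtain ⟨κ, hκ, hκ'⟩ := a7 t ht
    refine ⟨P * κ, ev_mul_mem_treeChamber p hκ, ?_⟩
    rw [← map_smul, ← map_add, mul_inv_rev, LinearEquiv.mul_apply, hPi]
    exact hκ'

/-- Almost all points of an axis lie on at most one wall. -/
theorem IsAxis.exists_generic {h : Space ≃ₗ[ℝ] Space} {μ : ℝ} {ξ ξ' : Space}
    (H : IsAxis k h μ ξ ξ') : ∃ t : ℝ, 0 < t ∧ ∀ m i j, wall k i (word k m (ξ' + t • ξ)) = 0 →
      wall k j (word k m (ξ' + t • ξ)) = 0 → i = j := by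
  -- Parameters at which the axis meets a wall that does not contain `ξ`. Each wall contributes at
  -- most one parameter, and there are countably many walls.
  let B : Set ℝ := ⋃ a : List (Fin 3) × Fin 3,
    {t | wall k a.2 (word k a.1 ξ) ≠ 0 ∧ wall k a.2 (word k a.1 (ξ' + t • ξ)) = 0}
  have hB : B.Countable := by
    refine Set.countable_iUnion fun a => Set.Subsingleton.countable ?_
    rintro t ⟨h1, h2⟩ s ⟨-, h3⟩
    rw [map_add, map_add, map_smul, map_smul, smul_eq_mul] at h2 h3
    have : (t - s) * wall k a.2 (word k a.1 ξ) = 0 := by linarith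
    exact sub_eq_zero.mp ((mul_eq_zero.mp this).resolve_right h1)
  obtain ⟨t, ht, htB⟩ := (hB.dense_compl ℝ).inter_open_nonempty _ isOpen_Ioi
    (⟨1, Set.mem_Ioi.mpr one_pos⟩ : (Set.Ioi (0 : ℝ)).Nonempty)
  refine ⟨t, ht, fun m i j hi hj => ?_⟩
  by_contra hij
  have key : ∀ i, wall k i (word k m (ξ' + t • ξ)) = 0 →
      wall k i (word k m ξ) = 0 ∧ wall k i (word k m ξ') = 0 := by
    intro i hi
    have h1 : wall k i (word k m ξ) = 0 := by
      by_contra h1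
      exact htB (Set.mem_iUnion.mpr ⟨(m, i), h1, hi⟩)
    refine ⟨h1, ?_⟩
    rw [map_add, map_add, map_smul, map_smul, h1, smul_zero, add_zero] at hi
    exact hi
  obtain ⟨i1, i2⟩ := key i hi
  obtain ⟨j1, j2⟩ := key j hj
  obtain ⟨r, hr⟩ : ∃ r : Fin 3, ∀ s, s = i ∨ s = j ∨ s = r := by
    clear * - hij
    revert i j; decide
  -- Two distinct walls that contain both ends leave room for only one line, but the ends are
  -- eigenvectors for different eigenvalues.
  have h1 : wall k r (word k m ξ') • ξ - wall k r (word k m ξ) • ξ' = 0 := by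
    apply (word k m).injective
    rw [map_zero]
    refine eq_zero_of_wall hk fun s => ?_
    rw [map_sub, map_sub, map_smul, map_smul, map_smul, map_smul, smul_eq_mul, smul_eq_mul]
    rcases hr s with rfl | rfl | rfl
    · rw [i1, i2]; ring
    · rw [j1, j2]; ring
    · ring
  have h2 := congrArg h h1
  rw [map_zero, map_sub, map_smul, map_smul, H.eigen, H.eigen'] at h2
  have h3 : ((μ - μ⁻¹) * wall k r (word k m ξ')) • ξ = 0 := by
    linear_combination (norm := module) h2 - μ⁻¹ • h1
  have h4 : μ⁻¹ < 1 := inv_lt_one_of_one_lt₀ H.one_lt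
  have h5 := (mul_eq_zero.mp ((smul_eq_zero.mp h3).resolve_right H.ne_zero)).resolve_left
    (by linarith [H.one_lt])
  apply H.ne_zero'
  apply (word k m).injective
  rw [map_zero]
  refine eq_zero_of_wall hk fun s => ?_
  rcases hr s with rfl | rfl | rfl
  · exact i2
  · exact j2
  · exact h5

/-- If a translate of an axis has the ends of another axis, then it has the same direction. -/
theorem IsAxis.pos_of_map {h h' : Space ≃ₗ[ℝ] Space} {μ ν c c' : ℝ} {ξ ξ' ζ ζ' : Space}
    (H : IsAxis k h μ ξ ξ') (H' : IsAxis k h' ν ζ ζ') (w : List (Fin 3))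
    (hc : word k w ζ = c • ξ) (hc' : word k w ζ' = c' • ξ') : 0 < c ∧ 0 < c' := by
  obtain ⟨m, p1, p2⟩ := H.pos
  set a := ∑ i, wall k i (word k m ξ)
  set a' := ∑ i, wall k i (word k m ξ')
  -- The axis of `h'` is covered by chambers and the sum of pairings is nonnegative on all their
  -- translates. Large and small `t` then give the signs of `c` and `c'`.
  have h1 : ∀ t : ℝ, 0 < t → 0 ≤ c' * a' + t * (c * a) := by
    intro t ht
    obtain ⟨κ, hκ, hκ'⟩ := H'.cover t ht
    obtain ⟨u, rfl⟩ := exists_word_treeChamber hκ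
    have h2 := sum_wall_word_ge hk (m ++ w ++ u) hκ'
    rw [word_append, word_append, LinearEquiv.mul_apply, LinearEquiv.mul_apply,
      ← LinearEquiv.mul_apply (word k u), mul_inv_cancel, LinearEquiv.coe_one, id_eq,
      map_add (word k w), map_smul (word k w), hc, hc'] at h2
    have h3 : 0 ≤ ∑ i, wall k i ((word k u)⁻¹ (ζ' + t • ζ)) := Finset.sum_nonneg fun i _ => hκ' i
    refine (h3.trans h2).trans_eq ?_
    simp only [map_add, map_smul, smul_eq_mul, Finset.sum_add_distrib, ← Finset.mul_sum]
    rfl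
  have hc0 : c ≠ 0 := by
    rintro rfl
    rw [zero_smul] at hc
    exact H'.ne_zero ((word k w).map_eq_zero_iff.mp hc)
  have hc0' : c' ≠ 0 := by
    rintro rfl
    rw [zero_smul] at hc'
    exact H'.ne_zero' ((word k w).map_eq_zero_iff.mp hc')
  constructor
  · refine lt_of_le_of_ne ?_ hc0.symm
    by_contra hneg
    push Not at hneg
    have h2 : c * a < 0 := mul_neg_of_neg_of_pos hneg p1
    have h3 := h1 ((|c' * a'| + 1) / -(c * a)) (by
      have := abs_nonneg (c' * a'); apply div_pos <;> linarith)
    have h4 : (|c' * a'| + 1) / -(c * a) * (c * a) = -(|c' * a'| + 1) := by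
      rw [div_neg, neg_mul, div_mul_cancel₀ _ h2.ne]
    linarith [le_abs_self (c' * a')]
  · refine lt_of_le_of_ne ?_ hc0'.symm
    by_contra hneg
    push Not at hneg
    have h2 : c' * a' < 0 := mul_neg_of_neg_of_pos hneg p2
    have h5 := abs_nonneg (c * a)
    have h3 := h1 (-(c' * a') / (|c * a| + 1)) (by apply div_pos <;> linarith)
    have h4 : -(c' * a') / (|c * a| + 1) * (|c * a| + 1) = -(c' * a') :=
      div_mul_cancel₀ _ (by linarith)
    have h6 : 0 < -(c' * a') / (|c * a| + 1) := by apply div_pos <;> linarith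
    have h7 := mul_le_mul_of_nonneg_left (le_abs_self (c * a)) h6.le
    linarith

/-- An element that translates a chamber of the tree to another such chamber either preserves the
tree or moves it to a tree with a trivially intersecting group. -/
theorem eq_one_of_ev {g h : Space ≃ₗ[ℝ] Space} (hg : g ∉ treeGroup k true)
    (hh : h ∈ treeGroup k true) (hgh : g⁻¹ * h * g ∈ treeGroup k true) {l m : List (Fin 3)}
    (e : g * ev k true m = ev k true l) : h = 1 := by
  have hg' : g = ev k true l * (ev k true m)⁻¹ := eq_mul_inv_of_mul_eq e
  by_cases hf : flag true l = flag true m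
  · refine absurd ⟨l ++ m.reverse, ?_, ?_⟩ hg
    · rw [flag_append, hf, ← flag_append, flag_eq_iff]; simp
    · rw [ev_append, hf, hg', ev_inv]
  · have h1 := conj_mem_treeGroup hh l
    have h2 := conj_mem_treeGroup hgh m
    have h3 : (ev k true m)⁻¹ * (g⁻¹ * h * g) * ev k true m =
        (ev k true l)⁻¹ * h * ev k true l := by rw [← e]; group
    rw [h3] at h2
    have h4 : (ev k true l)⁻¹ * h * ev k true l = 1 := by
      cases ha : flag true l <;> cases hb : flag true m <;> rw [ha] at h1 <;> rw [hb] at h2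
      · exact absurd (ha.trans hb.symm) hf
      · exact treeGroup_true_inf_false hk h2 h1
      · exact treeGroup_true_inf_false hk h1 h2
      · exact absurd (ha.trans hb.symm) hf
    have h5 : h = ev k true l * ((ev k true l)⁻¹ * h * ev k true l) * (ev k true l)⁻¹ := by group
    rw [h5, h4]; group

/-- Determinants force the two chambers to have the same parity. A coincidence of odd chambers
implies one of even chambers, since a product of two side reflections is trivial, a rotation, or an
inverse rotation. -/
theorem eq_one_of_treeChamber {g h : Space ≃ₗ[ℝ] Space} (hdet : LinearEquiv.det g = 1)
    (hg : g ∉ treeGroup k true) (hh : h ∈ treeGroup k true)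
    (hgh : g⁻¹ * h * g ∈ treeGroup k true) {κ κ' : Space ≃ₗ[ℝ] Space}
    (hκ : κ ∈ TreeChamber k true) (hκ' : κ' ∈ TreeChamber k true) (e : g * κ' = κ) : h = 1 := by
  have hne : (-1 : ℝˣ) ≠ 1 := by
    intro h; have := congrArg Units.val h; norm_num at this
  have hd := congrArg LinearEquiv.det e
  rw [map_mul, hdet, one_mul] at hd
  obtain ⟨l, rfl | ⟨s, rfl⟩⟩ := hκ <;> obtain ⟨m, rfl | ⟨r, rfl⟩⟩ := hκ'
  · exact eq_one_of_ev hk hg hh hgh e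
  · rw [map_mul, det_ev, det_ev, det_refl, one_mul] at hd
    exact absurd hd hne
  · rw [map_mul, det_ev, det_ev, det_refl, one_mul] at hd
    exact absurd hd.symm hne
  · obtain ⟨l, j, hl, e1⟩ := exists_flag_true (k := k) l s
    obtain ⟨m, i, hm, e2⟩ := exists_flag_true (k := k) m r
    rw [e1, e2] at e
    have hev : ∀ (l : List (Fin 3)) (j : Fin 3), flag true l = true →
        ev k true (l ++ [j]) = ev k true l * refl k j * refl k (j + 1) := by
      intro l j hl
      rw [ev_append, hl]
      simp [ev, step, rot, mul_assoc]
    have e' : g * ev k true m = ev k true l * refl k j * refl k i := by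
      rw [← e, mul_assoc, mul_assoc, refl_mul_self, mul_one]
    rcases eq_or_eq_add j i with rfl | rfl | rfl
    · rw [mul_assoc, refl_mul_self, mul_one] at e'
      exact eq_one_of_ev hk hg hh hgh e'
    · rw [← hev l j hl] at e'
      exact eq_one_of_ev hk hg hh hgh e'
    · refine eq_one_of_ev hk hg hh hgh (m := m ++ [j + 2]) (l := l) ?_
      rw [hev m _ hm, add_two_one, ← mul_assoc, ← mul_assoc, e', mul_assoc (ev k true l * refl k j),
        refl_mul_self, mul_one, mul_assoc, refl_mul_self, mul_one]

/-- The group preserving the tree of chambers is malnormal in the orientation preserving group. -/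
theorem treeGroup_malnormal (w : List (Fin 3)) (hw : Even w.length)
    (hg : word k w ∉ treeGroup k true) {h : Space ≃ₗ[ℝ] Space} (hh : h ∈ treeGroup k true)
    (hgh : (word k w)⁻¹ * h * word k w ∈ treeGroup k true) : h = 1 := by
  by_contra h1
  have hdet : LinearEquiv.det (word k w) = 1 := by rw [det_word, hw.neg_one_pow]
  set g := word k w with hgdef
  set h' := g⁻¹ * h * g with hh'
  have hne : h' ≠ 1 := by
    intro e
    apply h1
    have : h = g * h' * g⁻¹ := by rw [hh']; group
    rw [this, e]; group
  obtain ⟨μ, ξ, ξ', H⟩ := exists_isAxis hk hh h1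
  obtain ⟨ν, ζ, ζ', H'⟩ := exists_isAxis hk hgh hne
  have hconj : g * h' ^ 2 = h ^ 2 * g := by rw [hh', pow_two, pow_two]; group
  have hμν : ν = μ := by
    refine multiplier_unique H'.one_lt H.one_lt ?_
    rw [← H'.tr_eq, ← H.tr_eq, ← tr_conj g, hconj, mul_assoc, mul_inv_cancel, mul_one]
  subst hμν
  have hlt := H.one_lt
  have hinv : ν⁻¹ < 1 := inv_lt_one_of_one_lt₀ hlt
  have hdet2 : LinearEquiv.det (h ^ 2) = 1 := by
    obtain ⟨l, -, rfl⟩ := hh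
    rw [map_pow, det_ev, one_pow]
  obtain ⟨c, hc⟩ := exists_smul_of_eigen hdet2 (by linarith) hlt.ne' (by linarith) H.ne_zero
    H.ne_zero' H.eigen H.eigen' (v := g ζ) (by
      rw [← LinearEquiv.mul_apply, ← hconj, LinearEquiv.mul_apply, H'.eigen, map_smul])
  obtain ⟨c', hc'⟩ := exists_smul_of_eigen hdet2 (μ := ν⁻¹) (by positivity) hinv.ne
    (by rw [inv_inv]; linarith) H.ne_zero' H.ne_zero H.eigen' (by rw [inv_inv]; exact H.eigen)
    (v := g ζ') (by
      rw [← LinearEquiv.mul_apply, ← hconj, LinearEquiv.mul_apply, H'.eigen', map_smul])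
  obtain ⟨p1, p2⟩ := H.pos_of_map hk H' w hc hc'
  obtain ⟨t, ht, hgen⟩ := H.exists_generic hk
  obtain ⟨κ, hκ, hx⟩ := H.cover t ht
  -- This parameter is the one for which `g` carries the point on the axis of `h'` to a positive
  -- multiple of the generic point on the axis of `h`.
  obtain ⟨κ', hκ', hx'⟩ := H'.cover (t * c' / c) (by positivity)
  obtain ⟨u, rfl⟩ := exists_word_treeChamber hκ
  obtain ⟨u', rfl⟩ := exists_word_treeChamber hκ'
  have hz : g (ζ' + (t * c' / c) • ζ) = c' • (ξ' + t • ξ) := by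
    rw [map_add, map_smul, hc, hc', smul_smul, div_mul_cancel₀ _ p1.ne']
    module
  have hz' : ζ' + (t * c' / c) • ζ = g⁻¹ (c' • (ξ' + t • ξ)) := by
    rw [← hz]; exact (LinearEquiv.congr_fun (inv_mul_cancel g) _).symm
  have e : word k (u.reverse ++ w ++ u') = (word k u)⁻¹ * g * word k u' := by
    rw [word_append, word_append, word_reverse]
  rcases word_eq_one_or_refl hk (u.reverse ++ w ++ u') hx
    (fun i j hi hj => by rw [← word_reverse] at hi hj; exact hgen _ i j hi hj) (by
      have e2 : ((word k u)⁻¹ * g * word k u')⁻¹ * (word k u)⁻¹ = (word k u')⁻¹ * g⁻¹ := by group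
      rw [e, ← LinearEquiv.mul_apply, e2, LinearEquiv.mul_apply]
      intro i
      have := hx' i
      rw [hz', map_smul, map_smul, map_smul, smul_eq_mul] at this
      exact nonneg_of_mul_nonneg_right this p2) with h2 | ⟨i, -, h2⟩
  · rw [e] at h2
    refine h1 (eq_one_of_treeChamber hk hdet hg hh hgh hκ hκ' ?_)
    calc g * word k u' = word k u * ((word k u)⁻¹ * g * word k u') := by group
      _ = _ := by rw [h2, mul_one]
  · rw [e] at h2
    have h3 : g * word k u' = word k u * refl k i := by
      calc g * word k u' = word k u * ((word k u)⁻¹ * g * word k u') := by group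
        _ = _ := by rw [h2]
    -- The chambers now differ by one reflection. If either is even, its neighbours all belong to
    -- the tree and the reflection can be absorbed there; if both are odd, the determinants
    -- disagree.
    obtain ⟨l, hl | ⟨s, hl⟩⟩ := hκ
    · refine h1 (eq_one_of_treeChamber hk hdet hg hh hgh (κ := word k u * refl k i) ?_ hκ' h3)
      exact ⟨l, Or.inr ⟨i, by rw [hl]⟩⟩
    obtain ⟨m, hm | ⟨r, hm⟩⟩ := hκ'
    · refine h1 (eq_one_of_treeChamber hk hdet hg hh hgh (κ := word k u)
        (κ' := word k u' * refl k i) ⟨l, Or.inr ⟨s, hl⟩⟩ ⟨m, Or.inr ⟨i, by rw [hm]⟩⟩ ?_)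
      rw [← mul_assoc, h3, mul_assoc, refl_mul_self, mul_one]
    · have hd := congrArg LinearEquiv.det h3
      rw [map_mul, map_mul, hdet, hl, hm, map_mul, map_mul, det_ev, det_ev, det_refl, det_refl,
        det_refl] at hd
      have := congrArg Units.val hd
      norm_num at this

end Large

/-! ### Positions on the cycles as cosets of the tree group -/

/-- The chamber placed at the position `s` of the union of the cycles. -/
noncomputable def place (k : Fin 3 → ℕ) (s : CycleVertex k) : Space ≃ₗ[ℝ] Space :=
  (rot k s.1 ^ 2) ^ s.2.val * refl k s.1

theorem angle_trig (t q : ℝ) :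
    -((2 * Real.cos t) ^ 3 - 2 * (2 * Real.cos t)) * Real.sin (q - t) +
      ((2 * Real.cos t) ^ 2 - 1) * Real.sin q = Real.sin (4 * t - q) := by
  have h4 : 4 * t = 2 * (2 * t) := by ring
  rw [Real.sin_sub, Real.sin_sub, h4, Real.sin_two_mul (2 * t), Real.cos_two_mul (2 * t),
    Real.sin_two_mul t, Real.cos_two_mul t]
  ring

/-- Angular positions q count modulo 4k + 2, a full turn in units of θ. The two sine conditions
leave only the residues −1, …, 4, so the range 5 ≤ q ≤ 4k is impossible. -/
theorem angle_contradiction (k : Fin 3 → ℕ) (i : Fin 3) {q : ℕ} (h5 : 5 ≤ q) (hq : q + 2 ≤ 4 * k i + 2)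
    (h1 : 0 ≤ Real.sin ((q + 1) * angle k i)) (h2 : 0 ≤ Real.sin ((4 - q) * angle k i)) :
    False := by
  have ha := angle_pos k i
  have hπ := mul_angle k i
  by_cases h : q ≤ 2 * k i
  · have h3 : 0 < Real.sin ((q - 4) * angle k i) := by
      have e5 : (5 : ℝ) ≤ q := by exact_mod_cast h5
      have e6 : (q : ℝ) ≤ 2 * k i := by exact_mod_cast h
      apply Real.sin_pos_of_pos_of_lt_pi
      · apply mul_pos _ ha; linarith
      · rw [← hπ]; apply mul_lt_mul_of_pos_right _ ha; linarith
    have e : (4 - q : ℝ) * angle k i = -((q - 4) * angle k i) := by ring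
    rw [e, Real.sin_neg] at h2
    linarith
  · have e5 : (2 * k i + 1 : ℝ) ≤ q := by exact_mod_cast (by omega : 2 * k i + 1 ≤ q)
    have e6 : (q + 2 : ℝ) ≤ 4 * k i + 2 := by exact_mod_cast hq
    have h3 : 0 < Real.sin ((q + 1) * angle k i - Real.pi) := by
      apply Real.sin_pos_of_pos_of_lt_pi
      · rw [← hπ, ← sub_mul]; apply mul_pos _ ha; linarith
      · have : (q + 1) * angle k i < 2 * Real.pi := by
          rw [← hπ, ← mul_assoc]; apply mul_lt_mul_of_pos_right _ ha; linarith
        linarith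
    rw [Real.sin_sub_pi] at h3
    linarith

section Large

variable {k : Fin 3 → ℕ} (hk : ∀ i, 2 ≤ k i)
include hk

theorem exists_wall (c : Space) : ∃ y : Space, ∀ i, wall k i y = c i := by
  let f : Space →ₗ[ℝ] Space := LinearMap.pi (wall k)
  have hf : Function.Injective f := by
    rw [← LinearMap.ker_eq_bot, LinearMap.ker_eq_bot']
    exact fun y hy => eq_zero_of_wall hk fun i => congrFun hy i
  obtain ⟨y, hy⟩ := LinearMap.injective_iff_surjective.mp hf c
  exact ⟨y, fun i => congrFun hy i⟩

theorem exists_wall_add (i : Fin 3) (a b c : ℝ) : ∃ y : Space,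
    wall k i y = a ∧ wall k (i + 1) y = b ∧ wall k (i + 2) y = c := by
  obtain ⟨y, hy⟩ := exists_wall hk fun j => if j = i then a else if j = i + 1 then b else c
  refine ⟨y, ?_, ?_, ?_⟩
  · rw [hy]; simp
  · rw [hy]; simp
  · rw [hy, if_neg (add_two_ne i), if_neg (add_two_ne_add_one i)]

/-- The hypothesis gives sin(4dθ) = 0, so the odd number 2k + 1 divides 4d and hence d. -/
theorem eq_zero_of_rot_pow (i : Fin 3) {d : ℕ} (hd : d < 2 * k i + 1)
    (h : (rot k i ^ 2) ^ d = 1) : d = 0 := by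
  by_contra h0
  obtain ⟨y, h1, h2, -⟩ := exists_wall_add hk i 1 0 0
  have h3 := (wall_rot_pow k i (2 * d) y).2
  rw [pow_mul, h, LinearEquiv.coe_one, id_eq, h1, h2] at h3
  simp only [mul_zero, mul_one, add_zero] at h3
  obtain ⟨n, hn⟩ := Real.sin_eq_zero_iff.mp h3.symm
  have h4 := angle_pos k i
  rw [← mul_angle k i, ← mul_assoc] at hn
  have h5 := mul_right_cancel₀ h4.ne' hn
  have h6 : n * (2 * (k i : ℤ) + 1) = 4 * d := by
    have : (n : ℝ) * (2 * k i + 1) = 4 * d := by rw [h5]; push_cast; ring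
    exact_mod_cast this
  have h7 : (2 * (k i : ℤ) + 1) ∣ 4 * d := ⟨n, by rw [← h6]; ring⟩
  have h8 : IsCoprime (2 * (k i : ℤ) + 1) 4 := by
    have : IsCoprime (2 * (k i : ℤ) + 1) 2 := ⟨1, -(k i : ℤ), by ring⟩
    have := IsCoprime.mul_right this this
    simpa using this
  have h9 := Int.le_of_dvd (by omega) (h8.dvd_of_dvd_mul_left h7)
  omega

/-- The images of the fundamental chamber are on one side of the walls that bound the branches. -/
theorem side_nonneg_of_mem {h : Space ≃ₗ[ℝ] Space} (hh : h ∈ treeGroup k true) {ω : Space}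
    (hω : ω ∈ Chamber k) (j : Fin 3) :
    0 ≤ sideA k true j (h ω) ∧ 0 ≤ sideB k true j (h ω) := by
  obtain ⟨l, hl, -, rfl⟩ := mem_treeGroup_iff.mp hh
  rcases l with _ | ⟨i, l⟩
  · obtain ⟨a1, a2, a3, -, -⟩ := cosine_bounds hk j
    obtain ⟨c1, -⟩ := cosine_bounds hk (j + 2)
    have h0 := hω j
    have h1 := hω (j + 1)
    have h2 := hω (j + 2)
    simp only [ev, LinearEquiv.coe_one, id_eq, sideA, sideB]
    constructor <;> nlinarith
  · exact side_nonneg_of_cone hk true i j (ev_mem_cone_of_chamber hk l true hl hω)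

theorem exponent_mem (i : Fin 3) {J : ℕ} (hJ : J < 2 * k i + 1) {e : ℕ} (he : e = 1 ∨ e = 2)
    (h1 : 0 ≤ Real.sin ((4 * J + e + 1) * angle k i))
    (h2 : 0 ≤ Real.sin ((4 - (4 * J + e)) * angle k i)) : J = 0 ∨ J = k i ∨ J = k i + 1 := by
  by_contra hne
  push Not at hne
  obtain ⟨n0, n1, n2⟩ := hne
  have hπ := mul_angle k i
  have hki := hk i
  by_cases h : J < k i
  · apply angle_contradiction k i (q := 4 * J + e) (by omega) (by omega)
    · push_cast; exact h1
    · push_cast; exact h2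
  · obtain ⟨q, hq⟩ : ∃ q, 4 * J + e = q + 2 * (2 * k i + 1) := ⟨4 * J + e - 2 * (2 * k i + 1), by omega⟩
    have hq' : (4 * J + e : ℝ) = q + 2 * (2 * k i + 1) := by exact_mod_cast hq
    rw [hq'] at h1 h2
    apply angle_contradiction k i (q := q) (by omega) (by omega)
    · have e : ((q : ℝ) + 2 * (2 * k i + 1) + 1) * angle k i =
          (q + 1) * angle k i + 2 * Real.pi := by rw [← hπ]; ring
      rwa [e, Real.sin_add_two_pi] at h1
    · have e : (4 - ((q : ℝ) + 2 * (2 * k i + 1))) * angle k i =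
          (4 - q) * angle k i - 2 * Real.pi := by rw [← hπ]; ring
      rwa [e, Real.sin_sub_two_pi] at h2

/-- The rotated point has angular position 4J + e about the vertex, in units of θ; the two offsets e
are those of the neighbouring vertices after reflection. The bounding walls turn into sin((4J + e +
1)θ) and sin((4 − 4J − e)θ), whose signs allow only J = 0, k, k + 1. -/
theorem exponent_of_side (i : Fin 3) {J : ℕ} (hJ : J < 2 * k i + 1) {x : Space} {e : ℕ}
    (he : (e = 1 ∧ wall k i x = 0 ∧ wall k (i + 1) x = 1) ∨
      (e = 2 ∧ wall k i x = -1 ∧ wall k (i + 1) x = cosine k i))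
    (h1 : 0 ≤ sideA k true (i + 1) (((rot k i ^ 2) ^ J) x))
    (h2 : 0 ≤ sideB k true i (((rot k i ^ 2) ^ J) x)) : J = 0 ∨ J = k i ∨ J = k i + 1 := by
  have hs := sin_angle_pos hk i
  obtain ⟨w1, w2⟩ := wall_rot_pow k i (2 * J) x
  rw [pow_mul] at w1 w2
  set y := ((rot k i ^ 2) ^ J) x
  set t := angle k i with ht
  have hu : cosine k i = 2 * Real.cos t := rfl
  push_cast at w1 w2
  have w1' : Real.sin t * wall k i y = -Real.sin ((4 * J + e) * t - t) := by
    rcases he with ⟨rfl, x0, x1⟩ | ⟨rfl, x0, x1⟩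
    · rw [w1, x0, x1]
      have e1 : ((4 * J + (1 : ℕ)) * t - t : ℝ) = 2 * (2 * J) * t := by push_cast; ring
      rw [e1]; ring
    · rw [w1, x0, x1, hu]
      have e1 : ((4 * J + (2 : ℕ)) * t - t : ℝ) = 2 * (2 * J) * t + t := by push_cast; ring
      have e2 : ((2 * (2 * J) - 1) * t : ℝ) = 2 * (2 * J) * t - t := by ring
      rw [e1, e2, Real.sin_add, Real.sin_sub]; ring
  have w2' : Real.sin t * wall k (i + 1) y = Real.sin ((4 * J + e) * t) := by
    rcases he with ⟨rfl, x0, x1⟩ | ⟨rfl, x0, x1⟩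
    · rw [w2, x0, x1]
      have e1 : ((4 * J + (1 : ℕ)) * t : ℝ) = (2 * (2 * J) + 1) * t := by push_cast; ring
      rw [e1]; ring
    · rw [w2, x0, x1, hu]
      have e1 : ((4 * J + (2 : ℕ)) * t : ℝ) = (2 * (2 * J) + 1) * t + t := by push_cast; ring
      have e2 : (2 * (2 * J) * t : ℝ) = (2 * (2 * J) + 1) * t - t := by ring
      rw [e1, e2, Real.sin_add, Real.sin_sub]; ring
  refine exponent_mem hk i hJ (e := e) (by tauto) ?_ ?_
  · have h3 := mul_nonneg hs.le h1
    simp only [sideA, add_one_two] at h3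
    rw [mul_add, w1', mul_left_comm, w2', hu] at h3
    have e1 : (4 * J + e + 1) * t = (4 * J + e) * t + t := by ring
    rw [← ht, e1, Real.sin_add]
    rw [Real.sin_sub] at h3
    linarith
  · have h3 := mul_nonneg hs.le h2
    simp only [sideB] at h3
    rw [mul_add, mul_left_comm, w1', mul_left_comm, w2', hu] at h3
    have h4 := angle_trig t ((4 * J + e) * t)
    have e1 : (4 - (4 * J + e)) * t = 4 * t - (4 * J + e) * t := by ring
    rw [← ht, e1, ← h4]
    linarith

/-- One edge along the `i`-th cycle multiplies on the right by the image of the `i`-th generator, as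
in a Schreier graph. -/
theorem place_add_one (i : Fin 3) (j : ZMod (2 * k i + 1)) :
    place k ⟨i, j + 1⟩ = place k ⟨i, j⟩ * ((rot k i)⁻¹) ^ 2 := by
  have hki := hk i
  have h1 : (1 : ZMod (2 * k i + 1)).val = 1 := by
    rw [ZMod.val_one_eq_one_mod, Nat.mod_eq_of_lt (by omega)]
  have h2 : (rot k i ^ 2) ^ (2 * k i + 1) = 1 := by
    rw [← pow_mul, mul_comm, pow_mul, rot_pow_eq_one hk, one_pow]
  have h3 : refl k i * (rot k i)⁻¹ = rot k i * refl k i := by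
    rw [rot_inv, rot, mul_assoc]
  simp only [place]
  rw [ZMod.val_add, h1, ← pow_eq_pow_mod _ h2, pow_succ, pow_two (rot k i)⁻¹, mul_assoc, mul_assoc,
    ← mul_assoc (refl k i), h3, mul_assoc, h3, pow_two]
  simp only [mul_assoc]

/-- The coset at a branching vertex depends on `v` alone and not on the cycle, so `place` respects
the gluing of the cycles. -/
theorem place_branchPosition (i v : Fin 3) :
    ∃ h ∈ treeGroup k true, place k ⟨i, branchPosition k i v⟩ = h * refl k v := by
  have hki := hk i
  have hval : ∀ m : ℕ, m < 2 * k i + 1 → ((m : ZMod (2 * k i + 1))).val = m :=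
    fun m hm => ZMod.val_natCast_of_lt hm
  have h2 : rot k i ^ (2 * k i) = (rot k i)⁻¹ := by
    rw [eq_inv_iff_mul_eq_one, ← pow_succ, rot_pow_eq_one hk]
  rcases eq_or_eq_add i v with rfl | rfl | rfl
  · refine ⟨1, one_mem _, ?_⟩
    simp [place, branchPosition]
  · refine ⟨1, one_mem _, ?_⟩
    simp only [place, branchPosition, if_neg (add_one_ne i), if_pos, one_mul]
    rw [hval _ (by omega), ← pow_mul, h2, rot_inv, mul_assoc, refl_mul_self, mul_one]
  · refine ⟨rot k i * (rot k (i + 2))⁻¹, ⟨[i, i + 2], rfl, by simp [ev, step]⟩, ?_⟩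
    simp only [place, branchPosition, if_neg (add_two_ne i), if_neg (add_two_ne_add_one i)]
    rw [← Nat.cast_succ, hval _ (by omega), ← pow_mul, Nat.mul_succ, pow_add, h2, pow_two,
      ← mul_assoc, inv_mul_cancel, one_mul, rot_inv, add_two_one]
    rw [mul_assoc, mul_assoc, refl_mul_self, mul_one]

/-- Two positions on one cycle differ by a power of a rotation, which has finite order, while the
tree group is torsion free. -/
theorem place_injective_of_fst (i : Fin 3) (j j' : ZMod (2 * k i + 1))
    (h : place k ⟨i, j⟩ * (place k ⟨i, j'⟩)⁻¹ ∈ treeGroup k true) : j = j' := by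
  wlog hle : j'.val ≤ j.val generalizing j j'
  · refine (this j' j ?_ (by omega)).symm
    have := inv_mem h
    rwa [mul_inv_rev, inv_inv] at this
  have e : place k ⟨i, j⟩ * (place k ⟨i, j'⟩)⁻¹ = (rot k i ^ 2) ^ (j.val - j'.val) := by
    simp only [place]
    rw [mul_inv_rev, refl_inv, mul_assoc, ← mul_assoc (refl k i), refl_mul_self, one_mul,
      pow_sub _ hle]
  rw [e] at h
  have h1 := treeGroup_torsionFree hk h (n := 2 * k i + 1) (by omega) (by
    rw [pow_right_comm, pow_right_comm _ 2, rot_pow_eq_one hk, one_pow, one_pow])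
  have h2 := eq_zero_of_rot_pow hk i (d := j.val - j'.val)
    (lt_of_le_of_lt (Nat.sub_le _ _) (ZMod.val_lt j)) h1
  exact ZMod.val_injective _ (by omega)

/-- If chambers at positions of different cycles are equivalent, the positions are branching. -/
theorem exists_branchPosition {o i : Fin 3} (hoi : o ≠ i) (j : ZMod (2 * k o + 1))
    (j' : ZMod (2 * k i + 1)) (h : place k ⟨o, j⟩ * (place k ⟨i, j'⟩)⁻¹ ∈ treeGroup k true) :
    ∃ v, j' = branchPosition k i v := by
  have hki := hk i
  -- The vertex about which the `o`-th cycle turns is fixed by every `place k ⟨o, j⟩`. Its image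
  -- under the tree group element is thus a rotated vertex about the centre of the `i`-th cycle,
  -- subject to the walls bounding the tree.
  obtain ⟨ω, w0, w1, w2⟩ := exists_wall_add hk o 0 0 1
  have hω : ω ∈ Chamber k := by
    intro m
    rcases eq_or_eq_add o m with rfl | rfl | rfl
    · rw [w0]
    · rw [w1]
    · rw [w2]; exact zero_le_one
  have hfix : place k ⟨o, j⟩ ω = ω := by
    have r0 : refl k o ω = ω := by rw [refl_apply, w0]; simp
    have r1 : refl k (o + 1) ω = ω := by rw [refl_apply, w1]; simp
    have r2 : rot k o ω = ω := by rw [rot, LinearEquiv.mul_apply, r1, r0]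
    have r3 : ∀ n, (rot k o ^ n) ω = ω := by
      intro n
      have := pow_smul_of_eigen (g := rot k o) (v := ω) (c := 1) (by rw [r2, one_smul]) n
      rwa [one_pow, one_smul] at this
    simp only [place]
    rw [LinearEquiv.mul_apply, r0, ← pow_mul, r3]
  have hmem := inv_mem h
  set g := (place k ⟨o, j⟩ * (place k ⟨i, j'⟩)⁻¹)⁻¹ with hg
  have hgω : g ω = ((rot k i ^ 2) ^ j'.val) (refl k i ω) := by
    conv_lhs => rw [← hfix]
    rw [← LinearEquiv.mul_apply, hg, mul_inv_rev, inv_inv, inv_mul_cancel_right]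
    rfl
  have hA := (side_nonneg_of_mem hk hmem hω (i + 1)).1
  have hB := (side_nonneg_of_mem hk hmem hω i).2
  rw [hgω] at hA hB
  have hJ : j'.val = 0 ∨ j'.val = k i ∨ j'.val = k i + 1 := by
    rcases eq_or_eq_add i o with rfl | rfl | rfl
    · exact absurd rfl hoi
    · rw [add_one_one] at w1
      rw [add_one_two] at w2
      refine exponent_of_side hk i (ZMod.val_lt j') (e := 2) (Or.inr ⟨rfl, ?_, ?_⟩) hA hB
      · rw [wall_refl_self, w2]
      · rw [wall_add_one_refl, w2, w0]; ring
    · rw [add_two_one] at w1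
      rw [add_two_two] at w2
      refine exponent_of_side hk i (ZMod.val_lt j') (e := 1) (Or.inl ⟨rfl, ?_, ?_⟩) hA hB
      · rw [wall_refl_self, w1, neg_zero]
      · rw [wall_add_one_refl, w2, w1]; ring
  have hcast := ZMod.natCast_zmod_val j'
  rcases hJ with h | h | h
  · exact ⟨i, by rw [← hcast, h]; simp [branchPosition]⟩
  · exact ⟨i + 1, by rw [← hcast, h]; simp [branchPosition]⟩
  · refine ⟨i + 2, ?_⟩
    rw [← hcast, h, branchPosition, if_neg (add_two_ne i), if_neg (add_two_ne_add_one i)]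
    push_cast; rfl

theorem place_equiv {s t : CycleVertex k} {v : Fin 3} (hs : s.2 = branchPosition k s.1 v)
    (ht : t.2 = branchPosition k t.1 v) : place k s * (place k t)⁻¹ ∈ treeGroup k true := by
  obtain ⟨i, j⟩ := s
  obtain ⟨i', j'⟩ := t
  simp only at hs ht
  subst hs ht
  obtain ⟨h, hh, e⟩ := place_branchPosition hk i v
  obtain ⟨h', hh', e'⟩ := place_branchPosition hk i' v
  rw [e, e', mul_inv_rev, mul_assoc, mul_inv_cancel_left]
  exact mul_mem hh (inv_mem hh')

theorem place_injective {s t : CycleVertex k}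
    (h : place k s * (place k t)⁻¹ ∈ treeGroup k true) :
    (Quot.mk _ s : BarVertex k) = Quot.mk _ t := by
  obtain ⟨o, j⟩ := s
  obtain ⟨i, j'⟩ := t
  by_cases hoi : o = i
  · subst hoi
    rw [place_injective_of_fst hk o j j' h]
  · obtain ⟨v, rfl⟩ := exists_branchPosition hk hoi j j' h
    have h1 := place_equiv hk (s := ⟨i, branchPosition k i v⟩) (t := ⟨o, branchPosition k o v⟩)
      rfl rfl
    have h2 := mul_mem h h1
    rw [mul_assoc, inv_mul_cancel_left] at h2
    rw [place_injective_of_fst hk o j _ h2]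
    exact Quot.sound ⟨v, rfl, rfl⟩

end Large

/-! ### The homomorphism, the edge group and the deck transformation -/

theorem mk_cons {E : Type*} (e : E) (b : Bool) (w : List (E × Bool)) :
    FreeGroup.mk ((e, b) :: w) =
      (if b then FreeGroup.of e else (FreeGroup.of e)⁻¹) * FreeGroup.mk w := by
  rw [← List.singleton_append, ← FreeGroup.mul_mk]
  cases b <;> rfl

/-- Two homomorphisms that differ by a gauge transformation on edges differ by it on paths. -/
theorem gauge_walk {V E Q : Type*} [Group Q] (G : OGraph V E) (F F' : FreeGroup E →* Q) (p : V → Q)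
    (h : ∀ e, F (FreeGroup.of e) = (p (G.src e))⁻¹ * F' (FreeGroup.of e) * p (G.tgt e))
    {v v' : V} {w : List (E × Bool)} (hw : G.IsWalk v w v') :
    F (FreeGroup.mk w) = (p v)⁻¹ * F' (FreeGroup.mk w) * p v' := by
  induction w generalizing v with
  | nil =>
    obtain rfl : v = v' := hw
    rw [← FreeGroup.one_eq_mk, map_one, map_one]; group
  | cons a w ih =>
    obtain ⟨e, b⟩ := a
    obtain ⟨rfl, h2⟩ := hw
    rw [mk_cons, map_mul, map_mul, ih h2]
    cases b
    · simp only [Bool.false_eq_true, if_false, map_inv, h, OGraph.start, OGraph.finish]; group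
    · simp only [if_true, h, OGraph.start, OGraph.finish]; group

/-- The homomorphism onto the von Dyck group. -/
noncomputable def quotientHom (k : Fin 3 → ℕ) : FreeGroup (Fin 3) →* (Space ≃ₗ[ℝ] Space) :=
  FreeGroup.lift fun i => (rot k i)⁻¹ ^ 2

/-- The reflection by which the tree of chambers is transported to the vertex `v`. -/
noncomputable def gauge (k : Fin 3 → ℕ) (v : QuarterVertex) : Space ≃ₗ[ℝ] Space :=
  refl k (if v.2 then v.1 else v.1 - 1)

theorem gauge_inv (k : Fin 3 → ℕ) (v : QuarterVertex) : (gauge k v)⁻¹ = gauge k v :=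
  refl_inv k _

/-- The class of an edge path relative to the trivialization by the gauge. -/
noncomputable def edgeClass : FreeGroup QuarterEdge →* FreeGroup (Fin 2) :=
  FreeGroup.lift fun e => if e.2.1 then 1 else (letter (e.1 - 1))⁻¹ * letter e.1

theorem edgeClass_of (e : QuarterEdge) : edgeClass (FreeGroup.of e) =
    if e.2.1 then 1 else (letter (e.1 - 1))⁻¹ * letter e.1 := by simp [edgeClass]

theorem quotientHom_of (k : Fin 3 → ℕ) (i : Fin 3) :
    quotientHom k (FreeGroup.of i) = (rot k i)⁻¹ ^ 2 := by simp [quotientHom]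

/-- The inversion of the free group of rank two. -/
def inversion : MulAut (FreeGroup (Fin 2)) :=
  MonoidHom.toMulEquiv (FreeGroup.lift fun i => (FreeGroup.of i)⁻¹)
    (FreeGroup.lift fun i => (FreeGroup.of i)⁻¹) (by ext i; simp) (by ext i; simp)

theorem inversion_letter (i : Fin 3) : inversion (letter i) = (letter i)⁻¹ := by
  refine Fin.cases ?_ (fun i => ?_) i
  · simp [letter]
  · simp [letter, inversion]

/-- The deck transformation exchanges edges of trivial class with edges of class `(letter (i - 1))⁻¹
* letter i`. After the gauge `letter (v.1 - 1)` this is inversion of the letters, as one checks on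
single edges. -/
theorem edgeClass_deck {v v' : QuarterVertex} {w : List (QuarterEdge × Bool)}
    (hw : quarterGraph.IsWalk v w v') :
    edgeClass (FreeGroup.map deckEdge (FreeGroup.mk w)) =
      (letter (v.1 - 1))⁻¹ * inversion (edgeClass (FreeGroup.mk w)) * letter (v'.1 - 1) := by
  refine gauge_walk quarterGraph (edgeClass.comp (FreeGroup.map deckEdge))
    (inversion.toMonoidHom.comp edgeClass) (fun v => letter (v.1 - 1)) (fun e => ?_) hw
  obtain ⟨i, s, t⟩ := e
  have hi : inversion ((letter (i - 1))⁻¹ * letter i) = letter (i - 1) * (letter i)⁻¹ := by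
    rw [map_mul, map_inv, inversion_letter, inversion_letter, inv_inv]
  have h1 : i + 1 - 1 = i := add_sub_cancel_right i 1
  change edgeClass (FreeGroup.map deckEdge (FreeGroup.of (i, s, t))) =
    (letter (i - 1))⁻¹ * inversion (edgeClass (FreeGroup.of (i, s, t))) * letter (i + 1 - 1)
  rw [FreeGroup.map.of, edgeClass_of, edgeClass_of, h1]
  cases s
  · simp only [deckEdge, Equiv.coe_fn_mk, Bool.not_false, if_true, Bool.false_eq_true, if_false, hi]
    group
  · simp only [deckEdge, Equiv.coe_fn_mk, Bool.not_true, if_true, Bool.false_eq_true, if_false,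
      map_one]
    group

/-- Edges starting at a positive vertex have trivial class and already connect the graph, so closing
up a path with them does not change its class. -/
theorem exists_walk_root (v : QuarterVertex) : ∃ w, quarterGraph.IsWalk v w (0, true) ∧
    edgeClass (FreeGroup.mk w) = 1 := by
  obtain ⟨i, s⟩ := v
  have h : ∀ w : List (QuarterEdge × Bool), (∀ a ∈ w, a.1.2.1 = true) →
      edgeClass (FreeGroup.mk w) = 1 := by
    intro w hw
    induction w with
    | nil => rw [← FreeGroup.one_eq_mk, map_one]
    | cons a w ih =>
      obtain ⟨e, b⟩ := a
      have he : e.2.1 = true := hw (e, b) (by simp)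
      rw [mk_cons, map_mul, ih fun a ha => hw a (by simp [ha])]
      cases b <;> simp [edgeClass_of, he]
  cases s <;> fin_cases i
  · exact ⟨[((2, true, false), false), ((2, true, true), true)], ⟨rfl, rfl, rfl⟩, h _ (by simp)⟩
  · exact ⟨[((0, true, false), false)], ⟨rfl, rfl⟩, h _ (by simp)⟩
  · exact ⟨[((1, true, false), false), ((0, true, true), false)], ⟨rfl, rfl, rfl⟩, h _ (by simp)⟩
  · exact ⟨[], rfl, h _ (by simp)⟩
  · exact ⟨[((0, true, true), false)], ⟨rfl, rfl⟩, h _ (by simp)⟩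
  · exact ⟨[((2, true, true), true)], ⟨rfl, rfl⟩, h _ (by simp)⟩

theorem map_edgeClass (v : QuarterVertex) : (quarterGraph.fundGroup v).map edgeClass = ⊤ := by
  have hmem : ∀ e : QuarterEdge,
      edgeClass (FreeGroup.of e) ∈ (quarterGraph.fundGroup v).map edgeClass := by
    intro e
    obtain ⟨w0, h0, c0⟩ := exists_walk_root v
    obtain ⟨w1, h1, c1⟩ := exists_walk_root (quarterGraph.src e)
    obtain ⟨w2, h2, c2⟩ := exists_walk_root (quarterGraph.tgt e)
    have he : quarterGraph.IsWalk (quarterGraph.src e) [(e, true)] (quarterGraph.tgt e) :=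
      ⟨rfl, rfl⟩
    refine ⟨_, ⟨_, (((h0.append h1.invRev).append he).append h2).append h0.invRev, rfl⟩, ?_⟩
    simp only [← FreeGroup.mul_mk, ← FreeGroup.inv_mk, map_mul, map_inv, c0, c1, c2]
    rw [mk_cons, ← FreeGroup.one_eq_mk]
    simp
  rw [eq_top_iff, ← FreeGroup.closure_range_of, Subgroup.closure_le]
  rintro _ ⟨i, rfl⟩
  fin_cases i
  · have h1 := hmem (1, false, false)
    have e : edgeClass (FreeGroup.of (1, false, false)) = FreeGroup.of 0 := by
      rw [edgeClass_of]
      change (letter 0)⁻¹ * letter 1 = _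
      have e1 : letter 0 = 1 := rfl
      have e2 : letter 1 = FreeGroup.of 0 := rfl
      rw [e1, e2]; group
    rw [e] at h1
    exact h1
  · have h1 := hmem (0, false, false)
    have e : edgeClass (FreeGroup.of (0, false, false)) = (FreeGroup.of 1)⁻¹ := by
      rw [edgeClass_of]
      change (letter 2)⁻¹ * letter 0 = _
      have e1 : letter 0 = 1 := rfl
      have e2 : letter 2 = FreeGroup.of 1 := rfl
      rw [e1, e2]; group
    rw [e] at h1
    exact (inv_mem_iff (G := FreeGroup (Fin 2))).mp h1

theorem rot_mem_vonDyckGroup (k : Fin 3 → ℕ) (i : Fin 3) :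
    rot k i ∈ vonDyckGroup fun i => 2 * k i + 1 :=
  Subgroup.subset_closure ⟨i, i + 1, rfl⟩

theorem exists_word_of_mem {k : Fin 3 → ℕ} {g : Space ≃ₗ[ℝ] Space}
    (hg : g ∈ vonDyckGroup fun i => 2 * k i + 1) : ∃ m, Even m.length ∧ word k m = g := by
  induction hg using Subgroup.closure_induction with
  | mem x hx =>
    obtain ⟨i, j, rfl⟩ := hx
    exact ⟨[i, j], by simp, by rw [word_cons, word_singleton]; rfl⟩
  | one => exact ⟨[], by simp, rfl⟩
  | mul x y _ _ hx hy =>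
    obtain ⟨m, h1, rfl⟩ := hx
    obtain ⟨n, h2, rfl⟩ := hy
    exact ⟨m ++ n, by rw [List.length_append]; exact h1.add h2, word_append k m n⟩
  | inv x _ hx =>
    obtain ⟨m, h1, rfl⟩ := hx
    exact ⟨m.reverse, by simpa using h1, word_reverse k m⟩

theorem quotientHom_mem (k : Fin 3 → ℕ) (x : FreeGroup (Fin 3)) :
    quotientHom k x ∈ vonDyckGroup fun i => 2 * k i + 1 := by
  induction x using FreeGroup.induction_on with
  | C1 => rw [map_one]; exact one_mem _
  | of i =>
    rw [quotientHom_of]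
    exact pow_mem (inv_mem (rot_mem_vonDyckGroup k i)) 2
  | inv_of i h => rw [map_inv]; exact inv_mem h
  | mul x y hx hy => rw [map_mul]; exact mul_mem hx hy

/-- The homomorphism onto the von Dyck group. -/
noncomputable def vonDyckHom (k : Fin 3 → ℕ) :
    FreeGroup (Fin 3) →* vonDyckGroup fun i => 2 * k i + 1 :=
  (quotientHom k).codRestrict _ (quotientHom_mem k)

theorem coe_vonDyckHom (k : Fin 3 → ℕ) (x : FreeGroup (Fin 3)) :
    (vonDyckHom k x : Space ≃ₗ[ℝ] Space) = quotientHom k x := rfl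

/-! ### The image of the edge group and its properties -/

section Large

variable {k : Fin 3 → ℕ} (hk : ∀ i, 2 ≤ k i)
include hk

/-- This is where odd labels matter: −2k ≡ 1 modulo 2k + 1. -/
theorem quotientHom_of_pow (i : Fin 3) : quotientHom k (FreeGroup.of i ^ k i) = rot k i := by
  rw [map_pow, quotientHom_of, ← pow_mul, inv_pow, inv_eq_iff_mul_eq_one, ← pow_succ,
    rot_pow_eq_one hk]

theorem vonDyckHom_surjective : Function.Surjective (vonDyckHom k) := by
  have h : vonDyckGroup (fun i => 2 * k i + 1) ≤ (quotientHom k).range := by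
    refine (Subgroup.closure_le _).mpr ?_
    have hrot : ∀ i, rot k i ∈ (quotientHom k).range := fun i => ⟨_, quotientHom_of_pow hk i⟩
    rintro _ ⟨i, j, rfl⟩
    change refl k i * refl k j ∈ _
    rcases eq_or_eq_add i j with rfl | rfl | rfl
    · rw [refl_mul_self]; exact one_mem _
    · exact hrot i
    · have := inv_mem (hrot (i + 2))
      rwa [rot_inv, add_two_one] at this
  rintro ⟨g, hg⟩
  obtain ⟨x, hx⟩ := h hg
  exact ⟨x, Subtype.ext hx⟩

/-- Checked on the four types of edges. On closed paths it shows that the image of C is the tree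
group conjugated by the reflection at `v`, and that the homomorphism factors through `edgeClass`. -/
theorem quotientHom_walk {v v' : QuarterVertex} {w : List (QuarterEdge × Bool)}
    (hw : quarterGraph.IsWalk v w v') :
    quotientHom k (FreeGroup.lift (quarterLabel k) (FreeGroup.mk w)) =
      (gauge k v)⁻¹ * param k (edgeClass (FreeGroup.mk w)) * gauge k v' := by
  refine gauge_walk quarterGraph ((quotientHom k).comp (FreeGroup.lift (quarterLabel k)))
    ((param k).comp edgeClass) (gauge k) (fun e => ?_) hw
  obtain ⟨i, s, t⟩ := e
  have h1 : i + 1 - 1 = i := add_sub_cancel_right i 1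
  have h2 : i - 1 + 1 = i := sub_add_cancel i 1
  have hc : refl k (i - 1) * (rot k (i - 1) * (rot k i)⁻¹) = rot k i * refl k i := by
    rw [rot_inv, rot, h2, rot, mul_assoc, mul_assoc, ← mul_assoc (refl k (i - 1)), refl_mul_self,
      one_mul]
  rw [MonoidHom.comp_apply, MonoidHom.comp_apply, FreeGroup.lift_apply_of, edgeClass_of, gauge_inv]
  cases s <;> cases t <;>
    simp only [quarterGraph, gauge, quarterLabel, Bool.false_eq_true, if_false, if_true, h1,
      map_one, map_inv, quotientHom_of_pow hk, quotientHom_of, param_letter_inv_mul, mul_one]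
  · rw [hc, mul_assoc, refl_mul_self, mul_one]
  · rw [hc, mul_assoc, inv_pow, inv_inv, pow_two]; rfl
  · rw [refl_mul_self]
  · rfl

theorem quotientHom_fundGroup {v : QuarterVertex} {h : FreeGroup QuarterEdge}
    (hh : h ∈ quarterGraph.fundGroup v) :
    quotientHom k (FreeGroup.lift (quarterLabel k) h) =
      (gauge k v)⁻¹ * param k (edgeClass h) * gauge k v := by
  obtain ⟨w, hw, rfl⟩ := hh
  exact quotientHom_walk hk hw

theorem mem_map_iff {v : QuarterVertex} {x : vonDyckGroup fun i => 2 * k i + 1} :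
    x ∈ (edgeGroup k v).map (vonDyckHom k) ↔
      ∃ f, (x : Space ≃ₗ[ℝ] Space) = (gauge k v)⁻¹ * param k f * gauge k v := by
  constructor
  · rintro ⟨_, ⟨⟨h, hh⟩, rfl⟩, rfl⟩
    exact ⟨edgeClass h, quotientHom_fundGroup hk hh⟩
  · rintro ⟨f, hf⟩
    have h1 : f ∈ (quarterGraph.fundGroup v).map edgeClass := by rw [map_edgeClass]; trivial
    obtain ⟨h, hh, rfl⟩ := h1
    refine ⟨_, ⟨⟨h, hh⟩, rfl⟩, Subtype.ext ?_⟩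
    rw [hf]
    exact quotientHom_fundGroup hk hh

theorem mem_map_iff_treeGroup {v : QuarterVertex} {x : vonDyckGroup fun i => 2 * k i + 1} :
    x ∈ (edgeGroup k v).map (vonDyckHom k) ↔
      gauge k v * (x : Space ≃ₗ[ℝ] Space) * (gauge k v)⁻¹ ∈ treeGroup k true := by
  rw [mem_map_iff hk, ← param_range]
  constructor
  · rintro ⟨f, hf⟩
    exact ⟨f, by rw [hf]; group⟩
  · rintro ⟨f, hf⟩
    exact ⟨f, by rw [hf]; group⟩

/-- The image of the edge group is free of rank two. -/
theorem exists_mulEquiv (v : QuarterVertex) :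
    ∃ Ψ : FreeGroup (Fin 2) ≃* (edgeGroup k v).map (vonDyckHom k),
      ∀ f, ((Ψ f : vonDyckGroup fun i => 2 * k i + 1) : Space ≃ₗ[ℝ] Space) =
        (gauge k v)⁻¹ * param k f * gauge k v := by
  have hex : ∀ f, ∃ x : (edgeGroup k v).map (vonDyckHom k),
      ((x : vonDyckGroup fun i => 2 * k i + 1) : Space ≃ₗ[ℝ] Space) =
        (gauge k v)⁻¹ * param k f * gauge k v := by
    intro f
    have h1 : f ∈ (quarterGraph.fundGroup v).map edgeClass := by rw [map_edgeClass]; trivial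
    obtain ⟨h, hh, rfl⟩ := h1
    exact ⟨⟨_, ⟨_, ⟨⟨h, hh⟩, rfl⟩, rfl⟩⟩, quotientHom_fundGroup hk hh⟩
  choose Ψ hΨ using hex
  refine ⟨MulEquiv.ofBijective (MonoidHom.mk' Ψ fun f f' => ?_) ⟨fun f f' h => ?_, ?_⟩, hΨ⟩
  · apply Subtype.ext
    apply Subtype.ext
    rw [hΨ, Subgroup.coe_mul, Subgroup.coe_mul, hΨ, hΨ, map_mul]
    group
  · have h1 : ((Ψ f : vonDyckGroup fun i => 2 * k i + 1) : Space ≃ₗ[ℝ] Space) = Ψ f' := by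
      rw [show Ψ f = Ψ f' from h]
    rw [hΨ, hΨ] at h1
    exact param_injective hk (mul_left_cancel (mul_right_cancel h1))
  · intro x
    obtain ⟨f, hf⟩ := (mem_map_iff hk).mp x.2
    exact ⟨f, Subtype.ext (Subtype.ext ((hΨ f).trans hf.symm))⟩

theorem isMalnormal_map (v : QuarterVertex) :
    IsMalnormal ((edgeGroup k v).map (vonDyckHom k)) := by
  intro g hg h hh hgh
  rw [mem_map_iff_treeGroup hk] at hg hh hgh
  obtain ⟨m, hm, hgm⟩ := exists_word_of_mem g.2
  obtain ⟨s, hs⟩ : ∃ s, gauge k v = refl k s := ⟨_, rfl⟩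
  have hw : word k ([s] ++ m ++ [s]) = gauge k v * g * (gauge k v)⁻¹ := by
    rw [word_append, word_append, word_singleton, hgm, hs, refl_inv]
  have h1 := treeGroup_malnormal hk ([s] ++ m ++ [s]) (by
    simp only [List.length_append, List.length_singleton]
    obtain ⟨r, hr⟩ := hm
    exact ⟨r + 1, by omega⟩) (by rw [hw]; exact hg) hh (by
      rw [hw]
      convert hgh using 1
      rw [Subgroup.coe_mul, Subgroup.coe_mul, Subgroup.coe_inv]
      group)
  apply Subtype.ext
  have h2 : (h : Space ≃ₗ[ℝ] Space) =
      (gauge k v)⁻¹ * (gauge k v * h * (gauge k v)⁻¹) * gauge k v := by group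
  rw [h2, h1, Subgroup.coe_one]; group

/-- Vertices of the graph correspond injectively to cosets, and paths act on cosets through their
labels. If the label of μ₁ followed by μ₂ fell into the image of C, the end of μ₁ and the start of
μ₂ would have the same coset and hence coincide. -/
theorem separates_map (v : QuarterVertex) :
    Separates (vonDyckHom k) (edgeGroup k v) (triangleOppressiveSet k v) := by
  let q : (Space ≃ₗ[ℝ] Space) → Quotient (QuotientGroup.rightRel (treeGroup k true)) :=
    Quotient.mk _
  have hq : ∀ a b, q a = q b ↔ b * a⁻¹ ∈ treeGroup k true := by
    intro a b
    rw [Quotient.eq, QuotientGroup.rightRel_apply]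
  obtain ⟨f, hf⟩ : ∃ f : BarVertex k → Quotient (QuotientGroup.rightRel (treeGroup k true)),
      ∀ s, f (Quot.mk _ s) = q (place k s) := by
    refine ⟨Quot.lift (fun s => q (place k s)) ?_, fun s => rfl⟩
    rintro s t ⟨v, hs, ht⟩
    exact (hq _ _).mpr (place_equiv hk ht hs)
  have hmul : ∀ a b c, q a = q b → q (a * c) = q (b * c) := by
    intro a b c h
    rw [hq] at h ⊢
    convert h using 1
    group
  have hinj : ∀ y y', f y = f y' → y = y' := by
    intro y y'
    induction y using Quot.ind with
    | _ s =>
    induction y' using Quot.ind with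
    | _ t =>
    rw [hf, hf, hq]
    exact fun h => (place_injective hk h).symm
  have hstep : ∀ (e : CycleVertex k) g, f ((barGraph k).src e) = q g ↔
      f ((barGraph k).tgt e) = q (g * quotientHom k (FreeGroup.of e.1)) := by
    intro e g
    simp only [barGraph]
    rw [hf, hf, place_add_one hk, quotientHom_of]
    refine ⟨hmul _ _ _, fun h => ?_⟩
    have := hmul _ _ ((rot k e.1)⁻¹ ^ 2)⁻¹ h
    rwa [mul_inv_cancel_right, mul_inv_cancel_right] at this
  have hwalk : ∀ w y y' g, (barGraph k).IsWalk y w y' → f y = q g →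
      f y' = q (g * quotientHom k (FreeGroup.map Sigma.fst (FreeGroup.mk w))) := by
    intro w
    induction w with
    | nil =>
      intro y y' g hw hy
      obtain rfl : y = y' := hw
      rw [← FreeGroup.one_eq_mk, map_one, map_one, mul_one, hy]
    | cons a w ih =>
      intro y y' g hw hy
      obtain ⟨e, b⟩ := a
      obtain ⟨rfl, h2⟩ := hw
      rw [mk_cons, map_mul, map_mul, ← mul_assoc]
      refine ih _ _ _ h2 ?_
      cases b
      · simp only [Bool.false_eq_true, if_false, map_inv, FreeGroup.map.of, OGraph.start,
          OGraph.finish] at hy ⊢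
        rw [hstep, inv_mul_cancel_right, hy]
      · simp only [if_true, FreeGroup.map.of, OGraph.start, OGraph.finish] at hy ⊢
        exact (hstep _ _).mp hy
  have hbase : f (toBarVertex k v) = q (gauge k v) := by
    obtain ⟨i, s⟩ := v
    cases s <;> simp [toBarVertex, gauge, hf, place]
  rintro g ⟨μ₁, μ₂, y₁, y₂, ⟨h1, -, -⟩, h2, hne, rfl⟩ hmem
  have h2' : (barGraph k).IsWalk y₂ μ₂ (toBarVertex k v) := by
    rcases h2 with ⟨rfl, rfl⟩ | ⟨h, -⟩
    · rfl
    · exact h.1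
  obtain ⟨a, ha⟩ : ∃ a, f y₂ = q a := ⟨(f y₂).out, (Quotient.out_eq _).symm⟩
  have h3 := hwalk _ _ _ _ h2' ha
  have h4 := hwalk _ _ _ _ h1.1 hbase
  rw [hbase] at h3
  rw [mem_map_iff_treeGroup hk, coe_vonDyckHom, map_mul] at hmem
  refine hne (hinj _ _ ?_)
  rw [h4, ha]
  have h5 := (hq _ _).mp h3
  rw [hq]
  convert mul_mem h5 (inv_mem hmem) using 1
  group

theorem sum_one_div_lt : ∑ i, (1 : ℝ) / ((2 * k i + 1 : ℕ) : ℝ) < 1 := by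
  have h : ∀ i, (1 : ℝ) / ((2 * k i + 1 : ℕ) : ℝ) ≤ 1 / 5 := by
    intro i
    have h1 : (5 : ℝ) ≤ ((2 * k i + 1 : ℕ) : ℝ) := by
      have := hk i
      exact_mod_cast (by omega : 5 ≤ 2 * k i + 1)
    exact one_div_le_one_div_of_le (by norm_num) h1
  rw [Fin.sum_univ_three]
  linarith [h 0, h 1, h 2]

end Large

end TriangleGroup

open TriangleGroup in
theorem mainTheorem8 (k : Fin 3 → ℕ) (hk : ∀ i, 2 ≤ k i) :
    (∑ i, (1 : ℝ) / ((2 * k i + 1 : ℕ) : ℝ) < 1) ∧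
    ∃ φ : FreeGroup (Fin 3) →* vonDyckGroup (fun i => 2 * k i + 1),
      Function.Surjective φ ∧
      ∀ v : QuarterVertex,
        Nonempty ((edgeGroup k v).map φ ≃* FreeGroup (Fin 2)) ∧
        IsMalnormal ((edgeGroup k v).map φ) ∧
        Separates φ (edgeGroup k v) (triangleOppressiveSet k v) ∧
        ∀ (w : List (QuarterEdge × Bool)) (hw : quarterGraph.IsWalk v w (deckVertex v)),
          ∃ βbar : MulAut ((edgeGroup k v).map φ),
            ∀ (h : quarterGraph.fundGroup v) (c : (edgeGroup k v).map φ),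
              (c : vonDyckGroup fun i => 2 * k i + 1) = φ (edgeGroupHom k v h) →
              (βbar c : vonDyckGroup fun i => 2 * k i + 1) =
                φ (edgeGroupHom k v (twist v w hw h)) := by
  refine ⟨sum_one_div_lt hk, vonDyckHom k, vonDyckHom_surjective hk, fun v => ?_⟩
  obtain ⟨Ψ, hΨ⟩ := exists_mulEquiv hk v
  refine ⟨⟨Ψ.symm⟩, isMalnormal_map hk v, separates_map hk v, fun w hw => ?_⟩
  have hval : ∀ h : quarterGraph.fundGroup v,
      ((Ψ (edgeClass h) : vonDyckGroup fun i => 2 * k i + 1)) =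
        vonDyckHom k (edgeGroupHom k v h) := fun h =>
    Subtype.ext ((hΨ _).trans (quotientHom_fundGroup hk h.2).symm)
  -- The class of the path corrected by the gauge of its end: in the free group, β becomes inversion
  -- of the generators followed by conjugation by `d`.
  let d := edgeClass (FreeGroup.mk w) * (letter (v.1 - 1))⁻¹
  refine ⟨Ψ.symm.trans ((inversion.trans (MulAut.conj d)).trans Ψ), fun h c hc => ?_⟩
  obtain rfl : c = Ψ (edgeClass h) := Subtype.ext (hc.trans (hval h).symm)
  rw [← hval]
  congr 1
  have htwist : edgeClass (twist v w hw h : FreeGroup QuarterEdge) =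
      d * inversion (edgeClass h) * d⁻¹ := by
    obtain ⟨h, u, hu, rfl⟩ := h
    change edgeClass (deckConj w (FreeGroup.mk u)) = _
    rw [deckConj_apply, map_mul, map_mul, edgeClass_deck hu, map_inv]
    simp only [d]
    group
  rw [htwist]
  simp [MulAut.conj_apply]
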